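/- **Setting.** Let $d\in\{1,2,3\}$, let $\mathscr O\subset\mathbb R^d$ be a nonempty bounded open set, $H=L^2(\mathscr O)$ with norm $\|\cdot\|$ and inner product $\langle\cdot,\cdot\rangle$, $\dot H^1=H^1_0(\mathscr O)$ (the $H^1$-closure of $C_c^\infty(\mathscr O)$), $\dot H^{-1}=(\dot H^1)^*$, $A$ the Dirichlet Laplacian, and $\lambda_1$ the first (smallest) eigenvalue of $-A$. Let $f:\mathbb R\to\mathbb R$ be differentiable, and let $L_1,\dots,L_5\in\mathbb R$ and $q\ge1$ (with $q\le 3$ if $d=3$) be such that for all $\xi,\eta\in\mathbb R$ $$(f(\xi)-f(\eta))(\xi-\eta)\le L_1(\xi-\eta)^2,\qquad f(\xi)\xi\le L_2|\xi|^2+L_3,\qquad |f'(\xi)|\le L_4|\xi|^{q-1}+L_5 ,$$ and let $F(x)(\xi)=f(x(\xi))$ be its Nemytskii operator. Let $\mathbf Q$ be a self-adjoint, positive definite, trace-class operator on $H$ with orthonormal eigenbasis $(g_k)$ and eigenvalues $q_k>0$, let $W$ be an $H$-valued $\mathbf Q$-Wiener process on a filtered probability space, $W(t)=\sum_k\sqrt{q_k}\,\beta_k(t)g_k$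 with independent Brownian motions $\beta_k$, and let $\|T\|_{\mathcal L_2^0}^2=\sum_k q_k\|Tg_k\|^2$ be the squared Hilbert--Schmidt norm of $T:\mathbf Q^{1/2}H\to H$. For $g:\mathbb R\to\mathbb R$ let $G(x)g_k(\xi)=g(x(\xi))g_k(\xi)$ define $G:H\to\mathcal L_2^0$, and suppose that for some constants $L_6,L_7,L_8\ge0$ and all $x,y\in H$ $$\|G(x)-G(y)\|^2_{\mathcal L_2^0}\le L_6\|x-y\|^2,\qquad \|G(x)\|^2_{\mathcal L_2^0}\le L_7\|x\|^2+L_8 .$$ For $\tau\in(0,1)$ and $t_m=m\tau$, the drift-implicit Euler scheme started at $x\in H$ is the adapted process $(X^x_m)_{m\in\mathbb N}$ with $X^x_0=x$, $X^x_{m+1}\in\dot H^1$ and, almost surely as an identity in $\dot H^{-1}$, $$X^x_{m+1}=X^x_m+\tau AX^x_{m+1}+\tau F(X^x_{m+1})+G(X^x_m)\,(W(t_{m+1})-W(t_m)),\qquad m\in\mathbb N. \tag{DIE}$$ Put $P_m\phi(x)=\mathbb E\,\phi(X_m^x)$. A probability measure $\mu$ on $H$ is invariant if $\int_H P_m\phi\,d\mu=\int_H\phi\,d\mu$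 for all $m\in\mathbb N$ and all bounded continuous $\phi:H\to\mathbb R$. **Theorem.** Assume that $\max\{L_1+L_6/2,\;L_2+L_7/2\}<\lambda_1$. Then for every $\tau\in(0,1)$ and every $x\in H$ the scheme (DIE) has an almost surely unique solution $(X_m^x)_{m\in\mathbb N}$, and (DIE) has a unique invariant measure $\pi_\tau$ on $H$. Moreover $\int_H\|y\|\,\pi_\tau(dy)<\infty$, and $\pi_\tau$ is exponentially mixing: for all $m\in\mathbb N$, $x\in H$ and all bounded Lipschitz functions $\phi:H\to\mathbb R$, $$\Big|P_m\phi(x)-\int_H\phi\,d\pi_\tau\Big|\le e^{-\gamma_6t_m/2}\,|\phi|_{\rm Lip}\int_H\|x-y\|\,\pi_\tau(dy),$$ where $|\phi|_{\rm Lip}=\sup_{x\ne y}|\phi(x)-\phi(y)|/\|x-y\|$ and $\gamma_6=\dfrac{2(\lambda_1-L_1)-L_6}{2(\lambda_1-L_1)+1}>0$ does not depend on $\tau$. -/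

import Mathlib

open MeasureTheory ProbabilityTheory Filter Topology
open scoped NNReal ENNReal BoundedContinuousFunction RealInnerProductSpace

noncomputable section

namespace DIE

/-- The Euclidean space `ℝᵈ`. -/
abbrev E (d : ℕ) : Type := EuclideanSpace ℝ (Fin d)

/-- `H = L²(O)`. -/
abbrev H {d : ℕ} (O : Set (E d)) : Type := Lp ℝ 2 (volume.restrict O)

/-- `L²(O; ℝᵈ)`, the space of gradients. -/
abbrev HVec {d : ℕ} (O : Set (E d)) : Type := Lp (E d) 2 (volume.restrict O)

/-- `H` carries its Borel `σ`-algebra. -/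
instance instMeasurableSpaceH {d : ℕ} (O : Set (E d)) : MeasurableSpace (H O) := borel _

instance instBorelSpaceH {d : ℕ} (O : Set (E d)) : BorelSpace (H O) := ⟨rfl⟩

/-! ### The Dirichlet Laplacian -/

/-- The pairs `(φ, ∇φ)` with `φ ∈ C_c^∞(O)`, seen in `L²(O) × L²(O; ℝᵈ)`. -/
def testPairs {d : ℕ} (O : Set (E d)) : Set (H O × HVec O) :=
  {z | ∃ φ : E d → ℝ, ContDiff ℝ ((⊤ : ℕ∞) : WithTop ℕ∞) φ ∧ HasCompactSupport φ ∧ tsupport φ ⊆ O ∧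
    z.1 =ᵐ[volume.restrict O] φ ∧ z.2 =ᵐ[volume.restrict O] gradient φ}

/-- `u ∈ Ḣ¹(O) = H¹₀(O)` with weak gradient `p`: the pair `(u, p)` lies in the closure of
`{(φ, ∇φ) : φ ∈ C_c^∞(O)}` in `L² × L²`, i.e. `u` is in the `H¹`-closure of `C_c^∞(O)`. -/
def IsH1Zero {d : ℕ} (O : Set (E d)) (u : H O) (p : HVec O) : Prop :=
  (u, p) ∈ closure (testPairs O)

/-- `lam` is an eigenvalue of the (negative) Dirichlet Laplacian `-A` on `O`: there is
`0 ≠ u ∈ Ḣ¹` with `⟨∇u, ∇v⟩ = lam ⟨u, v⟩` for all `v ∈ Ḣ¹`. -/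
def IsDirichletEigenvalue {d : ℕ} (O : Set (E d)) (lam : ℝ) : Prop :=
  ∃ (u : H O) (p : HVec O), IsH1Zero O u p ∧ u ≠ 0 ∧
    ∀ (v : H O) (r : HVec O), IsH1Zero O v r → ⟪p, r⟫ = lam * ⟪u, v⟫

/-- The first eigenvalue `λ₁` of the Dirichlet Laplacian on `O`. -/
def lambda1 {d : ℕ} (O : Set (E d)) : ℝ := sInf {lam | IsDirichletEigenvalue O lam}

/-! ### Assumptions on the coefficients -/

/-- The conditions on the drift function `f`, with constants `L₁, …, L₅` and growth exponent `q`;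
the restriction `q ≤ 3` for `d = 3` ensures `Ḣ¹ ⊆ L^{2q}`. -/
structure DriftAssumption (d : ℕ) (f : ℝ → ℝ) (L₁ L₂ L₃ L₄ L₅ q : ℝ) : Prop where
  differentiable : Differentiable ℝ f
  one_le_q : 1 ≤ q
  q_le_three : d = 3 → q ≤ 3
  monotone : ∀ ξ η : ℝ, (f ξ - f η) * (ξ - η) ≤ L₁ * (ξ - η) ^ 2
  coercive : ∀ ξ : ℝ, f ξ * ξ ≤ L₂ * |ξ| ^ 2 + L₃
  deriv_growth : ∀ ξ : ℝ, |deriv f ξ| ≤ L₄ * |ξ| ^ (q - 1) + L₅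

/-- The covariance operator `Q` of the noise (self-adjoint, positive definite and trace class),
given by its spectral decomposition `Q h = ∑ₖ qₖ ⟨gₖ, h⟩ gₖ`. -/
structure Covariance {d : ℕ} (O : Set (E d)) where
  /-- the orthonormal basis `(gₖ)` of eigenvectors of `Q` -/
  basis : HilbertBasis ℕ ℝ (H O)
  /-- the eigenvalues `(qₖ)` of `Q` -/
  eig : ℕ → ℝ
  eig_pos : ∀ k, 0 < eig k
  summable_eig : Summable eig

/-- The squared Hilbert–Schmidt norm `‖T‖²_{HS(H₀; H)} = ∑ₖ ‖T (√qₖ gₖ)‖² = ∑ₖ qₖ ‖T gₖ‖²`, where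
`H₀ = Q^{1/2} H` has the orthonormal basis `(√qₖ gₖ)`; the operator `T` is represented by the
sequence `k ↦ T gₖ`, and it is Hilbert–Schmidt if and only if the value is finite. -/
def hsNormSq {d : ℕ} {O : Set (E d)} (Q : Covariance O) (T : ℕ → H O) : ℝ≥0∞ :=
  ∑' k, ENNReal.ofReal (Q.eig k) * ‖T k‖ₑ ^ 2

/-- `G` is the Nemytskii operator associated with `g`, with `G x k` standing for `G(x) gₖ`:
`(G(x) gₖ)(ξ) = g(x(ξ)) gₖ(ξ)`. -/
def IsNemytskii {d : ℕ} {O : Set (E d)} (Q : Covariance O) (g : ℝ → ℝ)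
    (G : H O → ℕ → H O) : Prop :=
  ∀ (x : H O) (k : ℕ),
    G x k =ᵐ[volume.restrict O] fun ξ => g (x ξ) * Q.basis k ξ

/-- Lipschitz continuity and linear growth of `G : H → HS(H₀; H)`. -/
structure DiffusionAssumption {d : ℕ} {O : Set (E d)} (Q : Covariance O)
    (G : H O → ℕ → H O) (L₆ L₇ L₈ : ℝ) : Prop where
  L₆_nonneg : 0 ≤ L₆
  L₇_nonneg : 0 ≤ L₇
  L₈_nonneg : 0 ≤ L₈
  lipschitz : ∀ x y : H O,
    hsNormSq Q (fun k => G x k - G y k) ≤ ENNReal.ofReal (L₆ * ‖x - y‖ ^ 2)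
  growth : ∀ x : H O, hsNormSq Q (G x) ≤ ENNReal.ofReal (L₇ * ‖x‖ ^ 2 + L₈)

/-! ### The noise and the scheme -/

/-- `W` is an `H`-valued `Q`-Wiener process on the filtered probability space `(Ω, 𝓕, P)`, with the
expansion `W(t) = ∑ₖ √qₖ βₖ(t) gₖ` in mutually independent Brownian motions `βₖ`. -/
structure IsQWiener {d : ℕ} {O : Set (E d)} (Q : Covariance O) {Ω : Type*}
    {mΩ : MeasurableSpace Ω} (𝓕 : Filtration ℝ≥0 mΩ) (P : Measure Ω)
    (W : ℝ≥0 → Ω → H O) : Prop where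
  adapted : ∀ t, StronglyMeasurable[𝓕 t] (W t)
  indep_increment : ∀ s t, s ≤ t →
    Indep (MeasurableSpace.comap (fun ω => W t ω - W s ω) inferInstance) (𝓕 s) P
  continuous_paths : ∀ᵐ ω ∂P, Continuous fun t => W t ω
  expansion : ∃ β : ℕ → ℝ≥0 → Ω → ℝ,
    (∀ k, IsBrownianReal (β k) P) ∧
    iIndepFun (fun (k : ℕ) (ω : Ω) (t : ℝ≥0) => β k t ω) P ∧
    ∀ t, ∀ᵐ ω ∂P, HasSum (fun k => (√(Q.eig k) * β k t ω) • Q.basis k) (W t ω)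

/-- `Z` is the random variable `G(X) δ`, for random `X, δ : Ω → H`: the limit in probability of
`∑_{k < n} ⟨gₖ, δ⟩ G(X) gₖ`. -/
def IsNoiseTerm {d : ℕ} {O : Set (E d)} (Q : Covariance O) (G : H O → ℕ → H O) {Ω : Type*}
    {mΩ : MeasurableSpace Ω} (P : Measure Ω) (X δ Z : Ω → H O) : Prop :=
  TendstoInMeasure P
    (fun (n : ℕ) ω => ∑ k ∈ Finset.range n, ⟪Q.basis k, δ ω⟫ • G (X ω) k) atTop Z

/-- One step of the drift-implicit Euler scheme: `y ∈ Ḣ¹` and `y = x + τ A y + τ F(y) + z` in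
`Ḣ⁻¹ = (Ḣ¹)*`, where `F` is the Nemytskii operator of `f`. -/
def IsStep {d : ℕ} (O : Set (E d)) (f : ℝ → ℝ) (τ : ℝ) (x z y : H O) : Prop :=
  ∃ p : HVec O, IsH1Zero O y p ∧
    ∀ (v : H O) (r : HVec O), IsH1Zero O v r →
      Integrable (fun ξ => f (y ξ) * v ξ) (volume.restrict O) ∧
      ⟪y, v⟫ = ⟪x, v⟫ - τ * ⟪p, r⟫ + τ * (∫ ξ in O, f (y ξ) * v ξ) + ⟪z, v⟫

/-- `X = (X_m)` is an adapted solution of the drift-implicit Euler scheme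
`X_{m+1} = X_m + τ A X_{m+1} + τ F(X_{m+1}) + G(X_m) (W(t_{m+1}) - W(t_m))`, `t_m = m τ`,
starting from `X_0 = x`. -/
structure IsSolution {d : ℕ} {O : Set (E d)} (Q : Covariance O) (f : ℝ → ℝ)
    (G : H O → ℕ → H O) (τ : ℝ≥0) {Ω : Type*} {mΩ : MeasurableSpace Ω}
    (𝓕 : Filtration ℝ≥0 mΩ) (P : Measure Ω) (W : ℝ≥0 → Ω → H O)
    (x : H O) (X : ℕ → Ω → H O) : Prop where
  initial : ∀ᵐ ω ∂P, X 0 ω = x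
  adapted : ∀ m : ℕ, StronglyMeasurable[𝓕 (m * τ)] (X m)
  step : ∀ m : ℕ, ∃ Z : Ω → H O,
    IsNoiseTerm Q G P (X m) (fun ω => W ((m + 1 : ℕ) * τ) ω - W (m * τ) ω) Z ∧
    ∀ᵐ ω ∂P, IsStep O f τ (X m ω) (Z ω) (X (m + 1) ω)

/-! ### Semigroup, invariant measures, mixing -/

/-- `P_m φ (x) = 𝔼 φ(X_m^x)` for a family `X x = (X_m^x)_m` of processes indexed by `x ∈ H`. -/
def semigroup {d : ℕ} {O : Set (E d)} {Ω : Type*} {mΩ : MeasurableSpace Ω} (P : Measure Ω)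
    (X : H O → ℕ → Ω → H O) (m : ℕ) (φ : H O → ℝ) (x : H O) : ℝ :=
  ∫ ω, φ (X x m ω) ∂P

/-- A probability measure `μ` on `H` is invariant: `∫ P_m φ dμ = ∫ φ dμ` for all `m` and all bounded
continuous `φ`. -/
def IsInvariantMeasure {d : ℕ} {O : Set (E d)} {Ω : Type*} {mΩ : MeasurableSpace Ω}
    (P : Measure Ω) (X : H O → ℕ → Ω → H O) (μ : Measure (H O)) : Prop :=
  IsProbabilityMeasure μ ∧
    ∀ (m : ℕ) (φ : H O →ᵇ ℝ), ∫ x, semigroup P X m φ x ∂μ = ∫ x, φ x ∂μ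

/-- The class `Lip_b(H)` of bounded Lipschitz functions. -/
def IsLipB {d : ℕ} {O : Set (E d)} (φ : H O → ℝ) : Prop :=
  (∃ K : ℝ≥0, LipschitzWith K φ) ∧ ∃ C : ℝ, ∀ x, |φ x| ≤ C

/-- `|φ|_Lip = sup_{x ≠ y} |φ(x) - φ(y)| / ‖x - y‖`. -/
def lipSeminorm {d : ℕ} {O : Set (E d)} (φ : H O → ℝ) : ℝ :=
  sSup {r | ∃ x y : H O, x ≠ y ∧ r = |φ x - φ y| / ‖x - y‖}

/-- The rate `γ₆ = (2 (λ₁ - L₁) - L₆) / (2 (λ₁ - L₁) + 1)`. -/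
def gamma6 (lam L₁ L₆ : ℝ) : ℝ := (2 * (lam - L₁) - L₆) / (2 * (lam - L₁) + 1)

end DIE

end

open DIE

/-!
One implicit step is the map `S` sending `w` to the solution `y ∈ Ḣ¹` of `y - τ A y - τ F(y) = w`.
Up to a quadratic term, the primitive of `f` makes it the Euler–Lagrange equation of a functional
that is strongly convex because `L₁ < λ₁`, so minimisation yields `S`; testing the difference of two
equations with the difference of their solutions gives `Lip S ≤ (1 + τ (λ₁ - L₁))⁻¹`. The increments
of `W` are centred and independent of the past, so by Itô's isometry one step of the scheme contracts
mean squares by `(1 + τ L₆) / (1 + τ (λ₁ - L₁))²`, which is at most `exp (-γ₆ τ)`. Two solutions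
driven by the same noise therefore approach each other exponentially fast. The same contraction
bounds the second moments uniformly in time, hence, `S` mapping balls into relatively compact sets
by Rellich's theorem, the laws of `X_m` are tight; contraction makes them converge to the invariant
measure.
-/

namespace DIE

section Jensen

theorem sq_lintegral_le {α : Type*} {mα : MeasurableSpace α} {μ : Measure α}
    [IsProbabilityMeasure μ] {g : α → ℝ≥0∞} (hg : AEMeasurable g μ) :
    (∫⁻ x, g x ∂μ) ^ 2 ≤ ∫⁻ x, g x ^ 2 ∂μ := by
  have hölder := ENNReal.lintegral_mul_le_Lp_mul_Lq μ Real.HolderConjugate.two_two hg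
    (aemeasurable_const (b := (1 : ℝ≥0∞)))
  simp only [Pi.mul_apply, mul_one, lintegral_const, measure_univ, ENNReal.rpow_two,
    one_pow, ENNReal.one_rpow] at hölder
  calc (∫⁻ x, g x ∂μ) ^ 2 ≤ ((∫⁻ x, g x ^ 2 ∂μ) ^ (1 / 2 : ℝ)) ^ 2 := by gcongr
    _ = ∫⁻ x, g x ^ 2 ∂μ := by rw [← ENNReal.rpow_natCast, ← ENNReal.rpow_mul]; norm_num

theorem enorm_sub_setAverage_sq_le {α F : Type*} {mα : MeasurableSpace α} [NormedAddCommGroup F]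
    [NormedSpace ℝ F] [CompleteSpace F] {μ : Measure α} {s : Set α} (hs₀ : μ s ≠ 0)
    (hs : μ s ≠ ∞) {φ : α → F} (hφ : IntegrableOn φ s μ) (c : F) :
    ‖c - ⨍ y in s, φ y ∂μ‖ₑ ^ 2 ≤ (μ s)⁻¹ * ∫⁻ y in s, ‖φ y - c‖ₑ ^ 2 ∂μ := by
  have : IsFiniteMeasure (μ.restrict s) := ⟨by simpa using hs.lt_top⟩
  have : IsProbabilityMeasure (μ[|s]) := cond_isProbabilityMeasure_of_finite hs₀ hs
  have hφ' : Integrable φ (μ[|s]) := hφ.integrable.smul_measure (ENNReal.inv_ne_top.2 hs₀)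
  have average_eq_cond : ⨍ y in s, φ y ∂μ = ∫ y, φ y ∂μ[|s] := by
    rw [average, Measure.restrict_apply_univ, ProbabilityTheory.cond]
  have sub_average : (⨍ y in s, φ y ∂μ) - c = ∫ y, (φ y - c) ∂μ[|s] := by
    rw [integral_sub hφ' (integrable_const c), average_eq_cond]
    simp
  calc ‖c - ⨍ y in s, φ y ∂μ‖ₑ ^ 2 ≤ (∫⁻ y, ‖φ y - c‖ₑ ∂μ[|s]) ^ 2 := by
        rw [enorm_sub_rev, sub_average]
        gcongr
        exact enorm_integral_le_lintegral_enorm _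
    _ ≤ ∫⁻ y, ‖φ y - c‖ₑ ^ 2 ∂μ[|s] :=
        sq_lintegral_le (hφ'.sub (integrable_const c)).aestronglyMeasurable.enorm
    _ = (μ s)⁻¹ * ∫⁻ y in s, ‖φ y - c‖ₑ ^ 2 ∂μ := by
        rw [ProbabilityTheory.cond, lintegral_smul_measure, smul_eq_mul]

end Jensen

section Translation

variable {V F : Type*} [NormedAddCommGroup V] [NormedSpace ℝ V] [NormedAddCommGroup F]
  [NormedSpace ℝ F]

theorem enorm_add_sub_sq_le_lintegral_fderiv [CompleteSpace F] {φ : V → F} (hφ : ContDiff ℝ 1 φ)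
    (x k : V) :
    ‖φ (x + k) - φ x‖ₑ ^ 2 ≤
      ‖k‖ₑ ^ 2 * ∫⁻ t in Set.Ioc (0 : ℝ) 1, ‖fderiv ℝ φ (x + t • k)‖ₑ ^ 2 := by
  have : IsProbabilityMeasure (volume.restrict (Set.Ioc (0 : ℝ) 1)) := ⟨by simp⟩
  have hderiv (t : ℝ) :
      HasDerivAt (fun s : ℝ => φ (x + s • k)) (fderiv ℝ φ (x + t • k) k) t := by
    have hline : HasDerivAt (fun s : ℝ => x + s • k) k t := by
      simpa using ((hasDerivAt_id t).smul_const k).const_add x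
    exact (hφ.differentiable one_ne_zero _).hasFDerivAt.comp_hasDerivAt t hline
  have hfderiv : Continuous fun t : ℝ => fderiv ℝ φ (x + t • k) :=
    (hφ.continuous_fderiv one_ne_zero).comp (by fun_prop)
  have hftc : φ (x + k) - φ x = ∫ t in Set.Ioc (0 : ℝ) 1, fderiv ℝ φ (x + t • k) k := by
    have := intervalIntegral.integral_eq_sub_of_hasDerivAt (a := 0) (b := 1)
      (fun t _ => hderiv t) ((hfderiv.clm_apply continuous_const).intervalIntegrable 0 1)
    rw [← intervalIntegral.integral_of_le zero_le_one, this]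
    simp only [one_smul, zero_smul, add_zero]
  calc ‖φ (x + k) - φ x‖ₑ ^ 2
      ≤ (∫⁻ t in Set.Ioc (0 : ℝ) 1, ‖fderiv ℝ φ (x + t • k) k‖ₑ) ^ 2 := by
        rw [hftc]; gcongr; exact enorm_integral_le_lintegral_enorm _
    _ ≤ (∫⁻ t in Set.Ioc (0 : ℝ) 1, ‖fderiv ℝ φ (x + t • k)‖ₑ * ‖k‖ₑ) ^ 2 := by
        gcongr with t; exact ContinuousLinearMap.le_opENorm _ _
    _ = ‖k‖ₑ ^ 2 * (∫⁻ t in Set.Ioc (0 : ℝ) 1, ‖fderiv ℝ φ (x + t • k)‖ₑ) ^ 2 := by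
        rw [lintegral_mul_const _ hfderiv.enorm.measurable, mul_pow, mul_comm]
    _ ≤ ‖k‖ₑ ^ 2 * ∫⁻ t in Set.Ioc (0 : ℝ) 1, ‖fderiv ℝ φ (x + t • k)‖ₑ ^ 2 := by
        gcongr; exact sq_lintegral_le hfderiv.enorm.measurable.aemeasurable

theorem lintegral_add_sub_sq_le_lintegral_fderiv [CompleteSpace F] [MeasurableSpace V]
    [BorelSpace V] [SecondCountableTopology V] {μ : Measure V} [SFinite μ]
    [μ.IsAddRightInvariant] {φ : V → F} (hφ : ContDiff ℝ 1 φ) (k : V) :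
    ∫⁻ x, ‖φ (x + k) - φ x‖ₑ ^ 2 ∂μ ≤ ‖k‖ₑ ^ 2 * ∫⁻ x, ‖fderiv ℝ φ x‖ₑ ^ 2 ∂μ := by
  have hmeas : Measurable fun z : V × ℝ => ‖fderiv ℝ φ (z.1 + z.2 • k)‖ₑ ^ 2 := by
    have : Continuous fun z : V × ℝ => fderiv ℝ φ (z.1 + z.2 • k) :=
      (hφ.continuous_fderiv one_ne_zero).comp (by fun_prop)
    exact this.enorm.measurable.pow_const 2
  calc ∫⁻ x, ‖φ (x + k) - φ x‖ₑ ^ 2 ∂μ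
      ≤ ∫⁻ x, (‖k‖ₑ ^ 2 * ∫⁻ t in Set.Ioc (0 : ℝ) 1, ‖fderiv ℝ φ (x + t • k)‖ₑ ^ 2) ∂μ :=
        lintegral_mono fun x => enorm_add_sub_sq_le_lintegral_fderiv hφ x k
    _ = ‖k‖ₑ ^ 2 * ∫⁻ t in Set.Ioc (0 : ℝ) 1, (∫⁻ x, ‖fderiv ℝ φ (x + t • k)‖ₑ ^ 2 ∂μ) := by
        rw [lintegral_const_mul' _ _ (by simp), lintegral_lintegral_swap hmeas.aemeasurable]
    _ = ‖k‖ₑ ^ 2 * ∫⁻ x, ‖fderiv ℝ φ x‖ₑ ^ 2 ∂μ := by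
        simp_rw [lintegral_add_right_eq_self (μ := μ) (fun x => ‖fderiv ℝ φ x‖ₑ ^ 2)]
        simp

end Translation

section Cells

variable {d : ℕ} {h : ℝ}

/-- The half-open cube with index `k` in the grid of mesh `h`. -/
def cell (h : ℝ) (k : Fin d → ℤ) : Set (E d) :=
  {x | ∀ i, h * k i ≤ x i ∧ x i < h * (k i + 1)}

/-- The index of the grid cell that contains `x`; meaningful for `0 < h`. -/
noncomputable def cellIndex (h : ℝ) (x : E d) : Fin d → ℤ := fun i => ⌊x i / h⌋

/-- The open sup-norm ball of radius `h` about the origin of the Euclidean space. -/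
def box (d : ℕ) (h : ℝ) : Set (E d) := {z | ∀ i, |z i| < h}

/-- The average of `φ` over the cell with index `k`. -/
noncomputable def cellAverage (h : ℝ) (φ : E d → ℝ) (k : Fin d → ℤ) : ℝ := ⨍ y in cell h k, φ y

theorem mem_cell_iff (hh : 0 < h) {x : E d} {k : Fin d → ℤ} :
    x ∈ cell h k ↔ cellIndex h x = k := by
  simp only [cell, cellIndex, Set.mem_ofPred_eq, funext_iff, Int.floor_eq_iff, le_div_iff₀ hh,
    div_lt_iff₀ hh, mul_comm h]

theorem measurableSet_cell (k : Fin d → ℤ) : MeasurableSet (cell h k) := by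
  simp only [cell, Set.ofPred_forall]
  refine MeasurableSet.iInter fun i => ?_
  have hi : Measurable fun x : E d => x i := by fun_prop
  exact (measurableSet_le measurable_const hi).inter (measurableSet_lt hi measurable_const)

theorem measurableSet_box : MeasurableSet (box d h) := by
  simp only [box, Set.ofPred_forall]
  exact MeasurableSet.iInter fun _ => measurableSet_lt (by fun_prop) measurable_const

theorem volume_cell (k : Fin d → ℤ) : volume (cell h k) = ENNReal.ofReal h ^ d := by
  have hpi : ((MeasurableEquiv.toLp 2 (Fin d → ℝ)).symm.symm ⁻¹' cell h k) =
      Set.pi Set.univ fun i => Set.Ico (h * k i) (h * (k i + 1)) := by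
    ext x; simp [cell]
  rw [← (EuclideanSpace.volume_preserving_symm_measurableEquiv_toLp (Fin d)).symm
    |>.measure_preimage_equiv (cell h k), hpi, Real.volume_pi_Ico]
  simp [mul_add]

theorem volume_box : volume (box d h) = ENNReal.ofReal (2 * h) ^ d := by
  have hpi : ((MeasurableEquiv.toLp 2 (Fin d → ℝ)).symm.symm ⁻¹' box d h) =
      Set.pi Set.univ fun _ => Set.Ioo (-h) h := by
    ext x; simp [box, abs_lt]
  rw [← (EuclideanSpace.volume_preserving_symm_measurableEquiv_toLp (Fin d)).symm
    |>.measure_preimage_equiv (box d h), hpi, Real.volume_pi_Ioo]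
  simp [two_mul]

theorem enorm_sq_le_of_mem_box {z : E d} (hz : z ∈ box d h) :
    ‖z‖ₑ ^ 2 ≤ ENNReal.ofReal (d * h ^ 2) := by
  rw [← ofReal_norm, ← ENNReal.ofReal_pow (norm_nonneg _), EuclideanSpace.norm_sq_eq]
  refine ENNReal.ofReal_le_ofReal ?_
  calc ∑ i, ‖z i‖ ^ 2 ≤ ∑ _i : Fin d, h ^ 2 :=
        Finset.sum_le_sum fun i _ => pow_le_pow_left₀ (norm_nonneg _) (hz i).le 2
    _ = d * h ^ 2 := by simp

theorem sub_mem_box {k : Fin d → ℤ} {x y : E d} (hx : x ∈ cell h k) (hy : y ∈ cell h k) :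
    y - x ∈ box d h := by
  intro i
  rw [PiLp.sub_apply, abs_lt]
  constructor <;> linarith [hx i, hy i]

theorem enorm_sub_cellAverage_sq_le (hh : 0 < h) {φ : E d → ℝ} (hφ : Integrable φ) (x : E d) :
    ‖φ x - cellAverage h φ (cellIndex h x)‖ₑ ^ 2 ≤
      (ENNReal.ofReal h ^ d)⁻¹ * ∫⁻ z in box d h, ‖φ (x + z) - φ x‖ₑ ^ 2 := by
  set C := cell h (cellIndex h x)
  have hx : x ∈ C := (mem_cell_iff hh).2 rfl
  have hjensen : ‖φ x - ⨍ y in C, φ y‖ₑ ^ 2 ≤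
      (volume C)⁻¹ * ∫⁻ y in C, ‖φ y - φ x‖ₑ ^ 2 :=
    enorm_sub_setAverage_sq_le (by simp [C, volume_cell, hh]) (by simp [C, volume_cell])
      hφ.integrableOn (φ x)
  rw [volume_cell] at hjensen
  refine hjensen.trans (mul_le_mul_right ?_ _)
  calc ∫⁻ y in C, ‖φ y - φ x‖ₑ ^ 2
      = ∫⁻ z, C.indicator (fun y => ‖φ y - φ x‖ₑ ^ 2) (x + z) := by
        rw [lintegral_add_left_eq_self (C.indicator fun y => ‖φ y - φ x‖ₑ ^ 2) x,
          lintegral_indicator (measurableSet_cell _)]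
    _ ≤ ∫⁻ z, (box d h).indicator (fun z => ‖φ (x + z) - φ x‖ₑ ^ 2) z := by
        refine lintegral_mono fun z => Set.indicator_apply_le' (fun hz => ?_) fun _ => zero_le
        rw [Set.indicator_of_mem (by simpa using sub_mem_box hx hz)]
    _ = ∫⁻ z in box d h, ‖φ (x + z) - φ x‖ₑ ^ 2 := lintegral_indicator measurableSet_box _

theorem lintegral_sub_cellAverage_sq_le (hh : 0 < h) {φ : E d → ℝ} (hφ : ContDiff ℝ 1 φ)
    (hφi : Integrable φ) :
    ∫⁻ x, ‖φ x - cellAverage h φ (cellIndex h x)‖ₑ ^ 2 ≤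
      ENNReal.ofReal (2 ^ d * d * h ^ 2) * ∫⁻ x, ‖fderiv ℝ φ x‖ₑ ^ 2 := by
  have hvol : ENNReal.ofReal h ^ d ≠ 0 := pow_ne_zero _ (by simpa using hh)
  set I := ∫⁻ x, ‖fderiv ℝ φ x‖ₑ ^ 2
  calc ∫⁻ x, ‖φ x - cellAverage h φ (cellIndex h x)‖ₑ ^ 2
      ≤ ∫⁻ x, (ENNReal.ofReal h ^ d)⁻¹ * ∫⁻ z in box d h, ‖φ (x + z) - φ x‖ₑ ^ 2 :=
        lintegral_mono (enorm_sub_cellAverage_sq_le hh hφi)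
    _ = (ENNReal.ofReal h ^ d)⁻¹ * ∫⁻ z in box d h, ∫⁻ x, ‖φ (x + z) - φ x‖ₑ ^ 2 := by
        rw [lintegral_const_mul' _ _ (by simpa using hvol), lintegral_lintegral_swap]
        have : Continuous fun z : E d × E d => φ (z.1 + z.2) - φ z.1 := by
          have := hφ.continuous; fun_prop
        exact (this.enorm.measurable.pow_const 2).aemeasurable
    _ ≤ (ENNReal.ofReal h ^ d)⁻¹ * ∫⁻ z in box d h, ENNReal.ofReal (d * h ^ 2) * I := by
        refine mul_le_mul_right (setLIntegral_mono measurable_const fun z hz => ?_) _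
        refine (lintegral_add_sub_sq_le_lintegral_fderiv hφ z).trans ?_
        gcongr
        exact enorm_sq_le_of_mem_box hz
    _ = ((ENNReal.ofReal h ^ d)⁻¹ * ENNReal.ofReal h ^ d) *
          (ENNReal.ofReal 2 ^ d * ENNReal.ofReal (d * h ^ 2) * I) := by
        rw [setLIntegral_const, volume_box, ENNReal.ofReal_mul zero_le_two, mul_pow]
        ring
    _ = ENNReal.ofReal (2 ^ d * d * h ^ 2) * I := by
        rw [ENNReal.inv_mul_cancel hvol (by simp), one_mul, mul_assoc (2 ^ d : ℝ),
          ENNReal.ofReal_mul (p := 2 ^ d) (by positivity), ENNReal.ofReal_pow zero_le_two]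

end Cells

section TotallyBounded

theorem totallyBounded_of_finiteDimensional_approx {X : Type*} [NormedAddCommGroup X]
    [NormedSpace ℝ X] {S : Set X} (hS : Bornology.IsBounded S)
    (happrox : ∀ ε > 0, ∃ F : Submodule ℝ X, FiniteDimensional ℝ F ∧
      ∀ u ∈ S, Metric.infDist u F < ε) :
    TotallyBounded S := by
  rw [Metric.totallyBounded_iff]
  intro ε hε
  obtain ⟨R, hR⟩ := hS.exists_norm_le
  obtain ⟨F, hF, hdist⟩ := happrox (ε / 2) (half_pos hε)
  have hcompact : IsCompact (F.subtypeL '' Metric.closedBall (0 : F) (R + ε / 2)) :=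
    (isCompact_closedBall _ _).image F.subtypeL.continuous
  obtain ⟨t, ht, hcover⟩ := Metric.totallyBounded_iff.1 hcompact.totallyBounded _ (half_pos hε)
  refine ⟨t, ht, fun u hu => ?_⟩
  obtain ⟨w, hwF, huw⟩ := (Metric.infDist_lt_iff F.nonempty).1 (hdist u hu)
  have hw : ‖w‖ ≤ R + ε / 2 := by
    rw [dist_comm, dist_eq_norm] at huw
    linarith [norm_le_norm_add_norm_sub' w u, hR u hu]
  obtain ⟨y, hy, hwy⟩ := Set.mem_iUnion₂.1 (hcover ⟨⟨w, hwF⟩, by simpa using hw, rfl⟩)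
  refine Set.mem_iUnion₂.2 ⟨y, hy, ?_⟩
  calc dist u y ≤ dist u w + dist w y := dist_triangle _ _ _
    _ < ε / 2 + ε / 2 := add_lt_add huw hwy
    _ = ε := add_halves ε

end TotallyBounded

section Norms

theorem enorm_sq_eq_ofReal {X : Type*} [SeminormedAddCommGroup X] (x : X) :
    ‖x‖ₑ ^ 2 = ENNReal.ofReal (‖x‖ ^ 2) := by
  rw [← ofReal_norm, ENNReal.ofReal_pow (norm_nonneg _)]

theorem eLpNorm_two_sq {F α : Type*} [NormedAddCommGroup F] {mα : MeasurableSpace α}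
    {μ : Measure α} (u : α → F) : eLpNorm u 2 μ ^ 2 = ∫⁻ x, ‖u x‖ₑ ^ 2 ∂μ := by
  simpa using eLpNorm_nnreal_pow_eq_lintegral (f := u) (μ := μ) (p := 2) two_ne_zero

theorem enorm_sq_eq_lintegral {F α : Type*} [NormedAddCommGroup F] {mα : MeasurableSpace α}
    {μ : Measure α} (u : Lp F 2 μ) : ‖u‖ₑ ^ 2 = ∫⁻ x, ‖u x‖ₑ ^ 2 ∂μ := by
  rw [Lp.enorm_def, eLpNorm_two_sq]

end Norms

section Gradient

variable {X : Type*} [NormedAddCommGroup X] [InnerProductSpace ℝ X] [CompleteSpace X]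
  {φ ψ : X → ℝ}

theorem gradient_add (hφ : Differentiable ℝ φ) (hψ : Differentiable ℝ ψ) :
    gradient (φ + ψ) = gradient φ + gradient ψ := by
  ext1 x
  simp only [gradient, Pi.add_apply, fderiv_add (hφ x) (hψ x), map_add]

theorem gradient_const_smul (hφ : Differentiable ℝ φ) (c : ℝ) :
    gradient (c • φ) = c • gradient φ := by
  ext1 x
  simp only [gradient, Pi.smul_apply, fderiv_const_smul (hφ x), map_smulₛₗ, conj_trivial]

theorem enorm_gradient (φ : X → ℝ) (x : X) : ‖gradient φ x‖ₑ = ‖fderiv ℝ φ x‖ₑ := by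
  rw [← ofReal_norm, ← ofReal_norm, gradient, LinearIsometryEquiv.norm_map]

theorem support_gradient_subset (φ : X → ℝ) : Function.support (gradient φ) ⊆ tsupport φ :=
  fun x hx => support_fderiv_subset ℝ fun h0 => hx (by rw [gradient, h0, map_zero])

end Gradient

variable {d : ℕ} {O : Set (E d)}

section H1Zero

/-- The linear subspace of `L²(O) × L²(O; ℝᵈ)` formed by the pairs `(φ, ∇φ)` of test functions. -/
noncomputable def testSubmodule (O : Set (E d)) : Submodule ℝ (H O × HVec O) where
  carrier := testPairs O
  zero_mem' := by
    refine ⟨0, contDiff_const, HasCompactSupport.zero, by simp, Lp.coeFn_zero _ _ _, ?_⟩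
    rw [show (0 : E d → ℝ) = Function.const _ 0 from rfl, gradient_const']
    exact Lp.coeFn_zero _ _ _
  add_mem' := by
    rintro _ _ ⟨φ, hφ, hφc, hφO, hφu, hφp⟩ ⟨ψ, hψ, hψc, hψO, hψu, hψp⟩
    refine ⟨φ + ψ, hφ.add hψ, hφc.add hψc, (tsupport_add φ ψ).trans (Set.union_subset hφO hψO),
      (Lp.coeFn_add _ _).trans (hφu.add hψu), ?_⟩
    rw [gradient_add (hφ.differentiable (by simp)) (hψ.differentiable (by simp))]
    exact (Lp.coeFn_add _ _).trans (hφp.add hψp)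
  smul_mem' := by
    rintro c _ ⟨φ, hφ, hφc, hφO, hφu, hφp⟩
    refine ⟨c • φ, contDiff_const.smul hφ, hφc.smul_left (f := fun _ => c),
      (tsupport_smul_subset_right (fun _ => c) φ).trans hφO,
      (Lp.coeFn_smul _ _).trans (hφu.const_smul c), ?_⟩
    rw [gradient_const_smul (hφ.differentiable (by simp))]
    exact (Lp.coeFn_smul _ _).trans (hφp.const_smul c)

/-- The Hilbert space `H¹₀(O)`, realised as the closed subspace of the pairs `(u, ∇u)` in
`L²(O) × L²(O; ℝᵈ)`. -/
noncomputable def h1Zero (O : Set (E d)) : Submodule ℝ (H O × HVec O) :=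
  (testSubmodule O).topologicalClosure

theorem isClosed_h1Zero : IsClosed (h1Zero O : Set (H O × HVec O)) :=
  Submodule.isClosed_topologicalClosure _

theorem IsH1Zero.mem_of_isClosed {C : Set (H O × HVec O)} {u : H O} {p : HVec O}
    (hup : IsH1Zero O u p) (hC : IsClosed C) (htest : testPairs O ⊆ C) : (u, p) ∈ C :=
  closure_minimal htest hC hup

variable {u v : H O} {p r : HVec O}

theorem IsH1Zero.add (hu : IsH1Zero O u p) (hv : IsH1Zero O v r) : IsH1Zero O (u + v) (p + r) :=
  (h1Zero O).add_mem hu hv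

theorem IsH1Zero.sub (hu : IsH1Zero O u p) (hv : IsH1Zero O v r) : IsH1Zero O (u - v) (p - r) :=
  (h1Zero O).sub_mem hu hv

theorem IsH1Zero.smul (hu : IsH1Zero O u p) (c : ℝ) : IsH1Zero O (c • u) (c • p) :=
  (h1Zero O).smul_mem c hu

theorem enorm_sq_eq_lintegral_fderiv {φ : E d → ℝ} (hφ : tsupport φ ⊆ O)
    (hp : p =ᵐ[volume.restrict O] gradient φ) : ‖p‖ₑ ^ 2 = ∫⁻ x, ‖fderiv ℝ φ x‖ₑ ^ 2 := by
  have hsupp : (Function.support fun x => ‖gradient φ x‖ₑ ^ 2) ⊆ O := fun x hx => by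
    refine hφ (support_gradient_subset φ fun h0 : gradient φ x = 0 => hx ?_)
    change ‖gradient φ x‖ₑ ^ 2 = 0
    rw [h0, enorm_zero, zero_pow two_ne_zero]
  calc ‖p‖ₑ ^ 2
    _ = ∫⁻ x in O, ‖p x‖ₑ ^ 2 := enorm_sq_eq_lintegral p
    _ = ∫⁻ x in O, ‖gradient φ x‖ₑ ^ 2 :=
      lintegral_congr_ae (hp.mono fun x hx => by simp only [hx])
    _ = ∫⁻ x, ‖gradient φ x‖ₑ ^ 2 := setLIntegral_eq_of_support_subset hsupp
    _ = ∫⁻ x, ‖fderiv ℝ φ x‖ₑ ^ 2 := by simp only [enorm_gradient]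

end H1Zero

section Rellich

theorem isFiniteMeasure_restrict (hOb : Bornology.IsBounded O) :
    IsFiniteMeasure (volume.restrict O) :=
  ⟨by simpa using hOb.measure_lt_top⟩

theorem finite_image_cellIndex (hOb : Bornology.IsBounded O) {h : ℝ} (hh : 0 < h) :
    (cellIndex h '' O).Finite := by
  obtain ⟨R, hR⟩ := hOb.exists_norm_le
  refine (Set.finite_Icc (fun _ => ⌊-(R / h)⌋) fun _ => ⌊R / h⌋).subset ?_
  rintro _ ⟨x, hx, rfl⟩
  have hxi (i : Fin d) : |x i / h| ≤ R / h := by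
    rw [abs_div, abs_of_pos hh]
    gcongr
    exact (PiLp.norm_apply_le x i).trans (hR x hx)
  exact ⟨fun i => Int.floor_mono (abs_le.1 (hxi i)).1, fun i => Int.floor_mono (abs_le.1 (hxi i)).2⟩

section CellIndicator

variable [IsFiniteMeasure (volume.restrict O)]

/-- The indicator function of a grid cell, as an element of `L²(O)`. -/
noncomputable def cellIndicator (O : Set (E d)) [IsFiniteMeasure (volume.restrict O)] (h : ℝ)
    (k : Fin d → ℤ) : H O :=
  indicatorConstLp 2 (measurableSet_cell (h := h) k) (measure_ne_top _ _) 1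

theorem coeFn_sum_smul_cellIndicator (hO : MeasurableSet O) {h : ℝ} (hh : 0 < h)
    {s : Finset (Fin d → ℤ)} (hs : ∀ x ∈ O, cellIndex h x ∈ s) (a : (Fin d → ℤ) → ℝ) :
    ⇑(∑ k ∈ s, a k • cellIndicator O h k) =ᵐ[volume.restrict O] fun x => a (cellIndex h x) := by
  have hterm (k : Fin d → ℤ) : ∀ᵐ x ∂volume.restrict O,
      (a k • cellIndicator O h k : H O) x = a k * (cell h k).indicator (fun _ => 1) x := by
    filter_upwards [Lp.coeFn_smul (a k) (cellIndicator O h k), indicatorConstLp_coeFn (p := 2)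
      (hs := measurableSet_cell (h := h) k) (hμs := measure_ne_top (volume.restrict O) _)
      (c := (1 : ℝ))] with x hsmul hindicator
    rw [hsmul, Pi.smul_apply, cellIndicator, hindicator, smul_eq_mul]
  filter_upwards [Lp.coeFn_finsetSum s fun k => a k • cellIndicator O h k, ae_all_iff.2 hterm,
    ae_restrict_mem hO] with x hsum hx hxO
  rw [hsum, Finset.sum_apply, Finset.sum_congr rfl fun k _ => hx k,
    Finset.sum_eq_single_of_mem _ (hs x hxO)]
  · simp [(mem_cell_iff hh).2 (rfl : cellIndex h x = _)]
  · intro k _ hk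
    rw [Set.indicator_of_notMem fun hxk => hk ((mem_cell_iff hh).1 hxk).symm, mul_zero]

theorem exists_mem_span_cellIndicator_norm_sub_le (hO : MeasurableSet O) {h : ℝ} (hh : 0 < h)
    {s : Finset (Fin d → ℤ)} (hs : ∀ x ∈ O, cellIndex h x ∈ s) {u : H O} {p : HVec O}
    (hup : (u, p) ∈ testPairs O) :
    ∃ w ∈ Submodule.span ℝ (cellIndicator O h '' s), ‖u - w‖ ≤ √(2 ^ d * d) * h * ‖p‖ := by
  obtain ⟨φ, hφ, hφc, hφO, hu, hp⟩ := hup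
  set w : H O := ∑ k ∈ s, cellAverage h φ k • cellIndicator O h k
  have hw : w =ᵐ[volume.restrict O] fun x => cellAverage h φ (cellIndex h x) :=
    coeFn_sum_smul_cellIndicator hO hh hs _
  refine ⟨w, Submodule.sum_mem _ fun k hk => Submodule.smul_mem _ _
    (Submodule.subset_span ⟨k, hk, rfl⟩), ?_⟩
  have hsq : ‖u - w‖ₑ ^ 2 ≤ ENNReal.ofReal (2 ^ d * d * h ^ 2) * ‖p‖ₑ ^ 2 := by
    calc ‖u - w‖ₑ ^ 2 = ∫⁻ x in O, ‖φ x - cellAverage h φ (cellIndex h x)‖ₑ ^ 2 := by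
          rw [enorm_sq_eq_lintegral]
          refine lintegral_congr_ae ?_
          filter_upwards [hu, hw, Lp.coeFn_sub u w] with x hux hwx hsub
          rw [hsub, Pi.sub_apply, hux, hwx]
      _ ≤ ∫⁻ x, ‖φ x - cellAverage h φ (cellIndex h x)‖ₑ ^ 2 := setLIntegral_le_lintegral _ _
      _ ≤ ENNReal.ofReal (2 ^ d * d * h ^ 2) * ‖p‖ₑ ^ 2 := by
          rw [enorm_sq_eq_lintegral_fderiv hφO hp]
          exact lintegral_sub_cellAverage_sq_le hh (hφ.of_le (by simp))
            (hφ.continuous.integrable_of_hasCompactSupport hφc)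
  rw [enorm_sq_eq_ofReal, enorm_sq_eq_ofReal, ← ENNReal.ofReal_mul (by positivity),
    ENNReal.ofReal_le_ofReal_iff (by positivity)] at hsq
  refine (abs_le_of_sq_le_sq' ?_ (by positivity)).2
  rwa [mul_pow, mul_pow, Real.sq_sqrt (by positivity)]

end CellIndicator

theorem exists_finiteDimensional_infDist_le (hO : MeasurableSet O) (hOb : Bornology.IsBounded O)
    {ε : ℝ} (hε : 0 < ε) :
    ∃ F : Submodule ℝ (H O), FiniteDimensional ℝ F ∧
      ∀ u p, IsH1Zero O u p → Metric.infDist u F ≤ ε * ‖p‖ := by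
  have := isFiniteMeasure_restrict hOb
  obtain ⟨h, hh, hhε⟩ : ∃ h > 0, √(2 ^ d * d) * h ≤ ε := by
    refine ⟨ε / (√(2 ^ d * d) + 1), by positivity, ?_⟩
    rw [← mul_div_assoc, div_le_iff₀ (by positivity), mul_comm]
    gcongr
    linarith
  let s := (finite_image_cellIndex hOb hh).toFinset
  let F := Submodule.span ℝ (cellIndicator O h '' s)
  refine ⟨F, FiniteDimensional.span_of_finite ℝ (s.finite_toSet.image _), fun u p hup => ?_⟩
  refine hup.mem_of_isClosed (C := {z | Metric.infDist z.1 F ≤ ε * ‖z.2‖})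
    (isClosed_le ((Metric.continuous_infDist_pt _).comp continuous_fst) (by fun_prop)) ?_
  rintro ⟨v, r⟩ hvr
  obtain ⟨w, hw, hvw⟩ := exists_mem_span_cellIndicator_norm_sub_le hO hh
    (s := s) (fun x hx => by simpa [s] using ⟨x, hx, rfl⟩) hvr
  calc Metric.infDist v F ≤ dist v w := Metric.infDist_le_dist_of_mem hw
    _ ≤ √(2 ^ d * d) * h * ‖r‖ := by rwa [dist_eq_norm]
    _ ≤ ε * ‖r‖ := by gcongr

theorem totallyBounded_h1Zero_ball (hO : MeasurableSet O) (hOb : Bornology.IsBounded O) (R : ℝ) :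
    TotallyBounded {u : H O | ∃ p, IsH1Zero O u p ∧ ‖u‖ ≤ R ∧ ‖p‖ ≤ R} := by
  refine totallyBounded_of_finiteDimensional_approx
    (isBounded_iff_forall_norm_le.2 ⟨R, fun u ⟨_, _, hu, _⟩ => hu⟩) fun ε hε => ?_
  obtain ⟨F, hF, hdist⟩ := exists_finiteDimensional_infDist_le hO hOb
    (ε := ε / (|R| + 1)) (by positivity)
  refine ⟨F, hF, fun u ⟨p, hup, _, hp⟩ => (hdist u p hup).trans_lt ?_⟩
  rw [div_mul_eq_mul_div, div_lt_iff₀ (by positivity)]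
  gcongr
  linarith [le_abs_self R]

theorem isCompact_closure_h1Zero_ball (hO : MeasurableSet O) (hOb : Bornology.IsBounded O)
    (R : ℝ) : IsCompact (closure {u : H O | ∃ p, IsH1Zero O u p ∧ ‖u‖ ≤ R ∧ ‖p‖ ≤ R}) :=
  (totallyBounded_h1Zero_ball hO hOb R).closure.isCompact_of_isClosed isClosed_closure

end Rellich

theorem cauchySeq_of_dist_sq_le {X : Type*} [PseudoMetricSpace X] {u : ℕ → X} {b : ℕ × ℕ → ℝ}
    (hb : Tendsto b atTop (𝓝 0)) (h : ∀ n m, dist (u n) (u m) ^ 2 ≤ b (n, m)) : CauchySeq u := by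
  refine cauchySeq_iff_tendsto_dist_atTop_0.2 (squeeze_zero (fun _ => dist_nonneg)
    (fun n => Real.le_sqrt_of_sq_le (h n.1 n.2)) ?_)
  simpa using hb.sqrt

theorem tendsto_add_prod_atTop {a : ℕ → ℝ} (ha : Tendsto a atTop (𝓝 0)) :
    Tendsto (fun n : ℕ × ℕ => a n.1 + a n.2) atTop (𝓝 0) := by
  rw [← prod_atTop_atTop_eq]
  simpa using (ha.comp tendsto_fst).add (ha.comp tendsto_snd)

theorem eq_zero_of_forall_nonneg_quadratic {b c : ℝ} (h : ∀ t : ℝ, 0 ≤ 2 * b * t + c * t ^ 2) :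
    b = 0 := by
  have hdiscrim : discrim c (2 * b) 0 ≤ 0 :=
    discrim_le_zero fun t => by linarith [h t, pow_two t]
  rw [discrim, mul_zero, sub_zero] at hdiscrim
  nlinarith [sq_nonneg b]

section Poincare

variable {d : ℕ} {O : Set (E d)} {u : H O} {p : HVec O}

/-- The pairs `(u, ∇u)` with `u ∈ H¹₀(O)` of unit norm in `L²(O)`. -/
def h1Sphere (O : Set (E d)) : Set (H O × HVec O) := {z | IsH1Zero O z.1 z.2 ∧ ‖z.1‖ = 1}

/-- The infimum of the Rayleigh quotient over `H¹₀(O)`, that is, of `‖∇u‖²` over the unit sphere of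
`L²(O)`. -/
noncomputable def rayleighInf (O : Set (E d)) : ℝ := sInf ((fun z => ‖z.2‖ ^ 2) '' h1Sphere O)

theorem bddBelow_rayleigh : BddBelow ((fun z => ‖z.2‖ ^ 2) '' h1Sphere O) :=
  ⟨0, Set.forall_mem_image.2 fun _ _ => sq_nonneg _⟩

theorem IsH1Zero.normalize_mem_h1Sphere (h : IsH1Zero O u p) (hu : u ≠ 0) :
    (‖u‖⁻¹ • u, ‖u‖⁻¹ • p) ∈ h1Sphere O :=
  ⟨h.smul _, norm_smul_inv_norm hu⟩

theorem rayleighInf_mul_norm_sq_le (h : IsH1Zero O u p) :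
    rayleighInf O * ‖u‖ ^ 2 ≤ ‖p‖ ^ 2 := by
  rcases eq_or_ne u 0 with rfl | hu
  · simp
  have hle : rayleighInf O ≤ ‖‖u‖⁻¹ • p‖ ^ 2 :=
    csInf_le bddBelow_rayleigh ⟨_, h.normalize_mem_h1Sphere hu, rfl⟩
  rwa [norm_smul, norm_inv, norm_norm, inv_mul_eq_div, div_pow, le_div_iff₀ (by positivity)] at hle

theorem norm_sub_sq_le_of_h1Sphere {z z' : H O × HVec O} (hz : z ∈ h1Sphere O)
    (hz' : z' ∈ h1Sphere O) :
    ‖z.2 - z'.2‖ ^ 2 ≤ 2 * (‖z.2‖ ^ 2 - rayleighInf O) + 2 * (‖z'.2‖ ^ 2 - rayleighInf O) +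
      rayleighInf O * ‖z.1 - z'.1‖ ^ 2 := by
  have hsum := rayleighInf_mul_norm_sq_le (hz.1.add hz'.1)
  have hlaw₁ := parallelogram_law_with_norm ℝ z.1 z'.1
  have hlaw₂ := parallelogram_law_with_norm ℝ z.2 z'.2
  rw [hz.2, hz'.2] at hlaw₁
  linear_combination hsum + hlaw₂ - rayleighInf O * hlaw₁

theorem exists_rayleigh_minimizer (hO : MeasurableSet O) (hOb : Bornology.IsBounded O)
    (hne : (h1Sphere O).Nonempty) : ∃ z ∈ h1Sphere O, ‖z.2‖ ^ 2 = rayleighInf O := by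
  obtain ⟨s, -, hs, hmem⟩ := exists_seq_tendsto_sInf (hne.image _) bddBelow_rayleigh
  choose z hz hzs using hmem
  obtain ⟨R, hR⟩ := hs.bddAbove_range
  have hball (n : ℕ) : (z n).1 ∈ closure {v : H O | ∃ r, IsH1Zero O v r ∧ ‖v‖ ≤ max 1 √R ∧
      ‖r‖ ≤ max 1 √R} :=
    subset_closure ⟨(z n).2, (hz n).1, (hz n).2.trans_le (le_max_left _ _),
      le_max_of_le_right (Real.le_sqrt_of_sq_le ((hzs n).trans_le (hR ⟨n, rfl⟩)))⟩
  obtain ⟨v, -, φ, hφ, hv⟩ := (isCompact_closure_h1Zero_ball hO hOb _).tendsto_subseq hball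
  have hsφ : Tendsto (fun n => ‖(z (φ n)).2‖ ^ 2) atTop (𝓝 (rayleighInf O)) := by
    simpa only [hzs] using! hs.comp hφ.tendsto_atTop
  have hcauchy : CauchySeq fun n => (z (φ n)).2 := by
    refine cauchySeq_of_dist_sq_le (b := fun n => (2 * (‖(z (φ n.1)).2‖ ^ 2 - rayleighInf O) +
      2 * (‖(z (φ n.2)).2‖ ^ 2 - rayleighInf O)) +
      rayleighInf O * dist (z (φ n.1)).1 (z (φ n.2)).1 ^ 2) ?_ fun n m => ?_
    · have hgap : Tendsto (fun n => 2 * (‖(z (φ n)).2‖ ^ 2 - rayleighInf O)) atTop (𝓝 0) := by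
        simpa using (hsφ.sub_const (rayleighInf O)).const_mul 2
      have hdist := cauchySeq_iff_tendsto_dist_atTop_0.1 hv.cauchySeq
      simpa using (tendsto_add_prod_atTop hgap).add ((hdist.pow 2).const_mul (rayleighInf O))
    · simpa only [dist_eq_norm] using norm_sub_sq_le_of_h1Sphere (hz (φ n)) (hz (φ m))
  obtain ⟨r, hr⟩ := cauchySeq_tendsto_of_complete hcauchy
  refine ⟨(v, r), ⟨?_, ?_⟩, tendsto_nhds_unique (hr.norm.pow 2) hsφ⟩
  · exact isClosed_h1Zero.mem_of_tendsto (hv.prodMk_nhds hr)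
      (Eventually.of_forall fun n => (hz _).1)
  · exact tendsto_nhds_unique hv.norm (by simp [(hz _).2])

theorem isDirichletEigenvalue_rayleighInf (hO : MeasurableSet O) (hOb : Bornology.IsBounded O)
    (hne : (h1Sphere O).Nonempty) : IsDirichletEigenvalue O (rayleighInf O) := by
  obtain ⟨⟨u, p⟩, ⟨hup : IsH1Zero O u p, hu : ‖u‖ = 1⟩, hp : ‖p‖ ^ 2 = _⟩ :=
    exists_rayleigh_minimizer hO hOb hne
  refine ⟨u, p, hup, norm_ne_zero_iff.1 (hu.trans_ne one_ne_zero), fun v r hvr => ?_⟩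
  rw [← sub_eq_zero]
  refine eq_zero_of_forall_nonneg_quadratic (c := ‖r‖ ^ 2 - rayleighInf O * ‖v‖ ^ 2) fun t => ?_
  have hmin := rayleighInf_mul_norm_sq_le (hup.add (hvr.smul t))
  simp only [norm_add_sq_real, norm_smul, mul_pow, inner_smul_right, hu, hp, Real.norm_eq_abs,
    sq_abs] at hmin
  linear_combination hmin

theorem IsDirichletEigenvalue.nonneg {lam : ℝ} (h : IsDirichletEigenvalue O lam) : 0 ≤ lam := by
  obtain ⟨u, p, hup, hu, heq⟩ := h
  have hself := heq u p hup
  rw [real_inner_self_eq_norm_sq, real_inner_self_eq_norm_sq] at hself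
  exact nonneg_of_mul_nonneg_left (hself ▸ sq_nonneg ‖p‖) (by positivity)

theorem lambda1_mul_norm_sq_le (hO : MeasurableSet O) (hOb : Bornology.IsBounded O)
    (h : IsH1Zero O u p) : lambda1 O * ‖u‖ ^ 2 ≤ ‖p‖ ^ 2 := by
  rcases eq_or_ne u 0 with rfl | hu
  · simp
  have hle : lambda1 O ≤ rayleighInf O := csInf_le ⟨0, fun _ => IsDirichletEigenvalue.nonneg⟩
    (isDirichletEigenvalue_rayleighInf hO hOb ⟨_, h.normalize_mem_h1Sphere hu⟩)
  calc lambda1 O * ‖u‖ ^ 2 ≤ rayleighInf O * ‖u‖ ^ 2 := by gcongr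
    _ ≤ ‖p‖ ^ 2 := rayleighInf_mul_norm_sq_le h

end Poincare

section Sobolev

theorem enorm_le_lintegral_fderiv_of_dim_one {φ : E 1 → ℝ} (hφ : ContDiff ℝ 1 φ)
    (hφc : HasCompactSupport φ) (x : E 1) : ‖φ x‖ₑ ≤ ∫⁻ y, ‖fderiv ℝ φ y‖ₑ := by
  let e : ℝ ≃ₗᵢ[ℝ] E 1 := (OrthonormalBasis.singleton (Fin 1) ℝ).repr
  have henorm : ‖e 1‖ₑ = 1 := by
    rw [← ofReal_norm, e.norm_map, norm_one, ENNReal.ofReal_one]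
  have hderiv (t : ℝ) : ‖deriv (φ ∘ e) t‖ₑ ≤ ‖fderiv ℝ φ (e t)‖ₑ := by
    have he : HasDerivAt e (e 1) t := by
      simpa using e.toContinuousLinearEquiv.toContinuousLinearMap.hasDerivAt (x := t)
    rw [((hφ.differentiable one_ne_zero _).hasFDerivAt.comp_hasDerivAt t he).deriv,
      ← mul_one ‖fderiv ℝ φ (e t)‖ₑ, ← henorm]
    exact ContinuousLinearMap.le_opENorm _ _
  calc ‖φ x‖ₑ = ‖(φ ∘ e) (e.symm x)‖ₑ := by simp
    _ ≤ ∫⁻ t in Set.Iic (e.symm x), ‖deriv (φ ∘ e) t‖ₑ :=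
        (hφc.comp_homeomorph e.toHomeomorph).enorm_le_lintegral_Ici_deriv
          (hφ.comp e.contDiff) _
    _ ≤ ∫⁻ t, ‖deriv (φ ∘ e) t‖ₑ := setLIntegral_le_lintegral _ _
    _ ≤ ∫⁻ t, ‖fderiv ℝ φ (e t)‖ₑ := lintegral_mono hderiv
    _ = ∫⁻ y, ‖fderiv ℝ φ y‖ₑ :=
        (OrthonormalBasis.singleton (Fin 1) ℝ).measurePreserving_repr.lintegral_comp
          (hφ.continuous_fderiv one_ne_zero).enorm.measurable

variable {d : ℕ} {O : Set (E d)}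

theorem eLpNorm_le_fderiv_of_dim_one {O : Set (E 1)} {φ : E 1 → ℝ} (hφ : ContDiff ℝ 1 φ)
    (hφc : HasCompactSupport φ) (r : ℝ≥0) :
    eLpNorm φ r (volume.restrict O) ≤
      eLpNorm (fderiv ℝ φ) 1 volume * volume.restrict O Set.univ ^ (1 / (r : ℝ)) := by
  have hHolder := eLpNorm_le_eLpNorm_mul_rpow_measure_univ (μ := volume.restrict O) (p := r)
    (q := ∞) le_top hφ.continuous.aestronglyMeasurable
  simp only [ENNReal.coe_toReal, ENNReal.toReal_top, div_zero, sub_zero] at hHolder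
  refine hHolder.trans ?_
  gcongr
  rw [eLpNorm_exponent_top, eLpNorm_one_eq_lintegral_enorm]
  exact eLpNormEssSup_le_of_ae_enorm_bound
    (ae_of_all _ fun x => enorm_le_lintegral_fderiv_of_dim_one hφ hφc x)

theorem exists_eLpNorm_le_fderiv (hd : 1 ≤ d) (hOb : Bornology.IsBounded O) {r : ℝ≥0}
    (hr : 2 ≤ r) (hdr : (d : ℝ≥0) * r ≤ 2 * (d + r)) :
    ∃ C p : ℝ≥0, 1 ≤ p ∧ p ≤ 2 ∧ ∀ φ : E d → ℝ, ContDiff ℝ 1 φ → HasCompactSupport φ →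
      tsupport φ ⊆ O →
      eLpNorm φ r (volume.restrict O) ≤ C * eLpNorm (fderiv ℝ φ) p volume := by
  have := isFiniteMeasure_restrict hOb
  have hr0 : 0 < r := two_pos.trans_le hr
  obtain rfl | hd2 := hd.eq_or_lt
  · refine ⟨(volume.restrict O Set.univ ^ (1 / (r : ℝ))).toNNReal, 1, le_rfl, one_le_two,
      fun φ hφ hφc _ => ?_⟩
    rw [ENNReal.coe_toNNReal (ENNReal.rpow_ne_top_of_nonneg (by positivity) (measure_ne_top _ _)),
      mul_comm]
    exact eLpNorm_le_fderiv_of_dim_one hφ hφc r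
  · have hd2 : (2 : ℝ≥0) ≤ d := by exact_mod_cast hd2
    -- `p` is the exponent whose Sobolev conjugate is `r`
    set p : ℝ≥0 := d * r / (d + r) with hp
    have hp1 : 1 ≤ p := by
      rw [hp, le_div_iff₀ (by positivity), one_mul]
      have _hdr2 : (2 : ℝ) ≤ d ∧ (2 : ℝ) ≤ r := by exact_mod_cast And.intro hd2 hr
      exact_mod_cast (by nlinarith : (d : ℝ) + r ≤ d * r)
    refine ⟨eLpNormLESNormFDerivOfLeConst ℝ volume O p r, p, hp1, ?_, fun φ hφ _ hφO => ?_⟩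
    · rwa [hp, div_le_iff₀ (by positivity)]
    · refine (eLpNorm_restrict_le _ _ _ _).trans (eLpNorm_le_eLpNorm_fderiv_of_le volume hφ
        ((subset_tsupport φ).trans hφO) hp1 ?_ ?_ hOb)
      · rw [finrank_euclideanSpace_fin, hp, div_lt_iff₀ (by positivity)]
        gcongr
        exact lt_add_of_pos_left _ (by positivity)
      · rw [finrank_euclideanSpace_fin, hp]
        push_cast
        have : (0 : ℝ) < r := hr0
        have : (0 : ℝ) < d := by positivity
        refine le_of_eq ?_
        field_simp
        ring

theorem isClosed_setOf_eLpNorm_fst_le (r : ℝ≥0∞) (C : ℝ≥0) :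
    IsClosed {z : H O × HVec O | eLpNorm z.1 r (volume.restrict O) ≤ C * ‖z.2‖ₑ} := by
  refine isSeqClosed_iff_isClosed.1 fun z w hz hzw => ?_
  have hbound : Tendsto (fun n => (C : ℝ≥0∞) * ‖(z n).2‖ₑ) atTop (𝓝 (C * ‖w.2‖ₑ)) :=
    ENNReal.Tendsto.const_mul ((continuous_enorm.comp continuous_snd).tendsto _ |>.comp hzw)
      (Or.inr ENNReal.coe_ne_top)
  change eLpNorm w.1 r (volume.restrict O) ≤ C * ‖w.2‖ₑ
  refine le_of_forall_gt_imp_ge_of_dense fun c hc => ?_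
  refine eLpNorm_le_of_tendstoInMeasure ?_
    (tendstoInMeasure_of_tendsto_Lp ((continuous_fst.tendsto _).comp hzw))
    fun n => Lp.aestronglyMeasurable _
  filter_upwards [hbound.eventually_lt_const hc] with n hn
  exact (hz n).trans hn.le

theorem eLpNorm_fderiv_le [IsFiniteMeasure (volume.restrict O)] {s : ℝ≥0} (hs : s ≤ 2)
    {φ : E d → ℝ} (hφO : tsupport φ ⊆ O) {p : HVec O} (hp : p =ᵐ[volume.restrict O] gradient φ) :
    eLpNorm (fderiv ℝ φ) s volume ≤
      ‖p‖ₑ * volume.restrict O Set.univ ^ (1 / (s : ℝ) - 1 / 2) := by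
  have hnorm (s : ℝ≥0∞) : eLpNorm p s (volume.restrict O) = eLpNorm (fderiv ℝ φ) s volume := by
    rw [eLpNorm_congr_ae hp,
      eLpNorm_restrict_eq_of_support_subset ((support_gradient_subset φ).trans hφO),
      eLpNorm_congr_enorm_ae (ae_of_all _ (enorm_gradient φ))]
  have hHolder := eLpNorm_le_eLpNorm_mul_rpow_measure_univ (μ := volume.restrict O) (p := s)
    (q := 2) (by exact_mod_cast hs) (Lp.aestronglyMeasurable p)
  rwa [hnorm, ← Lp.enorm_def, ENNReal.coe_toReal, ENNReal.toReal_ofNat] at hHolder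

theorem exists_eLpNorm_le_of_isH1Zero (hd : 1 ≤ d) (hOb : Bornology.IsBounded O) {r : ℝ≥0}
    (hr : 2 ≤ r) (hdr : (d : ℝ≥0) * r ≤ 2 * (d + r)) :
    ∃ C : ℝ≥0, ∀ u p, IsH1Zero O u p → eLpNorm u r (volume.restrict O) ≤ C * ‖p‖ₑ := by
  have := isFiniteMeasure_restrict hOb
  obtain ⟨C, s, hs1, hs2, hC⟩ := exists_eLpNorm_le_fderiv hd hOb hr hdr
  have hexp : (0 : ℝ) ≤ 1 / s - 1 / 2 :=
    sub_nonneg.2 (one_div_le_one_div_of_le (by positivity) (by exact_mod_cast hs2))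
  obtain ⟨D, hD⟩ : ∃ D : ℝ≥0,
      (D : ℝ≥0∞) = volume.restrict O Set.univ ^ (1 / (s : ℝ) - 1 / 2) :=
    ⟨_, ENNReal.coe_toNNReal
      (ENNReal.rpow_ne_top_of_nonneg hexp (measure_ne_top (volume.restrict O) Set.univ))⟩
  refine ⟨C * D, fun u p hup =>
    hup.mem_of_isClosed (isClosed_setOf_eLpNorm_fst_le r (C * D)) ?_⟩
  rintro ⟨v, r'⟩ ⟨φ, hφ, hφc, hφO, hv, hr'⟩
  have hφ1 : ContDiff ℝ 1 φ := hφ.of_le (by simp)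
  calc eLpNorm v r (volume.restrict O)
    _ = eLpNorm φ r (volume.restrict O) := eLpNorm_congr_ae hv
    _ ≤ C * eLpNorm (fderiv ℝ φ) s volume := hC φ hφ1 hφc hφO
    _ ≤ C * (‖r'‖ₑ * D) := by rw [hD]; gcongr; exact eLpNorm_fderiv_le hs2 hφO hr'
    _ = (C * D : ℝ≥0) * ‖r'‖ₑ := by rw [ENNReal.coe_mul]; ring

end Sobolev

section Minimization

-- The midpoint condition makes every minimizing sequence Cauchy.
theorem exists_isMinOn_of_midpoint {X : Type*} [PseudoMetricSpace X] {S : Set X}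
    (hS : IsComplete S) (hne : S.Nonempty) {J : X → ℝ} (hlsc : LowerSemicontinuousOn J S)
    (hbdd : BddBelow (J '' S)) {c : ℝ} (hc : 0 < c)
    (hmid : ∀ z ∈ S, ∀ z' ∈ S, ∃ m ∈ S, c * dist z z' ^ 2 ≤ J z + J z' - 2 * J m) :
    ∃ z ∈ S, IsMinOn J S z := by
  have hinf : ∀ z ∈ S, sInf (J '' S) ≤ J z := fun z hz => csInf_le hbdd ⟨z, hz, rfl⟩
  obtain ⟨s, -, hs, hmem⟩ := exists_seq_tendsto_sInf (hne.image J) hbdd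
  choose z hzS hzs using hmem
  have hcauchy : CauchySeq z := by
    have hgap : Tendsto (fun n => (s n - sInf (J '' S)) / c) atTop (𝓝 0) := by
      simpa using (hs.sub_const (sInf (J '' S))).div_const c
    refine cauchySeq_of_dist_sq_le (tendsto_add_prod_atTop hgap) fun n m => ?_
    obtain ⟨w, hw, hdist⟩ := hmid _ (hzS n) _ (hzS m)
    rw [← add_div, le_div_iff₀' hc, ← hzs, ← hzs]
    linarith [hinf w hw]
  obtain ⟨y, hy, hzy⟩ := cauchySeq_tendsto_of_isComplete hS hzS hcauchy
  have hzy' : Tendsto z atTop (𝓝[S] y) :=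
    tendsto_nhdsWithin_iff.2 ⟨hzy, Eventually.of_forall hzS⟩
  have hle : J y ≤ sInf (J '' S) := by
    refine le_of_forall_lt_imp_le_of_dense fun b hb => ge_of_tendsto hs ?_
    filter_upwards [hzy'.eventually (hlsc y hy b hb)] with n hn
    exact (hzs n ▸ hn).le
  exact ⟨y, hy, fun z' hz' => hle.trans (hinf z' hz')⟩

end Minimization

section LowerSemicontinuity

variable {α F : Type*} [MeasurableSpace α] {μ : Measure α} [NormedAddCommGroup F]
  {p : ℝ≥0∞} [Fact (1 ≤ p)]

theorem lowerSemicontinuous_lintegral_comp {ψ : F → ℝ≥0∞} (hψ : Continuous ψ) :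
    LowerSemicontinuous fun u : Lp F p μ => ∫⁻ x, ψ (u x) ∂μ := by
  intro u b hb
  by_contra hcon
  obtain ⟨v, hvu, hvb⟩ := exists_seq_forall_of_frequently (not_eventually.1 hcon)
  obtain ⟨φ, -, hae⟩ := (tendstoInMeasure_of_tendsto_Lp hvu).exists_seq_tendsto_ae
  have hfatou : ∫⁻ x, ψ (u x) ∂μ ≤ liminf (fun n => ∫⁻ x, ψ (v (φ n) x) ∂μ) atTop := calc
    _ = ∫⁻ x, liminf (fun n => ψ (v (φ n) x)) atTop ∂μ := lintegral_congr_ae <| by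
      filter_upwards [hae] with x hx
      exact ((hψ.tendsto _).comp hx).liminf_eq.symm
    _ ≤ _ := lintegral_liminf_le' fun n =>
      (hψ.comp_aestronglyMeasurable (Lp.aestronglyMeasurable _)).aemeasurable
  have hliminf : liminf (fun n => ∫⁻ x, ψ (v (φ n) x) ∂μ) atTop ≤ b :=
    liminf_le_of_frequently_le' (Frequently.of_forall fun n => not_lt.1 (hvb (φ n)))
  exact (hfatou.trans hliminf).not_gt hb

theorem lowerSemicontinuousOn_integral_comp {ψ : F → ℝ} (hψ : Continuous ψ) (h0 : ∀ y, 0 ≤ ψ y) :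
    LowerSemicontinuousOn (fun u : Lp F p μ => ∫ x, ψ (u x) ∂μ)
      {u | Integrable (fun x => ψ (u x)) μ} := by
  have hlintegral {u : Lp F p μ} (hu : Integrable (fun x => ψ (u x)) μ) :
      ENNReal.ofReal (∫ x, ψ (u x) ∂μ) = ∫⁻ x, ENNReal.ofReal (ψ (u x)) ∂μ :=
    ofReal_integral_eq_lintegral_ofReal hu (ae_of_all _ fun x => h0 _)
  intro u hu b hb
  obtain hb0 | hb0 := lt_or_ge b 0
  · exact Eventually.of_forall fun v => hb0.trans_le (integral_nonneg fun x => h0 _)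
  have hlt : ENNReal.ofReal b < ∫⁻ x, ENNReal.ofReal (ψ (u x)) ∂μ :=
    hlintegral hu ▸ (ENNReal.ofReal_lt_ofReal_iff (hb0.trans_lt hb)).2 hb
  have hlsc : ∀ᶠ v : Lp F p μ in 𝓝 u, ENNReal.ofReal b < ∫⁻ x, ENNReal.ofReal (ψ (v x)) ∂μ :=
    lowerSemicontinuous_lintegral_comp (ENNReal.continuous_ofReal.comp hψ) u _ hlt
  filter_upwards [nhdsWithin_le_nhds hlsc, self_mem_nhdsWithin] with v hv hvint
  rw [← hlintegral hvint] at hv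
  exact lt_of_not_ge fun hle => (ENNReal.ofReal_le_ofReal hle).not_gt hv

end LowerSemicontinuity

section Potential

variable {h : ℝ → ℝ}

/-- The primitive of `h` vanishing at `0`; it is the potential of the nonlinearity `h`. -/
noncomputable def potential (h : ℝ → ℝ) (ξ : ℝ) : ℝ := ∫ t in (0 : ℝ)..ξ, h t

theorem potential_zero : potential h 0 = 0 := intervalIntegral.integral_same

theorem continuous_potential (hc : Continuous h) : Continuous (potential h) :=
  intervalIntegral.continuous_primitive (fun a b => hc.intervalIntegrable a b) 0

theorem potential_sub_le (hm : Monotone h) (a b : ℝ) :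
    potential h b - potential h a ≤ h b * (b - a) := by
  have hint (a b : ℝ) : IntervalIntegrable h volume a b := hm.intervalIntegrable
  rw [potential, potential, intervalIntegral.integral_interval_sub_left (hint 0 b) (hint 0 a)]
  obtain hab | hba := le_total a b
  · calc ∫ t in a..b, h t
      _ ≤ ∫ _ in a..b, h b := intervalIntegral.integral_mono_on hab (hint a b)
        intervalIntegrable_const fun t ht => hm ht.2
      _ = h b * (b - a) := by rw [intervalIntegral.integral_const, smul_eq_mul, mul_comm]
  · rw [intervalIntegral.integral_symm, neg_le]
    calc -(h b * (b - a))
      _ = ∫ _ in b..a, h b := by rw [intervalIntegral.integral_const, smul_eq_mul]; ring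
      _ ≤ ∫ t in b..a, h t := intervalIntegral.integral_mono_on hba intervalIntegrable_const
        (hint b a) fun t ht => hm ht.1

theorem potential_nonneg (hm : Monotone h) (h0 : h 0 = 0) (ξ : ℝ) : 0 ≤ potential h ξ := by
  simpa [potential_zero, h0] using potential_sub_le hm ξ 0

theorem potential_le (hm : Monotone h) (ξ : ℝ) : potential h ξ ≤ h ξ * ξ := by
  simpa [potential_zero] using potential_sub_le hm 0 ξ

theorem potential_midpoint_le (hm : Monotone h) (a b : ℝ) :
    potential h (1 / 2 * (a + b)) ≤ (potential h a + potential h b) / 2 := by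
  linarith [potential_sub_le hm a (1 / 2 * (a + b)), potential_sub_le hm b (1 / 2 * (a + b))]

theorem abs_comp_add_mul_mul_le (hm : Monotone h) (y v : ℝ) {t : ℝ} (ht0 : 0 ≤ t) (ht1 : t ≤ 1) :
    |h (y + t * v) * v| ≤ |h y * v| + |h (y + v) * v| := by
  have hmono (s r : ℝ) (hsr : s ≤ r) : h (y + s * v) * v ≤ h (y + r * v) * v := by
    obtain hv | hv := le_total 0 v
    · exact mul_le_mul_of_nonneg_right (hm (by gcongr)) hv
    · exact mul_le_mul_of_nonpos_right (hm (by nlinarith)) hv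
  have hlower := hmono 0 t ht0
  have hupper := hmono t 1 ht1
  rw [zero_mul, add_zero] at hlower
  rw [one_mul] at hupper
  exact (abs_le_max_abs_abs hlower hupper).trans
    (max_le_add_of_nonneg (abs_nonneg _) (abs_nonneg _))

end Potential

section Integrability

variable {α : Type*} [MeasurableSpace α] {μ : Measure α} [IsFiniteMeasure μ] {h : ℝ → ℝ} {C : ℝ}
  {q : ℝ≥0} {a b : α → ℝ}

theorem rpow_mul_le_rpow_add_rpow {x y s : ℝ} (hx : 0 ≤ x) (hy : 0 ≤ y) (hs : 0 ≤ s) :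
    x ^ s * y ≤ x ^ (s + 1) + y ^ (s + 1) := by
  have hs1 : s + 1 ≠ 0 := by positivity
  rw [Real.rpow_add_one' hx hs1, Real.rpow_add_one' hy hs1]
  obtain hxy | hyx := le_total x y
  · exact (mul_le_mul_of_nonneg_right (Real.rpow_le_rpow hx hxy hs) hy).trans
      (le_add_of_nonneg_left (by positivity))
  · exact (mul_le_mul_of_nonneg_left hyx (by positivity)).trans
      (le_add_of_nonneg_right (by positivity))

theorem integrable_comp_mul (hc : Continuous h) (hgr : ∀ ξ, |h ξ| ≤ C * (1 + |ξ| ^ (q : ℝ)))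
    (ha : MemLp a (q + 1 : ℝ≥0) μ) (hb : MemLp b (q + 1 : ℝ≥0) μ) :
    Integrable (fun x => h (a x) * b x) μ := by
  have hC : 0 ≤ C := nonneg_of_mul_nonneg_left ((abs_nonneg _).trans (hgr 0)) (by positivity)
  have hpow {u : α → ℝ} (hu : MemLp u (q + 1 : ℝ≥0) μ) :
      Integrable (fun x => |u x| ^ (q + 1 : ℝ)) μ := by
    exact hu.integrable_norm_rpow (by simp) ENNReal.coe_ne_top
  have hbint : Integrable b μ := hb.integrable (by simp)
  refine Integrable.mono' ((hbint.abs.add ((hpow ha).add (hpow hb))).const_mul C)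
    ((hc.comp_aestronglyMeasurable ha.1).mul hb.1) (ae_of_all _ fun x => ?_)
  calc ‖h (a x) * b x‖
    _ = |h (a x)| * |b x| := norm_mul _ _
    _ ≤ C * (1 + |a x| ^ (q : ℝ)) * |b x| := by gcongr; exact hgr _
    _ = C * (|b x| + |a x| ^ (q : ℝ) * |b x|) := by ring
    _ ≤ C * (|b x| + (|a x| ^ (q + 1 : ℝ) + |b x| ^ (q + 1 : ℝ))) := by
      gcongr
      exact rpow_mul_le_rpow_add_rpow (abs_nonneg _) (abs_nonneg _) q.2

theorem integrable_potential_comp (hc : Continuous h) (hm : Monotone h) (h0 : h 0 = 0)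
    (hgr : ∀ ξ, |h ξ| ≤ C * (1 + |ξ| ^ (q : ℝ))) (ha : MemLp a (q + 1 : ℝ≥0) μ) :
    Integrable (fun x => potential h (a x)) μ := by
  refine Integrable.mono' (integrable_comp_mul hc hgr ha ha)
    ((continuous_potential hc).comp_aestronglyMeasurable ha.1) (ae_of_all _ fun x => ?_)
  rw [Real.norm_eq_abs, abs_of_nonneg (potential_nonneg hm h0 _)]
  exact potential_le hm _

theorem tendsto_integral_comp_add_mul (hc : Continuous h) (hm : Monotone h)
    (hgr : ∀ ξ, |h ξ| ≤ C * (1 + |ξ| ^ (q : ℝ)))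
    (ha : MemLp a (q + 1 : ℝ≥0) μ) (hb : MemLp b (q + 1 : ℝ≥0) μ) :
    Tendsto (fun t : ℝ => ∫ x, h (a x + t * b x) * b x ∂μ) (𝓝[>] 0)
      (𝓝 (∫ x, h (a x) * b x ∂μ)) := by
  have hunit : ∀ᶠ t : ℝ in 𝓝[>] 0, t ∈ Set.Ioc (0 : ℝ) 1 := Ioc_mem_nhdsGT zero_lt_one
  refine tendsto_integral_filter_of_dominated_convergence
    (fun x => |h (a x) * b x| + |h (a x + b x) * b x|) ?_ ?_ ?_ ?_
  · exact Eventually.of_forall fun t =>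
      (hc.comp_aestronglyMeasurable (ha.1.add (hb.1.const_mul t))).mul hb.1
  · filter_upwards [hunit] with t ht
    exact ae_of_all _ fun x => abs_comp_add_mul_mul_le hm _ _ ht.1.le ht.2
  · exact (integrable_comp_mul hc hgr ha hb).abs.add (integrable_comp_mul hc hgr (ha.add hb) hb).abs
  · refine ae_of_all _ fun x => ?_
    have hcont : Continuous fun t : ℝ => h (a x + t * b x) * b x := by fun_prop
    simpa using (hcont.tendsto 0).mono_left nhdsWithin_le_nhds

end Integrability

section DirichletEnergy

variable {d : ℕ} {O : Set (E d)} {h : ℝ → ℝ} {C α β c : ℝ} {q : ℝ≥0} {w : H O}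

/-- A nondecreasing nonlinearity `h` with `h 0 = 0` and growth exponent `q` small enough for
`H¹₀ ⊆ L^{q+1}`, so that `u ↦ ∫ h(u) v` is defined on `H¹₀` for `v ∈ H¹₀`. -/
structure SubcriticalNonlinearity (d : ℕ) (h : ℝ → ℝ) (C : ℝ) (q : ℝ≥0) : Prop where
  continuous : Continuous h
  monotone : Monotone h
  map_zero : h 0 = 0
  growth : ∀ ξ, |h ξ| ≤ C * (1 + |ξ| ^ (q : ℝ))
  one_le : 1 ≤ q
  subcritical : (d : ℝ≥0) * (q + 1) ≤ 2 * (d + (q + 1))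

/-- The quadratic form `α ‖u‖² + β ‖∇u‖²` is bounded below by `c (‖u‖² + ‖∇u‖²)` on `H¹₀(O)`. -/
def IsCoerciveForm (O : Set (E d)) (α β c : ℝ) : Prop :=
  ∀ u p, IsH1Zero O u p → c * (‖u‖ ^ 2 + ‖p‖ ^ 2) ≤ α * ‖u‖ ^ 2 + β * ‖p‖ ^ 2

/-- The functional `½ (α ‖u‖² + β ‖∇u‖²) + ∫ h̃(u) - ⟨w, u⟩`, with `h̃` the potential of `h`, whose
Euler–Lagrange equation is `α u - β Δu + h(u) = w`; its argument is the pair `(u, ∇u)`. -/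
noncomputable def energy (α β : ℝ) (h : ℝ → ℝ) (w : H O) (z : H O × HVec O) : ℝ :=
  (α * ‖z.1‖ ^ 2 + β * ‖z.2‖ ^ 2) / 2 - ⟪w, z.1⟫ + ∫ x in O, potential h (z.1 x)

namespace SubcriticalNonlinearity

theorem memLp (hh : SubcriticalNonlinearity d h C q) (hd : 1 ≤ d) (hOb : Bornology.IsBounded O)
    {u : H O} {p : HVec O} (hup : IsH1Zero O u p) :
    MemLp u (q + 1 : ℝ≥0) (volume.restrict O) := by
  have hq : (2 : ℝ≥0) ≤ q + 1 := by
    rw [← one_add_one_eq_two]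
    gcongr
    exact hh.one_le
  obtain ⟨C, hC⟩ := exists_eLpNorm_le_of_isH1Zero hd hOb hq hh.subcritical
  exact ⟨Lp.aestronglyMeasurable u,
    (hC u p hup).trans_lt (ENNReal.mul_lt_top ENNReal.coe_lt_top enorm_lt_top)⟩

theorem bddBelow_energy (hh : SubcriticalNonlinearity d h C q) (hc : 0 < c)
    (hcoer : IsCoerciveForm O α β c) :
    BddBelow (energy α β h w '' h1Zero O) := by
  refine ⟨-(‖w‖ ^ 2 / (2 * c)), ?_⟩
  rintro _ ⟨⟨u, p⟩, hz, rfl⟩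
  have hpot : 0 ≤ ∫ x in O, potential h (u x) :=
    integral_nonneg fun x => potential_nonneg hh.monotone hh.map_zero _
  have hyoung : ⟪w, u⟫ ≤ ‖w‖ ^ 2 / (2 * c) + c / 2 * ‖u‖ ^ 2 := by
    refine (real_inner_le_norm w u).trans ?_
    have hsq : 0 ≤ (‖w‖ - c * ‖u‖) ^ 2 / (2 * c) := by positivity
    have hexp : (‖w‖ - c * ‖u‖) ^ 2 / (2 * c) =
        ‖w‖ ^ 2 / (2 * c) + c / 2 * ‖u‖ ^ 2 - ‖w‖ * ‖u‖ := by field_simp; ring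
    linarith
  have hform := hcoer u p hz
  have hgrad : 0 ≤ c * ‖p‖ ^ 2 := by positivity
  rw [energy]
  linarith

variable (hh : SubcriticalNonlinearity d h C q) (hd : 1 ≤ d) (hOb : Bornology.IsBounded O)
include hh hd hOb

theorem integrable_mul {u v : H O} {p r : HVec O} (hup : IsH1Zero O u p) (hvr : IsH1Zero O v r) :
    Integrable (fun x => h (u x) * v x) (volume.restrict O) :=
  have := isFiniteMeasure_restrict hOb
  integrable_comp_mul hh.continuous hh.growth (hh.memLp hd hOb hup) (hh.memLp hd hOb hvr)

theorem integrable_potential {u : H O} {p : HVec O} (hup : IsH1Zero O u p) :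
    Integrable (fun x => potential h (u x)) (volume.restrict O) :=
  have := isFiniteMeasure_restrict hOb
  integrable_potential_comp hh.continuous hh.monotone hh.map_zero hh.growth (hh.memLp hd hOb hup)

theorem lowerSemicontinuousOn_energy :
    LowerSemicontinuousOn (energy α β h w) (h1Zero O) := by
  have hquad : Continuous fun z : H O × HVec O =>
      (α * ‖z.1‖ ^ 2 + β * ‖z.2‖ ^ 2) / 2 - ⟪w, z.1⟫ := by fun_prop
  have hpot : LowerSemicontinuousOn
      (fun z : H O × HVec O => ∫ x in O, potential h (z.1 x)) (h1Zero O) :=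
    (lowerSemicontinuousOn_integral_comp (continuous_potential hh.continuous)
      (potential_nonneg hh.monotone hh.map_zero)).comp continuous_fst.continuousOn
        fun z hz => hh.integrable_potential hd hOb hz
  exact (hquad.lowerSemicontinuous.lowerSemicontinuousOn _).add hpot

theorem energy_midpoint_le (hc : 0 ≤ c) (hcoer : IsCoerciveForm O α β c) {z z' : H O × HVec O}
    (hz : z ∈ h1Zero O) (hz' : z' ∈ h1Zero O) :
    c / 4 * dist z z' ^ 2 ≤
      energy α β h w z + energy α β h w z' - 2 * energy α β h w ((1 / 2 : ℝ) • (z + z')) := by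
  obtain ⟨u, p⟩ := z
  obtain ⟨v, r⟩ := z'
  have hpot : ∫ x in O, potential h (((1 / 2 : ℝ) • (u + v) : H O) x) ≤
      ((∫ x in O, potential h (u x)) + ∫ x in O, potential h (v x)) / 2 := by
    have hu := hh.integrable_potential hd hOb hz
    have hv := hh.integrable_potential hd hOb hz'
    rw [← integral_add hu hv, ← integral_div]
    refine integral_mono_ae (hh.integrable_potential hd hOb ((IsH1Zero.add hz hz').smul (1 / 2)))
      ((hu.add hv).div_const 2) ?_
    filter_upwards [Lp.coeFn_smul (1 / 2 : ℝ) (u + v), Lp.coeFn_add u v] with x hsmul hadd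
    simp only [hsmul, hadd, Pi.smul_apply, Pi.add_apply, smul_eq_mul]
    exact potential_midpoint_le hh.monotone _ _
  have hdist : dist (u, p) (v, r) ^ 2 ≤ ‖u - v‖ ^ 2 + ‖p - r‖ ^ 2 := by
    rw [dist_eq_norm, Prod.mk_sub_mk, Prod.norm_mk]
    obtain h | h := max_choice ‖u - v‖ ‖p - r‖ <;> rw [h] <;> nlinarith
  have hform := hcoer _ _ (IsH1Zero.sub hz hz')
  have hparu := parallelogram_law_with_norm ℝ u v
  have hparp := parallelogram_law_with_norm ℝ p r
  have hscaled : c * dist (u, p) (v, r) ^ 2 ≤ c * (‖u - v‖ ^ 2 + ‖p - r‖ ^ 2) := by gcongr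
  have hhalf : ‖(1 / 2 : ℝ)‖ ^ 2 = 1 / 4 := by norm_num
  simp only [energy, Prod.mk_add_mk, Prod.smul_mk, norm_smul, mul_pow, inner_smul_right,
    inner_add_right, hhalf]
  linear_combination (1 / 4) * hform + (1 / 4) * hscaled + 2 * hpot + (α / 4) * hparu +
    (β / 4) * hparp

theorem exists_isMinOn_energy (hc : 0 < c) (hcoer : IsCoerciveForm O α β c) :
    ∃ z ∈ h1Zero O, IsMinOn (energy α β h w) (h1Zero O) z :=
  exists_isMinOn_of_midpoint isClosed_h1Zero.isComplete ⟨0, (h1Zero O).zero_mem⟩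
    (hh.lowerSemicontinuousOn_energy hd hOb) (hh.bddBelow_energy hc hcoer)
    (div_pos hc four_pos) fun _ hz _ hz' =>
      ⟨_, (h1Zero O).smul_mem _ ((h1Zero O).add_mem hz hz'),
        hh.energy_midpoint_le hd hOb hc.le hcoer hz hz'⟩

variable {y v : H O} {p r : HVec O}

theorem energy_add_smul_le (hy : IsH1Zero O y p) (hv : IsH1Zero O v r) (t : ℝ) :
    energy α β h w (y + t • v, p + t • r) ≤ energy α β h w (y, p) +
      t * (α * ⟪y, v⟫ + β * ⟪p, r⟫ + (∫ x in O, h (y x + t * v x) * v x) - ⟪w, v⟫ +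
        t * ((α * ‖v‖ ^ 2 + β * ‖r‖ ^ 2) / 2)) := by
  have hyt := hy.add (hv.smul t)
  have hpot : ∫ x in O, potential h ((y + t • v : H O) x) ≤
      (∫ x in O, potential h (y x)) + t * ∫ x in O, h (y x + t * v x) * v x := by
    have hpy := hh.integrable_potential hd hOb hy
    have hcoe : (y + t • v : H O) =ᵐ[volume.restrict O] fun x => y x + t * v x := by
      filter_upwards [Lp.coeFn_add y (t • v), Lp.coeFn_smul t v] with x hadd hsmul
      rw [hadd, Pi.add_apply, hsmul, Pi.smul_apply, smul_eq_mul]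
    have hint : Integrable (fun x => h (y x + t * v x) * v x) (volume.restrict O) :=
      (hh.integrable_mul hd hOb hyt hv).congr (by filter_upwards [hcoe] with x hx; rw [hx])
    rw [← integral_const_mul, ← integral_add hpy (hint.const_mul t)]
    refine integral_mono_ae (hh.integrable_potential hd hOb hyt) (hpy.add (hint.const_mul t)) ?_
    filter_upwards [hcoe] with x hx
    rw [hx]
    linarith [potential_sub_le hh.monotone (y x) (y x + t * v x)]
  simp only [energy, norm_add_sq_real, inner_add_right, inner_smul_right, norm_smul, mul_pow,
    Real.norm_eq_abs, sq_abs]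
  linarith

theorem nonneg_of_isMinOn_energy (hmin : IsMinOn (energy α β h w) (h1Zero O) (y, p))
    (hy : IsH1Zero O y p) (hv : IsH1Zero O v r) :
    0 ≤ α * ⟪y, v⟫ + β * ⟪p, r⟫ + (∫ x in O, h (y x) * v x) - ⟪w, v⟫ := by
  have := isFiniteMeasure_restrict hOb
  have hlim : Tendsto (fun t : ℝ => α * ⟪y, v⟫ + β * ⟪p, r⟫ +
      (∫ x in O, h (y x + t * v x) * v x) - ⟪w, v⟫ + t * ((α * ‖v‖ ^ 2 + β * ‖r‖ ^ 2) / 2))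
      (𝓝[>] 0) (𝓝 (α * ⟪y, v⟫ + β * ⟪p, r⟫ + (∫ x in O, h (y x) * v x) - ⟪w, v⟫ +
        0 * ((α * ‖v‖ ^ 2 + β * ‖r‖ ^ 2) / 2))) :=
    (((tendsto_integral_comp_add_mul hh.continuous hh.monotone hh.growth (hh.memLp hd hOb hy)
      (hh.memLp hd hOb hv)).const_add _).sub_const _).add
      ((tendsto_id.mono_left nhdsWithin_le_nhds).mul_const _)
  rw [zero_mul, add_zero] at hlim
  refine ge_of_tendsto hlim ?_
  filter_upwards [self_mem_nhdsWithin] with t ht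
  refine nonneg_of_mul_nonneg_right (a := t) ?_ ht
  have hle : energy α β h w (y, p) ≤ energy α β h w (y + t • v, p + t • r) :=
    hmin (hy.add (hv.smul t))
  linarith [hh.energy_add_smul_le (α := α) (β := β) (w := w) hd hOb hy hv t]

theorem exists_weakSolution (hc : 0 < c) (hcoer : IsCoerciveForm O α β c) (w : H O) :
    ∃ y p, IsH1Zero O y p ∧ ∀ v r, IsH1Zero O v r →
      Integrable (fun x => h (y x) * v x) (volume.restrict O) ∧
      α * ⟪y, v⟫ + β * ⟪p, r⟫ + (∫ x in O, h (y x) * v x) = ⟪w, v⟫ := by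
  obtain ⟨⟨y, p⟩, hy, hmin⟩ := hh.exists_isMinOn_energy (w := w) hd hOb hc hcoer
  refine ⟨y, p, hy, fun v r hv => ⟨hh.integrable_mul hd hOb hy hv, ?_⟩⟩
  have hpos := hh.nonneg_of_isMinOn_energy hd hOb hmin hy hv
  have hneg := hh.nonneg_of_isMinOn_energy hd hOb hmin hy (hv.smul (-1))
  have hint : ∫ x in O, h (y x) * ((-1 : ℝ) • v : H O) x = -∫ x in O, h (y x) * v x := by
    rw [← integral_neg]
    refine integral_congr_ae ?_
    filter_upwards [Lp.coeFn_smul (-1 : ℝ) v] with x hx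
    rw [hx, Pi.smul_apply, neg_one_smul, mul_neg]
  rw [hint, inner_smul_right, inner_smul_right, inner_smul_right] at hneg
  linarith

end SubcriticalNonlinearity

end DirichletEnergy

section Step

variable {d : ℕ} {O : Set (E d)} {f : ℝ → ℝ} {L₁ L₂ L₃ L₄ L₅ q τ : ℝ}

/-- The nondecreasing function `ξ ↦ L₁ ξ - (f ξ - f 0)`. Moving `L₁ ξ` and `f 0` to the linear part
of the step equation leaves this monotone nonlinearity, which has a convex potential. -/
def driftRemainder (f : ℝ → ℝ) (L₁ : ℝ) (ξ : ℝ) : ℝ := L₁ * ξ - (f ξ - f 0)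

namespace DriftAssumption

variable (hf : DriftAssumption d f L₁ L₂ L₃ L₄ L₅ q)
include hf

theorem monotone_driftRemainder : Monotone (driftRemainder f L₁) := by
  intro a b hab
  obtain rfl | hlt := hab.eq_or_lt
  · rfl
  have hquot : f b - f a ≤ L₁ * (b - a) := by
    refine le_of_mul_le_mul_right ?_ (sub_pos.2 hlt)
    linarith [hf.monotone b a]
  rw [driftRemainder, driftRemainder]
  linarith

theorem abs_sub_zero_le (ξ : ℝ) : |f ξ - f 0| ≤ (|L₄| * |ξ| ^ (q - 1) + |L₅|) * |ξ| := by
  have hderiv (x : ℝ) (hx : x ∈ Metric.closedBall 0 |ξ|) :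
      ‖deriv f x‖ ≤ |L₄| * |ξ| ^ (q - 1) + |L₅| := by
    have hpow : |x| ^ (q - 1) ≤ |ξ| ^ (q - 1) :=
      Real.rpow_le_rpow (abs_nonneg _) (by simpa using hx) (sub_nonneg.2 hf.one_le_q)
    calc |deriv f x| ≤ L₄ * |x| ^ (q - 1) + L₅ := hf.deriv_growth x
      _ ≤ |L₄| * |ξ| ^ (q - 1) + |L₅| := by
        gcongr
        · exact le_abs_self L₄
        · exact le_abs_self L₅
  simpa using (convex_closedBall (0 : ℝ) |ξ|).norm_image_sub_le_of_norm_deriv_le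
    (fun x _ => hf.differentiable x) hderiv (x := 0) (y := ξ) (by simp) (by simp)

theorem abs_driftRemainder_le (ξ : ℝ) :
    |driftRemainder f L₁ ξ| ≤ (|L₁| + |L₅| + |L₄|) * (1 + |ξ| ^ q) := by
  have hq := hf.one_le_q
  have hmul : |ξ| ^ (q - 1) * |ξ| = |ξ| ^ q := by
    rw [← Real.rpow_add_one' (abs_nonneg _) (by linarith), sub_add_cancel]
  have hle : |ξ| ≤ 1 + |ξ| ^ q := by
    obtain h | h := le_total |ξ| 1
    · exact h.trans (le_add_of_nonneg_right (by positivity))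
    · exact (Real.self_le_rpow_of_one_le h hq).trans (le_add_of_nonneg_left zero_le_one)
  calc |driftRemainder f L₁ ξ|
    _ ≤ |L₁| * |ξ| + |f ξ - f 0| := (abs_sub _ _).trans_eq (by rw [abs_mul])
    _ ≤ |L₁| * |ξ| + (|L₄| * |ξ| ^ (q - 1) + |L₅|) * |ξ| := by
      gcongr
      exact hf.abs_sub_zero_le ξ
    _ = (|L₁| + |L₅|) * |ξ| + |L₄| * |ξ| ^ q := by rw [← hmul]; ring
    _ ≤ (|L₁| + |L₅|) * (1 + |ξ| ^ q) + |L₄| * (1 + |ξ| ^ q) := by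
      gcongr
      exact le_add_of_nonneg_left zero_le_one
    _ = (|L₁| + |L₅| + |L₄|) * (1 + |ξ| ^ q) := by ring

theorem subcriticalNonlinearity (hd3 : d ≤ 3) (hτ : 0 ≤ τ) :
    SubcriticalNonlinearity d (fun ξ => τ * driftRemainder f L₁ ξ) (τ * (|L₁| + |L₅| + |L₄|))
      q.toNNReal where
  continuous := by
    have := hf.differentiable.continuous
    unfold driftRemainder
    fun_prop
  monotone := hf.monotone_driftRemainder.const_mul hτ
  map_zero := by simp [driftRemainder]
  growth ξ := by
    rw [abs_mul, abs_of_nonneg hτ, mul_assoc, Real.coe_toNNReal _ (zero_le_one.trans hf.one_le_q)]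
    gcongr
    exact hf.abs_driftRemainder_le ξ
  one_le := Real.one_le_toNNReal.2 hf.one_le_q
  subcritical := by
    have hq3 := hf.q_le_three
    have hq := hf.one_le_q
    lift q to ℝ≥0 using zero_le_one.trans hq
    rw [Real.toNNReal_coe]
    interval_cases d <;> rw [← NNReal.coe_le_coe] <;> push_cast <;> grind

end DriftAssumption

-- Split `‖∇u‖²` as `ε ‖∇u‖² + (1 - ε) ‖∇u‖²` and use the Poincaré inequality on the second part.
theorem exists_isCoerciveForm (hO : MeasurableSet O) (hOb : Bornology.IsBounded O) (hτ : 0 < τ)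
    (hL : L₁ < lambda1 O) : ∃ c : ℝ, 0 < c ∧ IsCoerciveForm O (1 - τ * L₁) τ c := by
  set lam := lambda1 O
  obtain ⟨ε, hε0, hε1, hε⟩ : ∃ ε : ℝ, 0 < ε ∧ ε ≤ 1 ∧ ε * (τ * lam) ≤ 1 / 2 := by
    have hpos : 0 < 1 + τ * |lam| := by positivity
    refine ⟨1 / (2 * (1 + τ * |lam|)), by positivity, ?_, ?_⟩
    · rw [div_le_one (by positivity)]
      linarith [show 0 ≤ τ * |lam| by positivity]
    · rw [div_mul_eq_mul_div, one_mul, div_le_iff₀ (by positivity)]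
      linarith [mul_le_mul_of_nonneg_left (le_abs_self lam) hτ.le]
  refine ⟨min (1 / 2) (ε * τ), by positivity, fun u p hup => ?_⟩
  have hgap : 0 ≤ τ * (lam - L₁) * ‖u‖ ^ 2 :=
    mul_nonneg (mul_nonneg hτ.le (sub_pos.2 hL).le) (sq_nonneg _)
  have hpoincare : (1 - ε) * τ * (lam * ‖u‖ ^ 2) ≤ (1 - ε) * τ * ‖p‖ ^ 2 :=
    mul_le_mul_of_nonneg_left (lambda1_mul_norm_sq_le hO hOb hup)
      (mul_nonneg (sub_nonneg.2 hε1) hτ.le)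
  calc min (1 / 2) (ε * τ) * (‖u‖ ^ 2 + ‖p‖ ^ 2)
    _ ≤ 1 / 2 * ‖u‖ ^ 2 + ε * τ * ‖p‖ ^ 2 := by
      rw [mul_add]
      gcongr
      · exact min_le_left _ _
      · exact min_le_right _ _
    _ ≤ (1 - ε * (τ * lam)) * ‖u‖ ^ 2 + ε * τ * ‖p‖ ^ 2 := by
      gcongr
      linarith
    _ ≤ (1 - τ * L₁) * ‖u‖ ^ 2 + τ * ‖p‖ ^ 2 := by linarith

end Step

section StepMap

variable {d : ℕ} {O : Set (E d)} {f : ℝ → ℝ} {L₁ L₂ L₃ L₄ L₅ q τ : ℝ} {w w' x y y' z : H O}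

theorem isStep_iff_add : IsStep O f τ x z y ↔ IsStep O f τ (x + z) 0 y := by
  simp only [IsStep, inner_add_left, inner_zero_left, add_zero, add_sub_right_comm,
    add_right_comm _ ⟪z, _⟫]

theorem inner_eq_integral (u v : H O) : ⟪u, v⟫ = ∫ x in O, u x * v x := by
  simp only [L2.inner_def, RCLike.inner_apply, conj_trivial, mul_comm]

theorem integrable_mul (u v : H O) : Integrable (fun x => u x * v x) (volume.restrict O) := by
  simpa [mul_comm] using L2.integrable_inner (𝕜 := ℝ) u v

theorem exists_isStep (hd : 1 ≤ d) (hd3 : d ≤ 3) (hO : MeasurableSet O)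
    (hOb : Bornology.IsBounded O) (hf : DriftAssumption d f L₁ L₂ L₃ L₄ L₅ q) (hτ : 0 < τ)
    (hL : L₁ < lambda1 O) (w : H O) : ∃ y, IsStep O f τ w 0 y := by
  have := isFiniteMeasure_restrict hOb
  let e : H O := Lp.const 2 (volume.restrict O) (τ * f 0)
  have he (v : H O) : ⟪e, v⟫ = τ * (f 0 * ∫ x in O, v x) := by
    rw [inner_eq_integral, ← mul_assoc, ← integral_const_mul]
    refine integral_congr_ae ?_
    filter_upwards [Lp.coeFn_const 2 (volume.restrict O) (τ * f 0)] with x hx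
    rw [hx, Function.const_apply]
  obtain ⟨c, hc, hcoer⟩ := exists_isCoerciveForm hO hOb hτ hL
  obtain ⟨y, p, hyp, hweak⟩ :=
    (hf.subcriticalNonlinearity hd3 hτ.le).exists_weakSolution hd hOb hc hcoer (w + e)
  refine ⟨y, p, hyp, fun v r hvr => ?_⟩
  obtain ⟨hint, heq⟩ := hweak v r hvr
  have hyv := (integrable_mul y v).const_mul L₁
  have hv := ((Lp.memLp v).integrable one_le_two).const_mul (f 0)
  have hsum : Integrable (fun x => L₁ * (y x * v x) + f 0 * v x) (volume.restrict O) :=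
    hyv.add hv
  have hrem : Integrable (fun x => driftRemainder f L₁ (y x) * v x) (volume.restrict O) := by
    simpa only [mul_assoc, integrable_const_mul_iff hτ.ne'.isUnit] using hint
  have hfun : (fun x => f (y x) * v x) = fun x => L₁ * (y x * v x) + f 0 * v x -
      driftRemainder f L₁ (y x) * v x := by
    ext x
    rw [driftRemainder]
    ring
  refine ⟨hfun ▸ hsum.sub hrem, ?_⟩
  rw [hfun, integral_sub hsum hrem, integral_add hyv hv, integral_const_mul,
    integral_const_mul, ← inner_eq_integral, inner_zero_left]
  simp only [mul_assoc, integral_const_mul, inner_add_left, he] at heq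
  linear_combination heq

/-- The solution map `w ↦ y` of `y = w + τ A y + τ F(y)`, with an arbitrary value at those `w` for
which this equation has no solution. -/
noncomputable def stepMap (O : Set (E d)) (f : ℝ → ℝ) (τ : ℝ) (w : H O) : H O :=
  Classical.epsilon fun y => IsStep O f τ w 0 y

theorem isStep_stepMap (hd : 1 ≤ d) (hd3 : d ≤ 3) (hO : MeasurableSet O)
    (hOb : Bornology.IsBounded O) (hf : DriftAssumption d f L₁ L₂ L₃ L₄ L₅ q) (hτ : 0 < τ)
    (hL : L₁ < lambda1 O) (w : H O) : IsStep O f τ w 0 (stepMap O f τ w) :=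
  Classical.epsilon_spec (exists_isStep hd hd3 hO hOb hf hτ hL w)

section Monotone

variable (hO : MeasurableSet O) (hOb : Bornology.IsBounded O)
  (hmono : ∀ ξ η, (f ξ - f η) * (ξ - η) ≤ L₁ * (ξ - η) ^ 2) (hτ : 0 < τ)
include hO hOb hmono hτ

-- Test the difference of the two equations with `y - y'`.
theorem IsStep.norm_sub_le (hy : IsStep O f τ w 0 y) (hy' : IsStep O f τ w' 0 y') :
    (1 + τ * (lambda1 O - L₁)) * ‖y - y'‖ ≤ ‖w - w'‖ := by
  obtain ⟨p, hyp, heq⟩ := hy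
  obtain ⟨p', hyp', heq'⟩ := hy'
  have hv := hyp.sub hyp'
  obtain ⟨hint, htest⟩ := heq _ _ hv
  obtain ⟨hint', htest'⟩ := heq' _ _ hv
  have hdrift : (∫ x in O, f (y x) * (y - y' : H O) x) -
      ∫ x in O, f (y' x) * (y - y' : H O) x ≤ L₁ * ‖y - y'‖ ^ 2 := by
    rw [← integral_sub hint hint', ← real_inner_self_eq_norm_sq, inner_eq_integral,
      ← integral_const_mul]
    refine integral_mono_ae (hint.sub hint') ((integrable_mul _ _).const_mul _) ?_
    filter_upwards [Lp.coeFn_sub y y'] with x hx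
    simp only [hx, Pi.sub_apply]
    linarith [hmono (y x) (y' x)]
  have hsub : ‖y - y'‖ ^ 2 = ⟪w - w', y - y'⟫ - τ * ‖p - p'‖ ^ 2 +
      τ * ((∫ x in O, f (y x) * (y - y' : H O) x) - ∫ x in O, f (y' x) * (y - y' : H O) x) := by
    rw [inner_zero_left] at htest htest'
    rw [← real_inner_self_eq_norm_sq, ← real_inner_self_eq_norm_sq, inner_sub_left y,
      inner_sub_left w, inner_sub_left p]
    linear_combination htest - htest'
  have henergy : (1 + τ * (lambda1 O - L₁)) * ‖y - y'‖ * ‖y - y'‖ ≤ ‖w - w'‖ * ‖y - y'‖ := by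
    linear_combination hsub + real_inner_le_norm (w - w') (y - y') + τ * hdrift +
      τ * lambda1_mul_norm_sq_le hO hOb hv
  obtain h0 | h0 := (norm_nonneg (y - y')).eq_or_lt
  · rw [← h0, mul_zero]
    exact norm_nonneg _
  · exact le_of_mul_le_mul_right henergy h0

theorem IsStep.unique (hL : L₁ < lambda1 O) (hy : IsStep O f τ w 0 y)
    (hy' : IsStep O f τ w 0 y') : y = y' := by
  have hle := hy.norm_sub_le hO hOb hmono hτ hy'
  have hpos : 0 < 1 + τ * (lambda1 O - L₁) :=
    add_pos one_pos (mul_pos hτ (sub_pos.2 hL))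
  rw [sub_self, norm_zero] at hle
  exact sub_eq_zero.1 (norm_le_zero_iff.1 (nonpos_of_mul_nonpos_right hle hpos))

end Monotone

section Coercive

variable (hOb : Bornology.IsBounded O) (hcoer : ∀ ξ, f ξ * ξ ≤ L₂ * |ξ| ^ 2 + L₃) (hτ : 0 < τ)
include hOb hcoer hτ

-- Test the equation with its solution.
theorem IsStep.exists_energy_le (hy : IsStep O f τ w 0 y) :
    ∃ p, IsH1Zero O y p ∧ ‖y‖ ^ 2 + τ * ‖p‖ ^ 2 ≤
      ⟪w, y⟫ + τ * (L₂ * ‖y‖ ^ 2 + L₃ * volume.real O) := by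
  have := isFiniteMeasure_restrict hOb
  obtain ⟨p, hyp, heq⟩ := hy
  obtain ⟨hint, htest⟩ := heq _ _ hyp
  refine ⟨p, hyp, ?_⟩
  have hsq := (integrable_mul y y).const_mul L₂
  have hdrift : ∫ x in O, f (y x) * y x ≤ L₂ * ‖y‖ ^ 2 + L₃ * volume.real O := calc
    _ ≤ ∫ x in O, (L₂ * (y x * y x) + L₃) :=
      integral_mono hint (hsq.add (integrable_const _)) fun x => by
        simpa only [← sq, sq_abs] using hcoer (y x)
    _ = L₂ * ‖y‖ ^ 2 + L₃ * volume.real O := by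
      rw [integral_add hsq (integrable_const _), integral_const_mul, ← inner_eq_integral,
        real_inner_self_eq_norm_sq, integral_const, smul_eq_mul, measureReal_restrict_apply_univ,
        mul_comm L₃]
  rw [inner_zero_left, real_inner_self_eq_norm_sq, real_inner_self_eq_norm_sq] at htest
  linear_combination htest + τ * hdrift

-- The energy estimate bounds the solution in `H¹₀`, and bounded subsets of `H¹₀` are relatively
-- compact in `L²`.
theorem exists_isCompact_isStep (hO : MeasurableSet O) (R : ℝ) :
    ∃ K : Set (H O), IsCompact K ∧ ∀ w y, ‖w‖ ≤ R → ‖y‖ ≤ R → IsStep O f τ w 0 y → y ∈ K := by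
  set D : ℝ := (R ^ 2 + τ * (|L₂| * R ^ 2 + L₃ * volume.real O)) / τ with hD
  refine ⟨_, isCompact_closure_h1Zero_ball hO hOb (max R √D), fun w y hw hyR hy => ?_⟩
  obtain ⟨p, hyp, henergy⟩ := hy.exists_energy_le hOb hcoer hτ
  have hwy : ⟪w, y⟫ ≤ R ^ 2 := (real_inner_le_norm w y).trans <| by
    rw [sq]
    exact mul_le_mul hw hyR (norm_nonneg _) ((norm_nonneg _).trans hw)
  have hL₂ : L₂ * ‖y‖ ^ 2 ≤ |L₂| * R ^ 2 := by
    gcongr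
    exact le_abs_self _
  have hpD : ‖p‖ ^ 2 ≤ D := by
    rw [hD, le_div_iff₀ hτ]
    linear_combination henergy + hwy + τ * hL₂ + sq_nonneg ‖y‖
  exact subset_closure ⟨p, hyp, le_max_of_le_left hyR,
    le_max_of_le_right (Real.le_sqrt_of_sq_le hpD)⟩

end Coercive

end StepMap

section Noise

theorem tendstoInMeasure_sub {X Ω : Type*} [NormedAddCommGroup X]
    {mΩ : MeasurableSpace Ω} {P : Measure Ω} {f g : ℕ → Ω → X} {F G : Ω → X}
    (hf : TendstoInMeasure P f atTop F) (hg : TendstoInMeasure P g atTop G) :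
    TendstoInMeasure P (fun n ω => f n ω - g n ω) atTop fun ω => F ω - G ω := by
  rw [tendstoInMeasure_iff_norm] at *
  intro ε hε
  have hadd := (hf (ε / 2) (by positivity)).add (hg (ε / 2) (by positivity))
  rw [add_zero] at hadd
  refine tendsto_of_tendsto_of_tendsto_of_le_of_le tendsto_const_nhds hadd (fun _ => zero_le)
    fun n => (measure_mono fun ω hω => ?_).trans (measure_union_le _ _)
  change ε ≤ ‖f n ω - g n ω - (F ω - G ω)‖ at hω
  change ε / 2 ≤ ‖f n ω - F ω‖ ∨ ε / 2 ≤ ‖g n ω - G ω‖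
  rw [sub_sub_sub_comm] at hω
  by_contra! hsmall
  linarith [norm_sub_le (f n ω - F ω) (g n ω - G ω)]

theorem summable_of_norm_sum_sq_le {X : Type*} [NormedAddCommGroup X] [CompleteSpace X]
    {F : ℕ → X} {b : ℕ → ℝ} (hb : Summable b)
    (h : ∀ I : Finset ℕ, ‖∑ k ∈ I, F k‖ ^ 2 ≤ ∑ k ∈ I, b k) : Summable F := by
  refine summable_iff_vanishing_norm.2 fun ε hε => ?_
  obtain ⟨s, hs⟩ := summable_iff_vanishing_norm.1 hb (ε ^ 2) (sq_pos_of_pos hε)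
  exact ⟨s, fun t ht => lt_of_pow_lt_pow_left₀ 2 hε.le
    ((h t).trans_lt ((le_abs_self _).trans_lt (hs t ht)))⟩

theorem exists_tendstoInMeasure_sum {X Ω : Type*} [NormedAddCommGroup X] [CompleteSpace X]
    {mΩ : MeasurableSpace Ω} {P : Measure Ω} {f : ℕ → Ω → X} {b : ℕ → ℝ≥0∞}
    (hf : ∀ k, AEStronglyMeasurable (f k) P) (hb : ∑' k, b k ≠ ∞)
    (h : ∀ I : Finset ℕ, eLpNorm (fun ω => ∑ k ∈ I, f k ω) 2 P ^ 2 ≤ ∑ k ∈ I, b k) :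
    ∃ Z : Lp X 2 P, TendstoInMeasure P (fun n ω => ∑ k ∈ Finset.range n, f k ω) atTop Z := by
  have hbk (k : ℕ) : b k ≠ ∞ := ENNReal.ne_top_of_tsum_ne_top hb k
  have hmem (k : ℕ) : MemLp (f k) 2 P := by
    refine ⟨hf k, (ENNReal.pow_lt_top_iff.1 ?_).resolve_right two_ne_zero⟩
    have hk := h {k}
    simp only [Finset.sum_singleton] at hk
    exact hk.trans_lt (hbk k).lt_top
  let F (k : ℕ) : Lp X 2 P := (hmem k).toLp (f k)
  have hF (I : Finset ℕ) : ⇑(∑ k ∈ I, F k) =ᵐ[P] fun ω => ∑ k ∈ I, f k ω := by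
    filter_upwards [Lp.coeFn_finsetSum I F, ae_all_iff.2 fun k => (hmem k).coeFn_toLp]
      with ω hsum hω
    rw [hsum, Finset.sum_apply, Finset.sum_congr rfl fun k _ => hω k]
  have hFsq (I : Finset ℕ) : ‖∑ k ∈ I, F k‖ ^ 2 ≤ ∑ k ∈ I, (b k).toReal := by
    rw [Lp.norm_def, eLpNorm_congr_ae (hF I), ← ENNReal.toReal_pow,
      ← ENNReal.toReal_sum fun k _ => hbk k]
    exact ENNReal.toReal_mono (ENNReal.sum_ne_top.2 fun k _ => hbk k) (h I)
  have hsum := (summable_of_norm_sum_sq_le (ENNReal.summable_toReal hb) hFsq).hasSum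
  exact ⟨_, (tendstoInMeasure_of_tendsto_Lp hsum.tendsto_sum_nat).congr_left fun n => hF _⟩

/-- The squared Hilbert–Schmidt norm `∑ₖ σₖ ‖Aₖ‖²` of an operator with values `Aₖ` on the basis
along which the noise has variances `σ`. -/
noncomputable def weightedSq {V : Type*} [NormedAddCommGroup V] (σ : ℕ → ℝ≥0) (A : ℕ → V) : ℝ≥0∞ :=
  ∑' k, (σ k : ℝ≥0∞) * ‖A k‖ₑ ^ 2

theorem weightedSq_le_add {V : Type*} [NormedAddCommGroup V] (σ : ℕ → ℝ≥0) (A B : ℕ → V) :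
    weightedSq σ A ≤ 2 * (weightedSq σ (fun k => A k - B k) + weightedSq σ B) := by
  rw [weightedSq, weightedSq, weightedSq, ← ENNReal.tsum_add, ← ENNReal.tsum_mul_left]
  refine ENNReal.tsum_le_tsum fun k => ?_
  have hconv : ‖A k‖ₑ ^ 2 ≤ 2 * (‖A k - B k‖ₑ ^ 2 + ‖B k‖ₑ ^ 2) := by
    calc ‖A k‖ₑ ^ 2 ≤ (‖A k - B k‖ₑ + ‖B k‖ₑ) ^ 2 := by
          gcongr
          simpa using enorm_add_le (A k - B k) (B k)
      _ ≤ _ := by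
          simpa [show (2 : ℝ) - 1 = 1 by norm_num] using
            ENNReal.rpow_add_le_mul_rpow_add_rpow ‖A k - B k‖ₑ ‖B k‖ₑ one_le_two
  calc _ ≤ (σ k : ℝ≥0∞) * (2 * (‖A k - B k‖ₑ ^ 2 + ‖B k‖ₑ ^ 2)) := by gcongr
    _ = _ := by ring

variable {𝓗 : Type*} [NormedAddCommGroup 𝓗] [InnerProductSpace ℝ 𝓗]

theorem norm_add_sum_smul_sq (I : Finset ℕ) (a : 𝓗) (A : ℕ → 𝓗) (ξ : ℕ → ℝ) :
    ‖a + ∑ k ∈ I, ξ k • A k‖ ^ 2 = ‖a‖ ^ 2 + 2 * (∑ k ∈ I, ξ k * ⟪a, A k⟫) +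
      ∑ j ∈ I, ∑ k ∈ I, ξ j * ξ k * ⟪A j, A k⟫ := by
  simp only [norm_add_sq_real, ← real_inner_self_eq_norm_sq (Finset.sum I _), sum_inner, inner_sum,
    real_inner_smul_left, real_inner_smul_right, mul_assoc]
  congr 1
  exact Finset.sum_congr rfl fun _ _ => Finset.sum_congr rfl fun _ _ => by rw [real_inner_comm]

/-- `γ` is the law of a sequence of centred, uncorrelated random variables with variances `σ`. -/
structure IsWhite (γ : Measure (ℕ → ℝ)) (σ : ℕ → ℝ≥0) : Prop where
  isProbabilityMeasure : IsProbabilityMeasure γ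
  memLp : ∀ k, MemLp (fun ξ : ℕ → ℝ => ξ k) 2 γ
  mean : ∀ k, ∫ ξ, ξ k ∂γ = 0
  covariance : ∀ j k, ∫ ξ, ξ j * ξ k ∂γ = if j = k then (σ j : ℝ) else 0

namespace IsWhite

variable {γ : Measure (ℕ → ℝ)} {σ : ℕ → ℝ≥0}

theorem integrable (h : IsWhite γ σ) (k : ℕ) : Integrable (fun ξ : ℕ → ℝ => ξ k) γ :=
  have := h.isProbabilityMeasure
  (h.memLp k).integrable one_le_two

theorem integrable_mul (h : IsWhite γ σ) (j k : ℕ) :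
    Integrable (fun ξ : ℕ → ℝ => ξ j * ξ k) γ :=
  (h.memLp j).integrable_mul (h.memLp k)

theorem integral_norm_sq (h : IsWhite γ σ) (I : Finset ℕ) (a : 𝓗) (A : ℕ → 𝓗) :
    Integrable (fun ξ : ℕ → ℝ => ‖a + ∑ k ∈ I, ξ k • A k‖ ^ 2) γ ∧
      ∫ ξ, ‖a + ∑ k ∈ I, ξ k • A k‖ ^ 2 ∂γ = ‖a‖ ^ 2 + ∑ k ∈ I, σ k * ‖A k‖ ^ 2 := by
  have := h.isProbabilityMeasure
  have hcross (k : ℕ) := (h.integrable k).mul_const ⟪a, A k⟫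
  have hquad (j k : ℕ) := (h.integrable_mul j k).mul_const ⟪A j, A k⟫
  have hsum := (integrable_finsetSum I fun k _ => hcross k).const_mul 2
  have hdouble := integrable_finsetSum I fun j _ => integrable_finsetSum I fun k _ => hquad j k
  have hlin : Integrable (fun ξ : ℕ → ℝ => ‖a‖ ^ 2 + 2 * ∑ k ∈ I, ξ k * ⟪a, A k⟫) γ :=
    (integrable_const (‖a‖ ^ 2)).add hsum
  simp only [norm_add_sum_smul_sq]
  refine ⟨hlin.add hdouble, ?_⟩
  rw [integral_add hlin hdouble, integral_add (integrable_const _) hsum, integral_const_mul,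
    integral_finsetSum _ fun k _ => hcross k,
    integral_finsetSum _ fun j _ => integrable_finsetSum I fun k _ => hquad j k]
  simp only [integral_finsetSum _ fun k _ => hquad _ k, integral_mul_const, h.mean, h.covariance,
    zero_mul, ite_mul, Finset.sum_const_zero, Finset.sum_ite_eq, integral_const, probReal_univ,
    one_smul, mul_zero, add_zero]
  congr 1
  exact Finset.sum_congr rfl fun k hk => by rw [if_pos hk, real_inner_self_eq_norm_sq]

theorem lintegral_norm_sq (h : IsWhite γ σ) (I : Finset ℕ) (a : 𝓗) (A : ℕ → 𝓗) :
    ∫⁻ ξ, ‖a + ∑ k ∈ I, ξ k • A k‖ₑ ^ 2 ∂γ = ‖a‖ₑ ^ 2 + ∑ k ∈ I, (σ k : ℝ≥0∞) * ‖A k‖ₑ ^ 2 := by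
  obtain ⟨hint, heq⟩ := h.integral_norm_sq I a A
  simp only [enorm_sq_eq_ofReal]
  rw [← ofReal_integral_eq_lintegral_ofReal hint (ae_of_all _ fun ξ => sq_nonneg _), heq,
    ENNReal.ofReal_add (sq_nonneg _) (Finset.sum_nonneg fun k _ => by positivity),
    ENNReal.ofReal_sum_of_nonneg fun k _ => by positivity]
  simp only [ENNReal.ofReal_mul (NNReal.coe_nonneg _), ENNReal.ofReal_coe_nnreal]

end IsWhite

/-- The random sequence `c` has law `γ` and is independent of `m`. -/
structure IsIndepIncrement {Ω : Type*} (m : MeasurableSpace Ω) {mΩ : MeasurableSpace Ω}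
    (P : Measure Ω) (γ : Measure (ℕ → ℝ)) (c : Ω → ℕ → ℝ) : Prop where
  le : m ≤ mΩ
  measurable : Measurable c
  indep : Indep (MeasurableSpace.comap c inferInstance) m P
  law : P.map c = γ

variable {Ω : Type*} {m m' mΩ : MeasurableSpace Ω} {P : Measure Ω} {γ : Measure (ℕ → ℝ)}
  {σ : ℕ → ℝ≥0} {c : Ω → ℕ → ℝ}

theorem stronglyMeasurable_sum_smul (hc : Measurable[m'] c) (hm : m ≤ m')
    {A : Ω → ℕ → 𝓗} (hA : ∀ k, StronglyMeasurable[m] fun ω => A ω k) (I : Finset ℕ) :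
    StronglyMeasurable[m'] fun ω => ∑ k ∈ I, c ω k • A ω k :=
  Finset.stronglyMeasurable_fun_sum _ fun k _ => StronglyMeasurable.smul
    ((measurable_pi_apply k).comp hc).stronglyMeasurable ((hA k).mono hm)

variable [IsProbabilityMeasure P]

theorem IsIndepIncrement.map_prod {β : Type*} [MeasurableSpace β]
    (hc : IsIndepIncrement m P γ c) {V : Ω → β} (hV : Measurable[m] V) :
    P.map (fun ω => (V ω, c ω)) = (P.map V).prod γ := by
  have hindep : IndepFun V c P := by
    rw [IndepFun_iff_Indep]
    exact (indep_of_indep_of_le_right hc.indep hV.comap_le).symm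
  rw [← hc.law]
  exact (indepFun_iff_map_prod_eq_prod_map_map (hV.mono hc.le le_rfl).aemeasurable
    hc.measurable.aemeasurable).1 hindep

theorem IsIndepIncrement.lintegral_comp_prod {β : Type*} [MeasurableSpace β]
    (hc : IsIndepIncrement m P γ c) {V : Ω → β} (hV : Measurable[m] V)
    {Φ : β × (ℕ → ℝ) → ℝ≥0∞} (hΦ : Measurable Φ) :
    ∫⁻ ω, Φ (V ω, c ω) ∂P = ∫⁻ ω, ∫⁻ ξ, Φ (V ω, ξ) ∂γ ∂P := by
  have hV' : Measurable V := hV.mono hc.le le_rfl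
  have hγ : IsProbabilityMeasure γ :=
    hc.law ▸ Measure.isProbabilityMeasure_map hc.measurable.aemeasurable
  rw [← lintegral_map hΦ (hV'.prodMk hc.measurable), hc.map_prod hV,
    lintegral_prod _ hΦ.aemeasurable, lintegral_map hΦ.lintegral_prod_right' hV']

variable [SecondCountableTopology 𝓗] [MeasurableSpace 𝓗] [BorelSpace 𝓗]
  {a : Ω → 𝓗} {A : Ω → ℕ → 𝓗}

namespace IsWhite

theorem eLpNorm_add_sum_sq (h : IsWhite γ σ) (hc : IsIndepIncrement m P γ c)
    (ha : StronglyMeasurable[m] a) (hA : ∀ k, StronglyMeasurable[m] fun ω => A ω k)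
    (I : Finset ℕ) :
    eLpNorm (fun ω => a ω + ∑ k ∈ I, c ω k • A ω k) 2 P ^ 2 =
      ∫⁻ ω, (‖a ω‖ₑ ^ 2 + ∑ k ∈ I, (σ k : ℝ≥0∞) * ‖A ω k‖ₑ ^ 2) ∂P := by
  have hV : Measurable[m] fun ω => (a ω, A ω) :=
    ha.measurable.prodMk (@measurable_pi_lambda _ _ _ m _ _ fun k => (hA k).measurable)
  have hΦ : Measurable fun z : (𝓗 × (ℕ → 𝓗)) × (ℕ → ℝ) =>
      ‖z.1.1 + ∑ k ∈ I, z.2 k • z.1.2 k‖ₑ ^ 2 := by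
    refine Measurable.pow_const (Measurable.enorm ?_) 2
    fun_prop
  rw [eLpNorm_two_sq, hc.lintegral_comp_prod hV hΦ]
  simp only [h.lintegral_norm_sq]

theorem eLpNorm_add_sq_le (h : IsWhite γ σ) (hc : IsIndepIncrement m P γ c)
    (ha : StronglyMeasurable[m] a) (hA : ∀ k, StronglyMeasurable[m] fun ω => A ω k)
    {Z : Ω → 𝓗}
    (hZ : TendstoInMeasure P (fun n ω => ∑ k ∈ Finset.range n, c ω k • A ω k) atTop Z) :
    eLpNorm (fun ω => a ω + Z ω) 2 P ^ 2 ≤ ∫⁻ ω, (‖a ω‖ₑ ^ 2 + weightedSq σ (A ω)) ∂P := by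
  have hlim : TendstoInMeasure P (fun n ω => a ω + ∑ k ∈ Finset.range n, c ω k • A ω k) atTop
      fun ω => a ω + Z ω := by
    simpa only [TendstoInMeasure, edist_add_left] using hZ
  rw [← ENNReal.rpow_two, ← ENNReal.le_rpow_inv_iff two_pos]
  refine eLpNorm_le_of_tendstoInMeasure (Eventually.of_forall fun n => ?_) hlim fun n =>
    ((ha.mono hc.le).add
      (stronglyMeasurable_sum_smul hc.measurable hc.le hA _)).aestronglyMeasurable
  rw [ENNReal.le_rpow_inv_iff two_pos, ENNReal.rpow_two, h.eLpNorm_add_sum_sq hc ha hA]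
  gcongr
  exact ENNReal.sum_le_tsum _

theorem exists_tendstoInMeasure [CompleteSpace 𝓗] (h : IsWhite γ σ)
    (hc : IsIndepIncrement m P γ c) (hmm' : m ≤ m') (hm' : m' ≤ mΩ)
    (hcm' : Measurable[m'] c) (hA : ∀ k, StronglyMeasurable[m] fun ω => A ω k)
    (hfin : ∫⁻ ω, weightedSq σ (A ω) ∂P ≠ ∞) :
    ∃ Z : Ω → 𝓗, StronglyMeasurable[m'] Z ∧
      TendstoInMeasure P (fun n ω => ∑ k ∈ Finset.range n, c ω k • A ω k) atTop Z := by
  have hAm (k : ℕ) : Measurable fun ω => (σ k : ℝ≥0∞) * ‖A ω k‖ₑ ^ 2 :=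
    ((((hA k).mono hc.le).measurable.enorm).pow_const 2).const_mul _
  have hb : ∑' k, ∫⁻ ω, σ k * ‖A ω k‖ₑ ^ 2 ∂P ≠ ∞ := by
    rwa [← lintegral_tsum fun k => (hAm k).aemeasurable]
  have hterm (k : ℕ) : StronglyMeasurable[m'] fun ω => c ω k • A ω k := by
    simpa using stronglyMeasurable_sum_smul hcm' hmm' hA {k}
  have hnorm (I : Finset ℕ) : eLpNorm (fun ω => ∑ k ∈ I, c ω k • A ω k) 2 (P.trim hm') ^ 2 =
      ∑ k ∈ I, ∫⁻ ω, σ k * ‖A ω k‖ₑ ^ 2 ∂P := by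
    rw [eLpNorm_trim hm' (stronglyMeasurable_sum_smul hcm' hmm' hA I),
      ← lintegral_finsetSum _ fun k _ => hAm k]
    simpa using h.eLpNorm_add_sum_sq hc (a := fun _ => 0) stronglyMeasurable_const hA I
  obtain ⟨Z, hZ⟩ := exists_tendstoInMeasure_sum (fun k => (hterm k).aestronglyMeasurable) hb
    fun I => (hnorm I).le
  exact ⟨Z, Lp.stronglyMeasurable Z, fun ε hε => tendsto_of_tendsto_of_tendsto_of_le_of_le
    tendsto_const_nhds (hZ ε hε) (fun _ => zero_le) fun n => le_trim hm'⟩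

end IsWhite

end Noise

section Scheme

theorem le_add_div_one_sub_of_affine_le {u : ℕ → ℝ≥0∞} {κ : ℝ≥0} {B : ℝ≥0∞} (hκ : κ < 1)
    (hu : ∀ n, u (n + 1) ≤ κ * u n + B) (n : ℕ) : u n ≤ u 0 + B / (1 - κ) := by
  have hκ' : (κ : ℝ≥0∞) ≤ 1 := by exact_mod_cast hκ.le
  have hfix : κ * (B / (1 - κ)) + B = B / (1 - κ) := by
    have hpos : (1 : ℝ≥0∞) - κ ≠ 0 := (tsub_pos_of_lt (by exact_mod_cast hκ)).ne'
    calc κ * (B / (1 - κ)) + B = κ * (B / (1 - κ)) + (1 - κ) * (B / (1 - κ)) := by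
          rw [ENNReal.mul_div_cancel hpos (by finiteness)]
      _ = B / (1 - κ) := by rw [← add_mul, add_tsub_cancel_of_le hκ', one_mul]
  induction n with
  | zero => exact le_self_add
  | succ n ih =>
    calc u (n + 1) ≤ κ * (u 0 + B / (1 - κ)) + B := (hu n).trans (by gcongr)
      _ = κ * u 0 + B / (1 - κ) := by rw [mul_add, add_assoc, hfix]
      _ ≤ u 0 + B / (1 - κ) := by gcongr; exact mul_le_of_le_one_left' hκ'

variable {𝓗 : Type*} [NormedAddCommGroup 𝓗] [InnerProductSpace ℝ 𝓗]

/-- The coefficients of an abstract scheme `Xₙ₊₁ = S (Xₙ + G(Xₙ) cₙ)` which contracts distances in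
mean square by the factor `κ < 1`. The operator `G(x)` is represented by its values `G x k` on the
basis along which the noise `cₙ` has variances `σ`. -/
structure ContractiveScheme (𝓗 : Type*) [NormedAddCommGroup 𝓗] [InnerProductSpace ℝ 𝓗] where
  /-- the solution map of the implicit part -/
  S : 𝓗 → 𝓗
  /-- the noise coefficient -/
  G : 𝓗 → ℕ → 𝓗
  /-- the variances of the noise -/
  σ : ℕ → ℝ≥0
  /-- the Lipschitz constant of `S` -/
  ρ : ℝ≥0
  /-- the squared Lipschitz constant of `G` -/
  ℓ : ℝ≥0
  /-- the rate of contraction -/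
  κ : ℝ≥0
  lipschitz_S : LipschitzWith ρ S
  continuous_G : ∀ k, Continuous fun x => G x k
  lipschitz_G : ∀ x y, weightedSq σ (fun k => G x k - G y k) ≤ ℓ * ‖x - y‖ₑ ^ 2
  weightedSq_G_zero : weightedSq σ (G 0) ≠ ∞
  le_rate : ρ * NNReal.sqrt (1 + ℓ) ≤ κ
  rate_lt_one : κ < 1

/-- The random sequences `cₙ` are independent increments with common law `γ`, adapted to the
filtration `𝓖`: `cₙ` is known at time `n + 1`. -/
structure IsNoise {Ω : Type*} (𝓖 : ℕ → MeasurableSpace Ω) {mΩ : MeasurableSpace Ω} (P : Measure Ω)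
    (γ : Measure (ℕ → ℝ)) (c : ℕ → Ω → ℕ → ℝ) : Prop where
  mono : ∀ n, 𝓖 n ≤ 𝓖 (n + 1)
  measurable : ∀ n, Measurable[𝓖 (n + 1)] (c n)
  increment : ∀ n, IsIndepIncrement (𝓖 n) P γ (c n)

namespace ContractiveScheme

variable (𝒮 : ContractiveScheme 𝓗)

/-- `Z` is the random variable `G(X) b`: the limit in probability of `∑_{k < N} bₖ G(X)ₖ`. -/
def IsForcing {Ω : Type*} {_mΩ : MeasurableSpace Ω} (P : Measure Ω) (b : Ω → ℕ → ℝ)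
    (X Z : Ω → 𝓗) : Prop :=
  TendstoInMeasure P (fun N ω => ∑ k ∈ Finset.range N, b ω k • 𝒮.G (X ω) k) atTop Z

/-- `X` is an adapted solution of `Xₙ₊₁ = S (Xₙ + G(Xₙ) cₙ)` with `X₀ = x`. -/
structure IsTrajectory {Ω : Type*} (𝓖 : ℕ → MeasurableSpace Ω) {mΩ : MeasurableSpace Ω}
    (P : Measure Ω) (c : ℕ → Ω → ℕ → ℝ) (x : 𝓗) (X : ℕ → Ω → 𝓗) : Prop where
  initial : ∀ᵐ ω ∂P, X 0 ω = x
  adapted : ∀ n, StronglyMeasurable[𝓖 n] (X n)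
  step : ∀ n, ∃ Z : Ω → 𝓗, 𝒮.IsForcing P (c n) (X n) Z ∧
    ∀ᵐ ω ∂P, X (n + 1) ω = 𝒮.S (X n ω + Z ω)

/-- The additive constant in the affine bound for the `L²` norm of one step of the scheme. -/
noncomputable def drift : ℝ≥0∞ := 𝒮.ρ * weightedSq 𝒮.σ (𝒮.G 0) ^ (2⁻¹ : ℝ) + ‖𝒮.S 0‖ₑ

theorem drift_ne_top : 𝒮.drift ≠ ∞ := by
  have := 𝒮.weightedSq_G_zero
  rw [drift]
  finiteness

variable {𝒮} {Ω : Type*} {𝓖 : ℕ → MeasurableSpace Ω} {m m' mΩ : MeasurableSpace Ω}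
  {P : Measure Ω} {γ : Measure (ℕ → ℝ)} {b : Ω → ℕ → ℝ} {c : ℕ → Ω → ℕ → ℝ}

theorem IsTrajectory.ae_eq {x : 𝓗} {X Y : ℕ → Ω → 𝓗} (hX : 𝒮.IsTrajectory 𝓖 P c x X)
    (hY : 𝒮.IsTrajectory 𝓖 P c x Y) (n : ℕ) : Y n =ᵐ[P] X n := by
  induction n with
  | zero =>
    filter_upwards [hX.initial, hY.initial] with ω hXω hYω
    rw [hXω, hYω]
  | succ n ih =>
    obtain ⟨Z, hZ, hstep⟩ := hX.step n
    obtain ⟨Z', hZ', hstep'⟩ := hY.step n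
    have hforcing : 𝒮.IsForcing P (c n) (X n) Z' := hZ'.congr_left fun N => by
      filter_upwards [ih] with ω hω
      rw [hω]
    filter_upwards [ih, hstep, hstep', tendstoInMeasure_ae_unique hZ hforcing]
      with ω hXY hXω hYω hZω
    rw [hXω, hYω, hXY, hZω]

theorem stronglyMeasurable_G {X : Ω → 𝓗} (hX : StronglyMeasurable[m] X) (k : ℕ) :
    StronglyMeasurable[m] fun ω => 𝒮.G (X ω) k :=
  (𝒮.continuous_G k).comp_stronglyMeasurable hX

theorem IsForcing.aestronglyMeasurable (hb : IsIndepIncrement m P γ b) {X Z : Ω → 𝓗}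
    (hX : StronglyMeasurable[m] X) (hZ : 𝒮.IsForcing P b X Z) : AEStronglyMeasurable Z P :=
  TendstoInMeasure.aestronglyMeasurable (fun N => (stronglyMeasurable_sum_smul hb.measurable hb.le
    (stronglyMeasurable_G hX) (Finset.range N)).aestronglyMeasurable) hZ

variable [SecondCountableTopology 𝓗] [MeasurableSpace 𝓗] [BorelSpace 𝓗] [IsProbabilityMeasure P]
  (hw : IsWhite γ 𝒮.σ) (hb : IsIndepIncrement m P γ b) {X Y Z Z' : Ω → 𝓗}

include hw hb

theorem IsForcing.eLpNorm_add_sub_add_le (hX : StronglyMeasurable[m] X)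
    (hY : StronglyMeasurable[m] Y) (hZ : 𝒮.IsForcing P b X Z) (hZ' : 𝒮.IsForcing P b Y Z') :
    eLpNorm (fun ω => X ω + Z ω - (Y ω + Z' ω)) 2 P ≤
      NNReal.sqrt (1 + 𝒮.ℓ) * eLpNorm (fun ω => X ω - Y ω) 2 P := by
  have hdiff : TendstoInMeasure P (fun N ω => ∑ k ∈ Finset.range N,
      b ω k • (𝒮.G (X ω) k - 𝒮.G (Y ω) k)) atTop fun ω => Z ω - Z' ω := by
    simp only [smul_sub, Finset.sum_sub_distrib]
    exact tendstoInMeasure_sub hZ hZ'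
  have hm : Measurable fun ω => ‖X ω - Y ω‖ₑ ^ 2 :=
    (((hX.sub hY).mono hb.le).enorm).pow_const 2
  refine (ENNReal.pow_le_pow_left_iff two_ne_zero).1 ?_
  calc eLpNorm (fun ω => X ω + Z ω - (Y ω + Z' ω)) 2 P ^ 2
      = eLpNorm (fun ω => (X ω - Y ω) + (Z ω - Z' ω)) 2 P ^ 2 := by
        simp only [add_sub_add_comm]
    _ ≤ ∫⁻ ω, (‖X ω - Y ω‖ₑ ^ 2 + weightedSq 𝒮.σ fun k => 𝒮.G (X ω) k - 𝒮.G (Y ω) k) ∂P :=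
        hw.eLpNorm_add_sq_le hb (hX.sub hY)
          (fun k => (stronglyMeasurable_G hX k).sub (stronglyMeasurable_G hY k)) hdiff
    _ ≤ ∫⁻ ω, (1 + 𝒮.ℓ) * ‖X ω - Y ω‖ₑ ^ 2 ∂P := lintegral_mono fun ω => by
        rw [add_mul, one_mul]
        gcongr
        exact 𝒮.lipschitz_G _ _
    _ = (NNReal.sqrt (1 + 𝒮.ℓ) * eLpNorm (fun ω => X ω - Y ω) 2 P) ^ 2 := by
        rw [lintegral_const_mul _ hm, mul_pow, eLpNorm_two_sq, ← ENNReal.coe_pow, NNReal.sq_sqrt]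
        push_cast
        rfl

theorem IsForcing.eLpNorm_step_sub_step_le (hX : StronglyMeasurable[m] X)
    (hY : StronglyMeasurable[m] Y) (hZ : 𝒮.IsForcing P b X Z) (hZ' : 𝒮.IsForcing P b Y Z') :
    eLpNorm (fun ω => 𝒮.S (X ω + Z ω) - 𝒮.S (Y ω + Z' ω)) 2 P ≤
      𝒮.κ * eLpNorm (fun ω => X ω - Y ω) 2 P := by
  calc _ ≤ 𝒮.ρ * eLpNorm (fun ω => X ω + Z ω - (Y ω + Z' ω)) 2 P :=
        eLpNorm_le_nnreal_smul_eLpNorm_of_ae_le_mul (ae_of_all _ fun ω => by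
          simpa only [nndist_eq_nnnorm] using 𝒮.lipschitz_S.nndist_le _ _) 2
    _ ≤ 𝒮.ρ * (NNReal.sqrt (1 + 𝒮.ℓ) * eLpNorm (fun ω => X ω - Y ω) 2 P) := by
        gcongr
        exact hZ.eLpNorm_add_sub_add_le hw hb hX hY hZ'
    _ ≤ _ := by
        rw [← mul_assoc, ← ENNReal.coe_mul]
        gcongr
        exact 𝒮.le_rate

variable [CompleteSpace 𝓗]

theorem exists_isForcing (hmm' : m ≤ m') (hm' : m' ≤ mΩ) (hbm' : Measurable[m'] b)
    (hX : StronglyMeasurable[m] X) (hfin : eLpNorm X 2 P < ∞) :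
    ∃ Z, StronglyMeasurable[m'] Z ∧ 𝒮.IsForcing P b X Z := by
  refine hw.exists_tendstoInMeasure hb hmm' hm' hbm' (stronglyMeasurable_G hX) (ne_of_lt ?_)
  have hm : Measurable fun ω => ‖X ω‖ₑ ^ 2 := ((hX.mono hb.le).enorm).pow_const 2
  calc ∫⁻ ω, weightedSq 𝒮.σ (𝒮.G (X ω)) ∂P
      ≤ ∫⁻ ω, 2 * (𝒮.ℓ * ‖X ω‖ₑ ^ 2 + weightedSq 𝒮.σ (𝒮.G 0)) ∂P := lintegral_mono fun ω => by
        refine (weightedSq_le_add 𝒮.σ _ (𝒮.G 0)).trans ?_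
        gcongr
        simpa using 𝒮.lipschitz_G (X ω) 0
    _ = 2 * (𝒮.ℓ * eLpNorm X 2 P ^ 2 + weightedSq 𝒮.σ (𝒮.G 0)) := by
        rw [lintegral_const_mul' _ _ ENNReal.ofNat_ne_top, lintegral_add_right _ measurable_const,
          lintegral_const_mul _ hm, lintegral_const, measure_univ, mul_one, eLpNorm_two_sq]
    _ < ∞ := by
        have := 𝒮.weightedSq_G_zero
        finiteness

omit [CompleteSpace 𝓗] in
theorem IsForcing.eLpNorm_le_of_zero (hZ : 𝒮.IsForcing P b (fun _ => 0) Z) :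
    eLpNorm Z 2 P ≤ weightedSq 𝒮.σ (𝒮.G 0) ^ (2⁻¹ : ℝ) := by
  rw [ENNReal.le_rpow_inv_iff two_pos, ENNReal.rpow_two]
  simpa using hw.eLpNorm_add_sq_le hb (a := fun _ => 0) (A := fun _ => 𝒮.G 0)
    stronglyMeasurable_const (fun k => stronglyMeasurable_const) hZ

theorem IsForcing.eLpNorm_add_le (hX : StronglyMeasurable[m] X) (hZ : 𝒮.IsForcing P b X Z) :
    eLpNorm (fun ω => X ω + Z ω) 2 P ≤
      NNReal.sqrt (1 + 𝒮.ℓ) * eLpNorm X 2 P + weightedSq 𝒮.σ (𝒮.G 0) ^ (2⁻¹ : ℝ) := by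
  obtain ⟨Z', -, hZ'⟩ := exists_isForcing hw hb hb.le le_rfl hb.measurable
    (X := fun _ => (0 : 𝓗)) stronglyMeasurable_const (by simp)
  have hmX : AEStronglyMeasurable X P := (hX.mono hb.le).aestronglyMeasurable
  have hmZ := hZ.aestronglyMeasurable hb hX
  have hmZ' := hZ'.aestronglyMeasurable hb stronglyMeasurable_const
  calc eLpNorm (fun ω => X ω + Z ω) 2 P
      = eLpNorm ((fun ω => X ω + Z ω - (0 + Z' ω)) + Z') 2 P := by
        congr 1
        ext ω
        simp
    _ ≤ eLpNorm (fun ω => X ω + Z ω - (0 + Z' ω)) 2 P + eLpNorm Z' 2 P :=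
        MeasureTheory.eLpNorm_add_le ((hmX.add hmZ).sub (aestronglyMeasurable_const.add hmZ'))
          hmZ' one_le_two
    _ ≤ _ := by
        gcongr
        · simpa using hZ.eLpNorm_add_sub_add_le hw hb hX stronglyMeasurable_const hZ'
        · exact hZ'.eLpNorm_le_of_zero hw hb

theorem IsForcing.eLpNorm_step_le (hX : StronglyMeasurable[m] X) (hZ : 𝒮.IsForcing P b X Z) :
    eLpNorm (fun ω => 𝒮.S (X ω + Z ω)) 2 P ≤ 𝒮.κ * eLpNorm X 2 P + 𝒮.drift := by
  have hm : AEStronglyMeasurable (fun ω => 𝒮.S (X ω + Z ω)) P :=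
    𝒮.lipschitz_S.continuous.comp_aestronglyMeasurable
      ((hX.mono hb.le).aestronglyMeasurable.add (hZ.aestronglyMeasurable hb hX))
  calc eLpNorm (fun ω => 𝒮.S (X ω + Z ω)) 2 P
      = eLpNorm ((fun ω => 𝒮.S (X ω + Z ω) - 𝒮.S 0) + fun _ => 𝒮.S 0) 2 P := by
        congr 1
        ext ω
        simp
    _ ≤ eLpNorm (fun ω => 𝒮.S (X ω + Z ω) - 𝒮.S 0) 2 P + eLpNorm (fun _ => 𝒮.S 0) 2 P :=
        MeasureTheory.eLpNorm_add_le (hm.sub aestronglyMeasurable_const)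
          aestronglyMeasurable_const one_le_two
    _ ≤ 𝒮.ρ * eLpNorm (fun ω => X ω + Z ω) 2 P + ‖𝒮.S 0‖ₑ := by
        gcongr
        · exact eLpNorm_le_nnreal_smul_eLpNorm_of_ae_le_mul (ae_of_all _ fun ω => by
            simpa only [nndist_eq_nnnorm, sub_zero] using 𝒮.lipschitz_S.nndist_le (X ω + Z ω) 0) 2
        · simp [eLpNorm_const _ two_ne_zero (IsProbabilityMeasure.ne_zero P)]
    _ ≤ 𝒮.ρ * (NNReal.sqrt (1 + 𝒮.ℓ) * eLpNorm X 2 P + weightedSq 𝒮.σ (𝒮.G 0) ^ (2⁻¹ : ℝ)) +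
          ‖𝒮.S 0‖ₑ := by
        gcongr
        exact hZ.eLpNorm_add_le hw hb hX
    _ ≤ 𝒮.κ * eLpNorm X 2 P + 𝒮.drift := by
        rw [mul_add, ← mul_assoc, ← ENNReal.coe_mul, add_assoc, drift]
        gcongr
        exact 𝒮.le_rate

omit hw hb

include hw

variable {x y : 𝓗} {U V : ℕ → Ω → 𝓗} (hc : IsNoise 𝓖 P γ c)

include hc

omit [CompleteSpace 𝓗] in
theorem IsTrajectory.eLpNorm_sub_le (hU : 𝒮.IsTrajectory 𝓖 P c x U)
    (hV : 𝒮.IsTrajectory 𝓖 P c y V) (n : ℕ) :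
    eLpNorm (fun ω => U n ω - V n ω) 2 P ≤ 𝒮.κ ^ n * ‖x - y‖ₑ := by
  induction n with
  | zero =>
    have hinit : (fun ω => U 0 ω - V 0 ω) =ᵐ[P] fun _ => x - y := by
      filter_upwards [hU.initial, hV.initial] with ω hUω hVω
      rw [hUω, hVω]
    simp [eLpNorm_congr_ae hinit, eLpNorm_const _ two_ne_zero (IsProbabilityMeasure.ne_zero P)]
  | succ n ih =>
    obtain ⟨Z, hZ, hstep⟩ := hU.step n
    obtain ⟨Z', hZ', hstep'⟩ := hV.step n
    calc eLpNorm (fun ω => U (n + 1) ω - V (n + 1) ω) 2 P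
        = eLpNorm (fun ω => 𝒮.S (U n ω + Z ω) - 𝒮.S (V n ω + Z' ω)) 2 P := by
          refine eLpNorm_congr_ae ?_
          filter_upwards [hstep, hstep'] with ω hω hω'
          rw [hω, hω']
      _ ≤ 𝒮.κ * eLpNorm (fun ω => U n ω - V n ω) 2 P := hZ.eLpNorm_step_sub_step_le hw
          (hc.increment n) (hU.adapted n) (hV.adapted n) hZ'
      _ ≤ 𝒮.κ * (𝒮.κ ^ n * ‖x - y‖ₑ) := by gcongr
      _ = 𝒮.κ ^ (n + 1) * ‖x - y‖ₑ := by rw [← mul_assoc, ← pow_succ']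

theorem IsTrajectory.eLpNorm_le (hU : 𝒮.IsTrajectory 𝓖 P c x U) (n : ℕ) :
    eLpNorm (U n) 2 P ≤ ‖x‖ₑ + 𝒮.drift / (1 - 𝒮.κ) := by
  have hzero : eLpNorm (U 0) 2 P = ‖x‖ₑ := by
    simp [eLpNorm_congr_ae hU.initial,
      eLpNorm_const _ two_ne_zero (IsProbabilityMeasure.ne_zero P)]
  rw [← hzero]
  refine le_add_div_one_sub_of_affine_le (u := fun n => eLpNorm (U n) 2 P) 𝒮.rate_lt_one
    (fun n => ?_) n
  obtain ⟨Z, hZ, hstep⟩ := hU.step n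
  rw [eLpNorm_congr_ae hstep]
  exact hZ.eLpNorm_step_le hw (hc.increment n) (hU.adapted n)

theorem exists_isTrajectory (x : 𝓗) : ∃ U, 𝒮.IsTrajectory 𝓖 P c x U := by
  let State (n : ℕ) := {U : Ω → 𝓗 // StronglyMeasurable[𝓖 n] U ∧ eLpNorm U 2 P < ∞}
  have hnext (n : ℕ) (U : State n) : ∃ V : State (n + 1), ∃ Z, 𝒮.IsForcing P (c n) U.1 Z ∧
      V.1 = fun ω => 𝒮.S (U.1 ω + Z ω) := by
    obtain ⟨Z, hmZ, hZ⟩ := exists_isForcing hw (hc.increment n) (hc.mono n)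
      (hc.increment (n + 1)).le (hc.measurable n) U.2.1 U.2.2
    refine ⟨⟨fun ω => 𝒮.S (U.1 ω + Z ω), 𝒮.lipschitz_S.continuous.comp_stronglyMeasurable
      ((U.2.1.mono (hc.mono n)).add hmZ), ?_⟩, Z, hZ, rfl⟩
    refine (hZ.eLpNorm_step_le hw (hc.increment n) U.2.1).trans_lt ?_
    have := 𝒮.drift_ne_top
    have := U.2.2.ne
    finiteness
  choose next Z hZ hstep using hnext
  let U (n : ℕ) : State n := Nat.rec ⟨fun _ => x, stronglyMeasurable_const, by
    simp [eLpNorm_const _ two_ne_zero (IsProbabilityMeasure.ne_zero P)]⟩ next n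
  exact ⟨fun n => (U n).1, ae_of_all _ fun ω => rfl, fun n => (U n).2.1, fun n =>
    ⟨Z n (U n), hZ n (U n), ae_of_all _ fun ω => congrFun (hstep n (U n)) ω⟩⟩

end ContractiveScheme

end Scheme

section Markov

variable {𝓗 : Type*} [NormedAddCommGroup 𝓗] [MeasurableSpace 𝓗]

theorem tendsto_integral_of_tendstoInMeasure [BorelSpace 𝓗] {Ω : Type*} {mΩ : MeasurableSpace Ω}
    {P : Measure Ω} [IsProbabilityMeasure P] {f : ℕ → Ω → 𝓗} {F : Ω → 𝓗}
    (hf : ∀ n, AEMeasurable (f n) P) (h : TendstoInMeasure P f atTop F) (φ : 𝓗 →ᵇ ℝ) :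
    Tendsto (fun n => ∫ ω, φ (f n ω) ∂P) atTop (𝓝 (∫ ω, φ (F ω) ∂P)) := by
  have hdist := h.tendstoInDistribution hf
  have hlim := ProbabilityMeasure.tendsto_iff_forall_integral_tendsto.1 hdist.tendsto φ
  simp only [ProbabilityMeasure.coe_mk] at hlim
  rw [integral_map hdist.aemeasurable_limit φ.continuous.aestronglyMeasurable] at hlim
  exact hlim.congr fun n => integral_map (hf n) φ.continuous.aestronglyMeasurable

theorem IsIndepIncrement.integral_comp_prod {Ω V : Type*} [MeasurableSpace V]
    {m mΩ : MeasurableSpace Ω} {P : Measure Ω} [IsProbabilityMeasure P] {γ : Measure (ℕ → ℝ)}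
    {b : Ω → ℕ → ℝ} (hb : IsIndepIncrement m P γ b) {Y : Ω → V} (hY : Measurable[m] Y)
    {Φ : V × (ℕ → ℝ) → ℝ} (hΦ : StronglyMeasurable Φ) {C : ℝ} (hC : ∀ z, ‖Φ z‖ ≤ C) :
    ∫ ω, Φ (Y ω, b ω) ∂P = ∫ ω, ∫ ξ, Φ (Y ω, ξ) ∂γ ∂P := by
  have hY' : Measurable Y := hY.mono hb.le le_rfl
  have hγ : IsProbabilityMeasure γ :=
    hb.law ▸ Measure.isProbabilityMeasure_map hb.measurable.aemeasurable
  have _hPY : IsProbabilityMeasure (P.map Y) := Measure.isProbabilityMeasure_map hY'.aemeasurable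
  have hint : Integrable Φ ((P.map Y).prod γ) :=
    .of_bound hΦ.aestronglyMeasurable C (ae_of_all _ hC)
  rw [← integral_map (hY'.prodMk hb.measurable).aemeasurable hΦ.aestronglyMeasurable,
    hb.map_prod hY, integral_prod _ hint,
    integral_map hY'.aemeasurable hΦ.integral_prod_right'.aestronglyMeasurable]

namespace ContractiveScheme

variable [InnerProductSpace ℝ 𝓗] (𝒮 : ContractiveScheme 𝓗)

/-- One step of the scheme driven by the first `N` coordinates of the noise. -/
def truncatedStep (N : ℕ) (z : 𝓗 × (ℕ → ℝ)) : 𝓗 :=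
  𝒮.S (z.1 + ∑ k ∈ Finset.range N, z.2 k • 𝒮.G z.1 k)

omit [MeasurableSpace 𝓗] in
/-- A family `X x` of trajectories of the scheme, one for each initial value `x`, driven by a
common white noise. -/
structure IsFlow {Ω : Type*} (𝓖 : ℕ → MeasurableSpace Ω) {mΩ : MeasurableSpace Ω} (P : Measure Ω)
    (γ : Measure (ℕ → ℝ)) (c : ℕ → Ω → ℕ → ℝ) (X : 𝓗 → ℕ → Ω → 𝓗) : Prop where
  white : IsWhite γ 𝒮.σ
  noise : IsNoise 𝓖 P γ c
  trajectory : ∀ x, 𝒮.IsTrajectory 𝓖 P c x (X x)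

variable {𝒮} [BorelSpace 𝓗] {Ω : Type*} {𝓖 : ℕ → MeasurableSpace Ω} {m mΩ : MeasurableSpace Ω}
  {P : Measure Ω} {γ : Measure (ℕ → ℝ)} {c : ℕ → Ω → ℕ → ℝ} {X : 𝓗 → ℕ → Ω → 𝓗}

namespace IsFlow

theorem measurable (h : 𝒮.IsFlow 𝓖 P γ c X) (x : 𝓗) (n : ℕ) : Measurable (X x n) :=
  (((h.trajectory x).adapted n).mono (h.noise.increment n).le).measurable

variable [IsProbabilityMeasure P]

theorem integrable_comp (h : 𝒮.IsFlow 𝓖 P γ c X) (n : ℕ) (φ : 𝓗 →ᵇ ℝ) (x : 𝓗) :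
    Integrable (fun ω => φ (X x n ω)) P :=
  Integrable.of_bound (φ.continuous.measurable.comp (h.measurable x n)).aestronglyMeasurable ‖φ‖
    (ae_of_all _ fun _ => φ.norm_coe_le_norm _)

variable [SecondCountableTopology 𝓗]

theorem lintegral_sub_le (h : 𝒮.IsFlow 𝓖 P γ c X) (x y : 𝓗) (n : ℕ) :
    ∫⁻ ω, ‖X x n ω - X y n ω‖ₑ ∂P ≤ 𝒮.κ ^ n * ‖x - y‖ₑ := by
  rw [← eLpNorm_one_eq_lintegral_enorm]
  exact (eLpNorm_le_eLpNorm_of_exponent_le one_le_two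
    ((h.measurable x n).sub (h.measurable y n)).aestronglyMeasurable).trans
    ((h.trajectory x).eLpNorm_sub_le h.white h.noise (h.trajectory y) n)

theorem continuous_integral (h : 𝒮.IsFlow 𝓖 P γ c X) (n : ℕ) (φ : 𝓗 →ᵇ ℝ) :
    Continuous fun x => ∫ ω, φ (X x n ω) ∂P := by
  refine continuous_iff_seqContinuous.2 fun y x hy => ?_
  refine tendsto_integral_of_tendstoInMeasure (fun j => (h.measurable _ n).aemeasurable) ?_ φ
  refine tendstoInMeasure_of_tendsto_eLpNorm one_ne_zero
    (fun j => (h.measurable _ n).aestronglyMeasurable)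
    (h.measurable _ n).aestronglyMeasurable ?_
  simp only [eLpNorm_one_eq_lintegral_enorm, Pi.sub_apply]
  have hdist : Tendsto (fun j => ‖y j - x‖ₑ) atTop (𝓝 0) := by
    simpa using (hy.sub_const x).enorm
  have hbound := ENNReal.Tendsto.const_mul (a := (𝒮.κ : ℝ≥0∞) ^ n) hdist (Or.inr (by finiteness))
  rw [mul_zero] at hbound
  exact tendsto_of_tendsto_of_tendsto_of_le_of_le tendsto_const_nhds hbound (fun j => zero_le)
    fun j => h.lintegral_sub_le _ _ n

/-- The transition operator `φ ↦ 𝔼 φ(Xₙ)` of the scheme on bounded continuous functions. -/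
noncomputable def transition (h : 𝒮.IsFlow 𝓖 P γ c X) (n : ℕ) (φ : 𝓗 →ᵇ ℝ) : 𝓗 →ᵇ ℝ :=
  .ofNormedAddCommGroup (fun x => ∫ ω, φ (X x n ω) ∂P) (h.continuous_integral n φ) ‖φ‖ fun x => by
    simpa using norm_integral_le_of_norm_le_const (μ := P) (f := fun ω => φ (X x n ω))
      (ae_of_all _ fun ω => φ.norm_coe_le_norm _)

theorem transition_apply (h : 𝒮.IsFlow 𝓖 P γ c X) (n : ℕ) (φ : 𝓗 →ᵇ ℝ) (x : 𝓗) :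
    h.transition n φ x = ∫ ω, φ (X x n ω) ∂P := rfl

theorem norm_transition_le (h : 𝒮.IsFlow 𝓖 P γ c X) (n : ℕ) (φ : 𝓗 →ᵇ ℝ) :
    ‖h.transition n φ‖ ≤ ‖φ‖ :=
  BoundedContinuousFunction.norm_ofNormedAddCommGroup_le _ (norm_nonneg φ) _

theorem lipschitzWith_transition (h : 𝒮.IsFlow 𝓖 P γ c X) (n : ℕ) {φ : 𝓗 →ᵇ ℝ} {K : ℝ≥0}
    (hφ : LipschitzWith K φ) : LipschitzWith (K * 𝒮.κ ^ n) (h.transition n φ) := by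
  intro x y
  rw [edist_eq_enorm_sub, edist_eq_enorm_sub, h.transition_apply, h.transition_apply,
    ← integral_sub (h.integrable_comp n φ x) (h.integrable_comp n φ y)]
  calc _ ≤ ∫⁻ ω, ‖φ (X x n ω) - φ (X y n ω)‖ₑ ∂P := enorm_integral_le_lintegral_enorm _
    _ ≤ ∫⁻ ω, K * ‖X x n ω - X y n ω‖ₑ ∂P := lintegral_mono fun ω => by
        simpa only [edist_eq_enorm_sub] using hφ (X x n ω) (X y n ω)
    _ = K * ∫⁻ ω, ‖X x n ω - X y n ω‖ₑ ∂P := lintegral_const_mul' _ _ ENNReal.coe_ne_top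
    _ ≤ K * (𝒮.κ ^ n * ‖x - y‖ₑ) := by
        gcongr
        exact h.lintegral_sub_le x y n
    _ = _ := by
        push_cast
        ring

theorem transition_zero (h : 𝒮.IsFlow 𝓖 P γ c X) (φ : 𝓗 →ᵇ ℝ) : h.transition 0 φ = φ := by
  ext x
  have hinit : (fun ω => φ (X x 0 ω)) =ᵐ[P] fun _ => φ x := by
    filter_upwards [(h.trajectory x).initial] with ω hω
    rw [hω]
  simp [h.transition_apply, integral_congr_ae hinit]

end IsFlow

theorem measurable_truncatedStep [SecondCountableTopology 𝓗] (N : ℕ) :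
    Measurable (𝒮.truncatedStep N) := by
  have hG (k : ℕ) : Measurable fun z : 𝓗 × (ℕ → ℝ) => 𝒮.G z.1 k :=
    (𝒮.continuous_G k).measurable.comp measurable_fst
  refine 𝒮.lipschitz_S.continuous.measurable.comp (measurable_fst.add ?_)
  exact Finset.measurable_fun_sum _ fun k _ => .smul (by fun_prop) (hG k)

variable [IsProbabilityMeasure P]

theorem IsForcing.tendsto_integral_truncatedStep {b : Ω → ℕ → ℝ} (hb : IsIndepIncrement m P γ b)
    {Y Z : Ω → 𝓗} (hY : StronglyMeasurable[m] Y) (hZ : 𝒮.IsForcing P b Y Z) (φ : 𝓗 →ᵇ ℝ) :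
    Tendsto (fun N => ∫ ω, φ (𝒮.truncatedStep N (Y ω, b ω)) ∂P) atTop
      (𝓝 (∫ ω, φ (𝒮.S (Y ω + Z ω)) ∂P)) := by
  have hsum : TendstoInMeasure P
      (fun N ω => Y ω + ∑ k ∈ Finset.range N, b ω k • 𝒮.G (Y ω) k) atTop fun ω => Y ω + Z ω := by
    simpa only [TendstoInMeasure, edist_add_left, IsForcing] using hZ
  refine tendsto_integral_of_tendstoInMeasure (fun N => ?_) hsum
    (φ.compContinuous ⟨𝒮.S, 𝒮.lipschitz_S.continuous⟩)
  exact ((hY.mono hb.le).add (stronglyMeasurable_sum_smul hb.measurable hb.le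
    (stronglyMeasurable_G hY) _)).measurable.aemeasurable

namespace IsFlow

variable [SecondCountableTopology 𝓗]

theorem tendsto_integral_truncatedStep (h : 𝒮.IsFlow 𝓖 P γ c X) (n : ℕ) (φ : 𝓗 →ᵇ ℝ) (x : 𝓗) :
    Tendsto (fun N => ∫ ω, ∫ ξ, φ (𝒮.truncatedStep N (X x n ω, ξ)) ∂γ ∂P) atTop
      (𝓝 (h.transition (n + 1) φ x)) := by
  obtain ⟨Z, hZ, hstep⟩ := (h.trajectory x).step n
  have hnext : ∫ ω, φ (𝒮.S (X x n ω + Z ω)) ∂P = h.transition (n + 1) φ x := by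
    rw [h.transition_apply]
    refine integral_congr_ae ?_
    filter_upwards [hstep] with ω hω
    rw [hω]
  rw [← hnext]
  refine (hZ.tendsto_integral_truncatedStep (h.noise.increment n) ((h.trajectory x).adapted n)
    φ).congr fun N => ?_
  exact (h.noise.increment n).integral_comp_prod ((h.trajectory x).adapted n).measurable
    (φ.continuous.measurable.comp (measurable_truncatedStep N)).stronglyMeasurable
    fun _ => φ.norm_coe_le_norm _

theorem tendsto_integral_truncatedStep_const (h : 𝒮.IsFlow 𝓖 P γ c X) (φ : 𝓗 →ᵇ ℝ) (x : 𝓗) :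
    Tendsto (fun N => ∫ ξ, φ (𝒮.truncatedStep N (x, ξ)) ∂γ) atTop (𝓝 (h.transition 1 φ x)) := by
  refine (h.tendsto_integral_truncatedStep 0 φ x).congr fun N => ?_
  have hinit : (fun ω => ∫ ξ, φ (𝒮.truncatedStep N (X x 0 ω, ξ)) ∂γ) =ᵐ[P]
      fun _ => ∫ ξ, φ (𝒮.truncatedStep N (x, ξ)) ∂γ := by
    filter_upwards [(h.trajectory x).initial] with ω hω
    rw [hω]
  simp [integral_congr_ae hinit]

theorem transition_succ (h : 𝒮.IsFlow 𝓖 P γ c X) (n : ℕ) (φ : 𝓗 →ᵇ ℝ) :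
    h.transition (n + 1) φ = h.transition n (h.transition 1 φ) := by
  have := h.white.isProbabilityMeasure
  ext x
  refine tendsto_nhds_unique (h.tendsto_integral_truncatedStep n φ x) ?_
  rw [h.transition_apply]
  refine tendsto_integral_of_dominated_convergence (fun _ => ‖φ‖) (fun N => ?_)
    (integrable_const _) (fun N => ae_of_all _ fun ω => ?_)
    (ae_of_all _ fun ω => h.tendsto_integral_truncatedStep_const φ _)
  · have hm : StronglyMeasurable fun z => φ (𝒮.truncatedStep N z) :=
      (φ.continuous.measurable.comp (measurable_truncatedStep N)).stronglyMeasurable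
    exact (hm.integral_prod_right'.measurable.comp (h.measurable x n)).aestronglyMeasurable
  · simpa using norm_integral_le_of_norm_le_const (μ := γ)
      (f := fun ξ => φ (𝒮.truncatedStep N (X x n ω, ξ))) (ae_of_all _ fun ξ => φ.norm_coe_le_norm _)

theorem transition_add (h : 𝒮.IsFlow 𝓖 P γ c X) (m n : ℕ) (φ : 𝓗 →ᵇ ℝ) :
    h.transition (m + n) φ = h.transition m (h.transition n φ) := by
  induction n generalizing φ with
  | zero => rw [h.transition_zero, add_zero]
  | succ n ih => rw [← add_assoc, h.transition_succ (m + n), ih, ← h.transition_succ n]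

end IsFlow

end ContractiveScheme

end Markov

section Invariant

theorem lintegral_enorm_le_of_tendsto {V : Type*} [NormedAddCommGroup V] [MeasurableSpace V]
    [BorelSpace V] {ν : ℕ → ProbabilityMeasure V} {π : ProbabilityMeasure V}
    (hν : Tendsto ν atTop (𝓝 π)) {B : ℝ≥0∞} (hB : ∀ n, ∫⁻ y, ‖y‖ₑ ∂(ν n : Measure V) ≤ B) :
    ∫⁻ y, ‖y‖ₑ ∂(π : Measure V) ≤ B := by
  simp only [← ofReal_norm] at hB ⊢
  refine (lintegral_le_liminf_lintegral_of_forall_isOpen_measure_le_liminf_measure continuous_norm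
    (fun _ => norm_nonneg _) fun U hU =>
      ProbabilityMeasure.le_liminf_measure_open_of_tendsto hν hU).trans ?_
  exact liminf_le_of_frequently_le' (Frequently.of_forall hB)

theorem tendsto_of_forall_lipschitzWith {V : Type*} [NormedAddCommGroup V] [MeasurableSpace V]
    [OpensMeasurableSpace V] {ν : ℕ → ProbabilityMeasure V} {π : ProbabilityMeasure V}
    (h : ∀ (φ : V →ᵇ ℝ) (K : ℝ≥0), LipschitzWith K φ →
      Tendsto (fun n => ∫ y, φ y ∂(ν n : Measure V)) atTop (𝓝 (∫ y, φ y ∂(π : Measure V)))) :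
    Tendsto ν atTop (𝓝 π) := by
  rw [tendsto_iff_forall_lipschitz_integral_tendsto]
  rintro φ ⟨B, hB⟩ ⟨K, hK⟩
  exact h (.mkOfBound ⟨φ, hK.continuous⟩ B hB) K hK

theorem isTightMeasureSet_range_map_of_norm_le {ι V V' Ω : Type*} [NormedAddCommGroup V]
    [TopologicalSpace V'] [T2Space V'] [MeasurableSpace V'] [OpensMeasurableSpace V']
    {mΩ : MeasurableSpace Ω} {P : Measure Ω} {T : V → V'}
    (hT : ∀ R : ℝ, ∃ K, IsCompact K ∧ ∀ w, ‖w‖ ≤ R → T w ∈ K) {Y : ι → Ω → V} {X : ι → Ω → V'}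
    (hY : ∀ i, AEStronglyMeasurable (Y i) P) (hX : ∀ i, AEMeasurable (X i) P)
    (hXY : ∀ i, X i =ᵐ[P] fun ω => T (Y i ω)) {B : ℝ≥0}
    (hB : ∀ i, ∫⁻ ω, ‖Y i ω‖ₑ ∂P ≤ B) :
    IsTightMeasureSet (Set.range fun i => P.map (X i)) := by
  rw [isTightMeasureSet_iff_exists_isCompact_measure_compl_le]
  intro ε hε
  rcases eq_or_ne ε ∞ with rfl | hε_top
  · exact ⟨∅, isCompact_empty, fun _ _ => le_top⟩
  lift ε to ℝ≥0 using hε_top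
  have hε_ne : ε ≠ 0 := by exact_mod_cast hε.ne'
  set R : ℝ≥0 := B / ε + 1
  obtain ⟨K, hK, hTK⟩ := hT R
  refine ⟨K, hK, ?_⟩
  rintro _ ⟨i, rfl⟩
  rw [Measure.map_apply_of_aemeasurable (hX i) hK.isClosed.measurableSet.compl]
  calc P (X i ⁻¹' Kᶜ) ≤ P {ω | (R : ℝ≥0∞) ≤ ‖Y i ω‖ₑ} := by
        refine measure_mono_ae ?_
        filter_upwards [hXY i] with ω hω hωK
        by_contra hlt
        have hnorm : ‖Y i ω‖₊ < R := by exact_mod_cast lt_of_not_ge hlt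
        refine hωK ?_
        rw [hω]
        exact hTK _ (by exact_mod_cast hnorm.le)
    _ ≤ (∫⁻ ω, ‖Y i ω‖ₑ ∂P) / R :=
        meas_ge_le_lintegral_div (hY i).enorm (by simp [R]) (by finiteness)
    _ ≤ ε := by
        refine ENNReal.div_le_of_le_mul ((hB i).trans ?_)
        have hle : B ≤ ε * R := by
          rw [mul_add, mul_div_cancel₀ _ hε_ne]
          exact le_self_add
        exact_mod_cast hle

namespace ContractiveScheme.IsFlow

variable {𝓗 : Type*} [NormedAddCommGroup 𝓗] [MeasurableSpace 𝓗] [InnerProductSpace ℝ 𝓗]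
  [BorelSpace 𝓗] {𝒮 : ContractiveScheme 𝓗} {Ω : Type*} {𝓖 : ℕ → MeasurableSpace Ω}
  {mΩ : MeasurableSpace Ω} {P : Measure Ω} [IsProbabilityMeasure P] {γ : Measure (ℕ → ℝ)}
  {c : ℕ → Ω → ℕ → ℝ} {X : 𝓗 → ℕ → Ω → 𝓗}

/-- The law of the `n`-th iterate of the scheme started at `x`. -/
noncomputable def law (h : 𝒮.IsFlow 𝓖 P γ c X) (x : 𝓗) (n : ℕ) : ProbabilityMeasure 𝓗 :=
  ⟨P.map (X x n), Measure.isProbabilityMeasure_map (h.measurable x n).aemeasurable⟩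

variable [SecondCountableTopology 𝓗]

theorem integral_law (h : 𝒮.IsFlow 𝓖 P γ c X) (x : 𝓗) (n : ℕ) (φ : 𝓗 →ᵇ ℝ) :
    ∫ y, φ y ∂(h.law x n : Measure 𝓗) = h.transition n φ x :=
  integral_map (h.measurable x n).aemeasurable φ.continuous.aestronglyMeasurable

section Moments

variable [CompleteSpace 𝓗]

theorem exists_eLpNorm_le (h : 𝒮.IsFlow 𝓖 P γ c X) (x : 𝓗) :
    ∃ B : ℝ≥0, ∀ n, eLpNorm (X x n) 2 P ≤ B := by
  have := 𝒮.drift_ne_top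
  have hκ : (1 : ℝ≥0∞) - 𝒮.κ ≠ 0 := (tsub_pos_of_lt (by exact_mod_cast 𝒮.rate_lt_one)).ne'
  have hfin : ‖x‖ₑ + 𝒮.drift / (1 - 𝒮.κ) ≠ ∞ := by finiteness
  lift ‖x‖ₑ + 𝒮.drift / (1 - 𝒮.κ) to ℝ≥0 using hfin with B hB
  exact ⟨B, fun n => hB ▸ (h.trajectory x).eLpNorm_le h.white h.noise n⟩

theorem exists_lintegral_enorm_le (h : 𝒮.IsFlow 𝓖 P γ c X) (x : 𝓗) :
    ∃ B : ℝ≥0, ∀ n, ∫⁻ ω, ‖X x n ω‖ₑ ∂P ≤ B := by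
  obtain ⟨B, hB⟩ := h.exists_eLpNorm_le x
  refine ⟨B, fun n => ?_⟩
  rw [← eLpNorm_one_eq_lintegral_enorm]
  exact (eLpNorm_le_eLpNorm_of_exponent_le one_le_two
    (h.measurable x n).aestronglyMeasurable).trans (hB n)

theorem isTightMeasureSet_law (h : 𝒮.IsFlow 𝓖 P γ c X)
    (hS : ∀ R : ℝ, ∃ K, IsCompact K ∧ ∀ w, ‖w‖ ≤ R → 𝒮.S w ∈ K) (x : 𝓗) :
    IsTightMeasureSet (Set.range fun n => (h.law x (n + 1) : Measure 𝓗)) := by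
  choose Z hZ hstep using (h.trajectory x).step
  obtain ⟨B, hB⟩ := h.exists_eLpNorm_le x
  have hfin := 𝒮.weightedSq_G_zero
  have hZm (n : ℕ) : AEStronglyMeasurable (fun ω => X x n ω + Z n ω) P :=
    (h.measurable x n).aestronglyMeasurable.add
      ((hZ n).aestronglyMeasurable (h.noise.increment n) ((h.trajectory x).adapted n))
  have hmoment (n : ℕ) : ∫⁻ ω, ‖X x n ω + Z n ω‖ₑ ∂P ≤
      (NNReal.sqrt (1 + 𝒮.ℓ) * B + (weightedSq 𝒮.σ (𝒮.G 0) ^ (2⁻¹ : ℝ)).toNNReal : ℝ≥0) := by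
    rw [← eLpNorm_one_eq_lintegral_enorm]
    refine (eLpNorm_le_eLpNorm_of_exponent_le one_le_two (hZm n)).trans
      (((hZ n).eLpNorm_add_le h.white (h.noise.increment n)
        ((h.trajectory x).adapted n)).trans ?_)
    rw [ENNReal.coe_add, ENNReal.coe_mul, ENNReal.coe_toNNReal (by finiteness)]
    gcongr
    exact hB n
  exact isTightMeasureSet_range_map_of_norm_le hS hZm
    (fun n => (h.measurable x (n + 1)).aemeasurable) hstep hmoment

end Moments

theorem dist_transition_succ_le (h : 𝒮.IsFlow 𝓖 P γ c X) {B : ℝ≥0} {x : 𝓗}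
    (hB : ∫⁻ ω, ‖X x 1 ω - x‖ₑ ∂P ≤ B) {φ : 𝓗 →ᵇ ℝ} {K : ℝ≥0} (hφ : LipschitzWith K φ) (n : ℕ) :
    dist (h.transition n φ x) (h.transition (n + 1) φ x) ≤ K * B * 𝒮.κ ^ n := by
  have hdiff : h.transition (n + 1) φ x - h.transition n φ x =
      ∫ ω, (h.transition n φ (X x 1 ω) - h.transition n φ x) ∂P := by
    rw [integral_sub (h.integrable_comp 1 _ x) (integrable_const _), add_comm, h.transition_add,
      ← h.transition_apply 1]
    simp
  have hedist : edist (h.transition n φ x) (h.transition (n + 1) φ x) ≤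
      (K * B * 𝒮.κ ^ n : ℝ≥0) := by
    rw [edist_comm, edist_eq_enorm_sub, hdiff]
    calc _ ≤ ∫⁻ ω, ‖h.transition n φ (X x 1 ω) - h.transition n φ x‖ₑ ∂P :=
          enorm_integral_le_lintegral_enorm _
      _ ≤ ∫⁻ ω, (K * 𝒮.κ ^ n : ℝ≥0) * ‖X x 1 ω - x‖ₑ ∂P := lintegral_mono fun ω => by
          simpa only [edist_eq_enorm_sub] using h.lipschitzWith_transition n hφ (X x 1 ω) x
      _ = (K * 𝒮.κ ^ n : ℝ≥0) * ∫⁻ ω, ‖X x 1 ω - x‖ₑ ∂P :=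
          lintegral_const_mul' _ _ ENNReal.coe_ne_top
      _ ≤ (K * 𝒮.κ ^ n : ℝ≥0) * B := by gcongr
      _ = _ := by rw [← ENNReal.coe_mul, mul_right_comm]
  rw [edist_nndist, ENNReal.coe_le_coe] at hedist
  exact_mod_cast hedist

/-- Invariance of a probability measure under the transition operators of the scheme. -/
def IsInvariant (h : 𝒮.IsFlow 𝓖 P γ c X) (π : Measure 𝓗) : Prop :=
  ∀ (n : ℕ) (φ : 𝓗 →ᵇ ℝ), ∫ y, h.transition n φ y ∂π = ∫ y, φ y ∂π

theorem isInvariant_of_tendsto (h : 𝒮.IsFlow 𝓖 P γ c X) {x : 𝓗} {π : ProbabilityMeasure 𝓗}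
    (hπ : Tendsto (h.law x) atTop (𝓝 π)) : h.IsInvariant π := by
  intro n φ
  have hlim := ProbabilityMeasure.tendsto_iff_forall_integral_tendsto.1 hπ
  simp only [h.integral_law] at hlim
  refine tendsto_nhds_unique (hlim (h.transition n φ)) ?_
  simpa only [Function.comp_def, h.transition_add] using
    (hlim φ).comp (tendsto_add_atTop_nat n)

variable {π : Measure 𝓗} [IsProbabilityMeasure π] {φ : 𝓗 →ᵇ ℝ} {K : ℝ≥0}

theorem abs_transition_sub_le (h : 𝒮.IsFlow 𝓖 P γ c X) (hint : Integrable (fun y => y) π)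
    (hπ : h.IsInvariant π) (hφ : LipschitzWith K φ) (n : ℕ) (x : 𝓗) :
    |h.transition n φ x - ∫ y, φ y ∂π| ≤ K * 𝒮.κ ^ n * ∫ y, ‖x - y‖ ∂π := by
  have hdiff : h.transition n φ x - ∫ y, φ y ∂π =
      ∫ y, (h.transition n φ x - h.transition n φ y) ∂π := by
    rw [integral_sub (integrable_const _) ((h.transition n φ).integrable π), hπ]
    simp
  rw [hdiff, ← integral_const_mul, ← Real.norm_eq_abs]
  refine norm_integral_le_of_norm_le ((((integrable_const x).sub hint).norm).const_mul _)
    (ae_of_all _ fun y => ?_)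
  simpa only [dist_eq_norm, NNReal.coe_mul, NNReal.coe_pow] using
    (h.lipschitzWith_transition n hφ).dist_le_mul x y

theorem tendsto_transition (h : 𝒮.IsFlow 𝓖 P γ c X) (hint : Integrable (fun y => y) π)
    (hπ : h.IsInvariant π) (hφ : LipschitzWith K φ) (x : 𝓗) :
    Tendsto (fun n => h.transition n φ x) atTop (𝓝 (∫ y, φ y ∂π)) := by
  rw [tendsto_iff_dist_tendsto_zero]
  refine squeeze_zero (fun _ => dist_nonneg)
    (fun n => h.abs_transition_sub_le hint hπ hφ n x) ?_
  have hpow := tendsto_pow_atTop_nhds_zero_of_lt_one 𝒮.κ.coe_nonneg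
    (NNReal.coe_lt_one.2 𝒮.rate_lt_one)
  simpa using (hpow.const_mul (K : ℝ)).mul_const (∫ y, ‖x - y‖ ∂π)

omit [IsProbabilityMeasure π] in
theorem eq_of_isInvariant (h : 𝒮.IsFlow 𝓖 P γ c X) {π μ : ProbabilityMeasure 𝓗}
    (hint : Integrable (fun y => y) (π : Measure 𝓗)) (hπ : h.IsInvariant π)
    (hμ : h.IsInvariant μ) : μ = π := by
  have hlim : Tendsto (fun _ : ℕ => μ) atTop (𝓝 π) :=
    tendsto_of_forall_lipschitzWith fun φ K hφ => by
      have hdom : Tendsto (fun n => ∫ y, h.transition n φ y ∂(μ : Measure 𝓗)) atTop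
          (𝓝 (∫ _, (∫ z, φ z ∂(π : Measure 𝓗)) ∂(μ : Measure 𝓗))) :=
        tendsto_integral_of_dominated_convergence (fun _ => ‖φ‖)
          (fun n => (h.transition n φ).continuous.aestronglyMeasurable) (integrable_const _)
          (fun n => ae_of_all _ fun y => (h.transition n φ).norm_coe_le_norm y |>.trans
            (h.norm_transition_le n φ))
          (ae_of_all _ fun y => h.tendsto_transition hint hπ hφ y)
      simpa [hμ _ φ] using hdom
  exact tendsto_nhds_unique tendsto_const_nhds hlim

section Existence

variable [CompleteSpace 𝓗]

theorem exists_tendsto_law (h : 𝒮.IsFlow 𝓖 P γ c X)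
    (hS : ∀ R : ℝ, ∃ K, IsCompact K ∧ ∀ w, ‖w‖ ≤ R → 𝒮.S w ∈ K) (x : 𝓗) :
    ∃ π, Tendsto (h.law x) atTop (𝓝 π) := by
  have htight := h.isTightMeasureSet_law hS x
  obtain ⟨π, -, ψ, hψ, hlim⟩ := (isCompact_closure_of_isTightMeasureSet
    (S := Set.range fun n => h.law x (n + 1)) (by simpa [Set.range] using htight)).tendsto_subseq
      (x := fun n => h.law x (n + 1)) fun n => subset_closure (Set.mem_range_self n)
  refine ⟨π, tendsto_of_forall_lipschitzWith fun φ K hφ => ?_⟩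
  have hsub := ProbabilityMeasure.tendsto_iff_forall_integral_tendsto.1 hlim φ
  obtain ⟨A, hA⟩ := h.exists_lintegral_enorm_le x
  have hint : Integrable (X x 1) P :=
    ⟨(h.measurable x 1).aestronglyMeasurable, (hA 1).trans_lt ENNReal.coe_lt_top⟩
  have hfin := (hint.sub (integrable_const x)).2.ne
  lift ∫⁻ ω, ‖X x 1 ω - x‖ₑ ∂P to ℝ≥0 using hfin with B hB
  simp only [Function.comp_apply, h.integral_law] at hsub ⊢
  exact tendsto_nhds_of_cauchySeq_of_subseq
    (cauchySeq_of_le_geometric 𝒮.κ (K * B) (by exact_mod_cast 𝒮.rate_lt_one)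
      (h.dist_transition_succ_le hB.ge hφ)) ((tendsto_add_atTop_nat 1).comp hψ.tendsto_atTop) hsub

theorem exists_isInvariant (h : 𝒮.IsFlow 𝓖 P γ c X)
    (hS : ∀ R : ℝ, ∃ K, IsCompact K ∧ ∀ w, ‖w‖ ≤ R → 𝒮.S w ∈ K) :
    ∃ π : ProbabilityMeasure 𝓗,
      Integrable (fun y => y) (π : Measure 𝓗) ∧ h.IsInvariant π := by
  obtain ⟨π, hπ⟩ := h.exists_tendsto_law hS 0
  obtain ⟨B, hB⟩ := h.exists_lintegral_enorm_le 0
  refine ⟨π, ⟨aestronglyMeasurable_id, ?_⟩, h.isInvariant_of_tendsto hπ⟩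
  exact (lintegral_enorm_le_of_tendsto hπ fun n =>
    (lintegral_map measurable_enorm (h.measurable 0 n)).trans_le (hB n)).trans_lt
      ENNReal.coe_lt_top

end Existence

end ContractiveScheme.IsFlow

end Invariant

section Wiener

theorem integral_eval_infinitePi_gaussianReal (v : ℕ → ℝ≥0) (k : ℕ) :
    ∫ ξ : ℕ → ℝ, ξ k ∂(Measure.infinitePi fun k => gaussianReal 0 (v k)) = 0 := by
  have heval := measurePreserving_eval_infinitePi (fun k => gaussianReal 0 (v k)) k
  have hmap := integral_map heval.aemeasurable (f := fun x : ℝ => x) aestronglyMeasurable_id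
  rw [heval.map_eq, integral_id_gaussianReal] at hmap
  exact hmap.symm

theorem integral_eval_mul_eval_infinitePi_gaussianReal (v : ℕ → ℝ≥0) (j k : ℕ) :
    ∫ ξ : ℕ → ℝ, ξ j * ξ k ∂(Measure.infinitePi fun k => gaussianReal 0 (v k)) =
      if j = k then (v j : ℝ) else 0 := by
  split_ifs with hjk
  · subst hjk
    have heval := measurePreserving_eval_infinitePi (fun k => gaussianReal 0 (v k)) j
    have hvar := variance_fun_id_gaussianReal (μ := 0) (v := v j)
    rw [variance_of_integral_eq_zero (by fun_prop) integral_id_gaussianReal] at hvar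
    rw [← hvar, ← heval.map_eq, integral_map heval.aemeasurable (by fun_prop)]
    simp only [sq]
  · have hind := (iIndepFun_infinitePi (P := fun k => gaussianReal 0 (v k))
      (X := fun _ x => x) fun _ => measurable_id).indepFun hjk
    rw [hind.integral_fun_mul_eq_mul_integral (measurable_pi_apply j).aestronglyMeasurable
      (measurable_pi_apply k).aestronglyMeasurable, integral_eval_infinitePi_gaussianReal,
      zero_mul]

theorem isWhite_infinitePi_gaussianReal (v : ℕ → ℝ≥0) :
    IsWhite (Measure.infinitePi fun k => gaussianReal 0 (v k)) v where
  isProbabilityMeasure := inferInstance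
  memLp k := (memLp_id_gaussianReal' 2 ENNReal.ofNat_ne_top).comp_measurePreserving
    (measurePreserving_eval_infinitePi _ k)
  mean := integral_eval_infinitePi_gaussianReal v
  covariance := integral_eval_mul_eval_infinitePi_gaussianReal v

theorem hasLaw_const_mul_brownian_sub {Ω : Type*} {mΩ : MeasurableSpace Ω} {P : Measure Ω}
    {B : ℝ≥0 → Ω → ℝ} (hB : IsPreBrownianReal B P) {s t : ℝ≥0} (hst : s ≤ t) (a : ℝ) :
    HasLaw (fun ω => a * (B t ω - B s ω)) (gaussianReal 0 ((t - s) * (a ^ 2).toNNReal)) P := by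
  convert! gaussianReal_const_mul (hB.hasLaw_sub t s) a using 2
  · simp
  · ext
    simp only [NNReal.coe_mul, NNReal.coe_sub hst, Real.coe_toNNReal _ (sq_nonneg a), coe_nndist,
      NNReal.coe_mk, mul_comm (a ^ 2)]
    exact congrArg (· * a ^ 2) (abs_of_nonneg (sub_nonneg.2 (NNReal.coe_le_coe.2 hst))).symm

theorem inner_eq_of_hasSum_smul {ι 𝕜 V : Type*} [RCLike 𝕜] [NormedAddCommGroup V]
    [InnerProductSpace 𝕜 V] {e : ι → V} (he : Orthonormal 𝕜 e) {a : ι → 𝕜} {w : V}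
    (h : HasSum (fun i => a i • e i) w) (i : ι) : inner 𝕜 (e i) w = a i := by
  have hinner := (innerSL 𝕜 (e i)).hasSum h
  have hsingle := hasSum_single (f := fun j => innerSL 𝕜 (e i) (a j • e j)) i fun j hj => by
    rw [innerSL_apply_apply, inner_smul_right, he.2 hj.symm, mul_zero]
  rw [← innerSL_apply_apply 𝕜, hinner.unique hsingle, innerSL_apply_apply, inner_smul_right,
    inner_self_eq_norm_sq_to_K, he.1]
  simp

variable {d : ℕ} {O : Set (E d)} {Q : Covariance O} {Ω : Type*} {mΩ : MeasurableSpace Ω}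
  {𝓕 : Filtration ℝ≥0 mΩ} {P : Measure Ω} [IsProbabilityMeasure P] {W : ℝ≥0 → Ω → H O}

theorem IsQWiener.map_inner_sub (hW : IsQWiener Q 𝓕 P W) {s t : ℝ≥0} (hst : s ≤ t) :
    P.map (fun ω k => ⟪Q.basis k, W t ω - W s ω⟫) =
      Measure.infinitePi fun k => gaussianReal 0 ((t - s) * (Q.eig k).toNNReal) := by
  obtain ⟨β, hβ, hind, hsum⟩ := hW.expansion
  have hcoord : (fun ω k => ⟪Q.basis k, W t ω - W s ω⟫) =ᵐ[P]
      fun ω k => √(Q.eig k) * (β k t ω - β k s ω) := by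
    filter_upwards [hsum t, hsum s] with ω ht hs
    ext k
    rw [inner_sub_right, inner_eq_of_hasSum_smul Q.basis.orthonormal ht,
      inner_eq_of_hasSum_smul Q.basis.orthonormal hs, mul_sub]
  have hlaw (k : ℕ) : HasLaw (fun ω => √(Q.eig k) * (β k t ω - β k s ω))
      (gaussianReal 0 ((t - s) * (Q.eig k).toNNReal)) P := by
    simpa only [Real.sq_sqrt (Q.eig_pos k).le] using
      hasLaw_const_mul_brownian_sub (hβ k).toIsPreBrownianReal hst (√(Q.eig k))
  have hind_coord : iIndepFun (fun k ω => √(Q.eig k) * (β k t ω - β k s ω)) P :=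
    hind.comp (fun k b => √(Q.eig k) * (b t - b s)) fun k => by fun_prop
  rw [Measure.map_congr hcoord, (iIndepFun_iff_map_fun_eq_infinitePi_map₀'
    fun k => (hlaw k).aemeasurable).1 hind_coord]
  congr with k
  rw [(hlaw k).map_eq]

/-- The coordinates, along the eigenbasis of `Q`, of the increments of `W` over the grid `n τ`. -/
noncomputable def gridNoise (Q : Covariance O) (W : ℝ≥0 → Ω → H O) (τ : ℝ≥0) (n : ℕ) (ω : Ω)
    (k : ℕ) : ℝ :=
  ⟪Q.basis k, W ((n + 1 : ℕ) * τ) ω - W (n * τ) ω⟫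

theorem natCast_mul_le_succ (τ : ℝ≥0) (n : ℕ) : (n : ℝ≥0) * τ ≤ (n + 1 : ℕ) * τ := by
  gcongr
  exact n.le_succ

theorem IsQWiener.map_gridNoise (hW : IsQWiener Q 𝓕 P W) (τ : ℝ≥0) (n : ℕ) :
    P.map (gridNoise Q W τ n) =
      Measure.infinitePi fun k => gaussianReal 0 (τ * (Q.eig k).toNNReal) := by
  have hlength : ((n + 1 : ℕ) : ℝ≥0) * τ - n * τ = τ := by
    rw [Nat.cast_add_one, add_mul, one_mul, add_tsub_cancel_left]
  exact (hW.map_inner_sub (natCast_mul_le_succ τ n)).trans (by rw [hlength])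

theorem IsQWiener.isNoise_gridNoise (hW : IsQWiener Q 𝓕 P W) (τ : ℝ≥0) :
    IsNoise (fun n => 𝓕 (n * τ)) P
      (Measure.infinitePi fun k => gaussianReal 0 (τ * (Q.eig k).toNNReal))
      (gridNoise Q W τ) := by
  have hle := natCast_mul_le_succ τ
  have hinner : Measurable fun (w : H O) (k : ℕ) => ⟪Q.basis k, w⟫ :=
    measurable_pi_lambda _ fun k => (innerSL ℝ (Q.basis k)).continuous.measurable
  have hmeas (n : ℕ) : Measurable[𝓕 ((n + 1 : ℕ) * τ)] (gridNoise Q W τ n) :=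
    hinner.comp ((hW.adapted _).sub ((hW.adapted _).mono (𝓕.mono (hle n)))).measurable
  refine ⟨fun n => 𝓕.mono (hle n), hmeas, fun n =>
    ⟨𝓕.le _, (hmeas n).mono (𝓕.le _) le_rfl, ?_, hW.map_gridNoise τ n⟩⟩
  refine indep_of_indep_of_le_left (hW.indep_increment _ _ (hle n)) ?_
  rintro _ ⟨B, hB, rfl⟩
  exact ⟨_, hinner hB, rfl⟩

end Wiener

section Rate

variable {lam L₁ L₆ τ : ℝ}

theorem gamma6_pos (hL₆ : 0 ≤ L₆) (hL : L₁ + L₆ / 2 < lam) : 0 < gamma6 lam L₁ L₆ :=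
  div_pos (by linarith) (by linarith)

theorem one_add_mul_le_exp_gamma6 (hL₆ : 0 ≤ L₆) (hL : L₁ + L₆ / 2 < lam) (hτ : 0 ≤ τ)
    (hτ1 : τ ≤ 1) :
    1 + τ * L₆ ≤ Real.exp (-(gamma6 lam L₁ L₆ * τ)) * (1 + τ * (lam - L₁)) ^ 2 := by
  have hγ := gamma6_pos hL₆ hL
  set γ := gamma6 lam L₁ L₆ with hγ_def
  set a := lam - L₁
  have ha : 0 < a := by linarith
  have hγa : γ * (2 * a + 1) = 2 * a - L₆ := by
    rw [hγ_def, gamma6]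
    exact div_mul_cancel₀ _ (by positivity)
  have hgap : 0 ≤ 2 * a * γ * τ * (1 - τ) := mul_nonneg (by positivity) (sub_nonneg.2 hτ1)
  calc 1 + τ * L₆ ≤ (1 - γ * τ) * (1 + 2 * a * τ) := by
        linear_combination hgap + τ * hγa
    _ ≤ Real.exp (-(γ * τ)) * (1 + 2 * a * τ) := by
        gcongr
        linarith [Real.add_one_le_exp (-(γ * τ))]
    _ ≤ Real.exp (-(γ * τ)) * (1 + τ * a) ^ 2 := by
        gcongr
        linear_combination sq_nonneg (τ * a)

end Rate

section LipSeminorm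

variable {d : ℕ} {O : Set (E d)} {φ : H O → ℝ}

theorem lipSeminorm_nonneg (φ : H O → ℝ) : 0 ≤ lipSeminorm φ := by
  refine Real.sSup_nonneg ?_
  rintro _ ⟨x, y, -, rfl⟩
  positivity

theorem IsLipB.lipschitzWith (hφ : IsLipB φ) : LipschitzWith (lipSeminorm φ).toNNReal φ := by
  obtain ⟨⟨K, hK⟩, -⟩ := hφ
  refine LipschitzWith.of_dist_le_mul fun x y => ?_
  rw [Real.coe_toNNReal _ (lipSeminorm_nonneg φ)]
  rcases eq_or_ne x y with rfl | hxy
  · simp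
  rw [Real.dist_eq, dist_eq_norm, ← div_le_iff₀ (norm_pos_iff.2 (sub_ne_zero.2 hxy))]
  refine le_csSup ⟨K, ?_⟩ ⟨x, y, hxy, rfl⟩
  rintro _ ⟨x', y', hne, rfl⟩
  rw [div_le_iff₀ (norm_pos_iff.2 (sub_ne_zero.2 hne)), ← Real.dist_eq, ← dist_eq_norm]
  exact hK.dist_le_mul x' y'

end LipSeminorm

section Euler

variable {d : ℕ} {O : Set (E d)} {f : ℝ → ℝ} {L₁ L₂ L₃ L₄ L₅ q : ℝ} {Q : Covariance O}
  {G : H O → ℕ → H O} {L₆ L₇ L₈ : ℝ} {τ : ℝ≥0}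

instance : SecondCountableTopology (H O) :=
  have : Fact ((2 : ℝ≥0∞) ≠ ∞) := ⟨ENNReal.ofNat_ne_top⟩
  Lp.SecondCountableTopology

theorem weightedSq_eq_mul_hsNormSq (Q : Covariance O) (τ : ℝ≥0) (A : ℕ → H O) :
    weightedSq (fun k => τ * (Q.eig k).toNNReal) A = τ * hsNormSq Q A := by
  simp only [weightedSq, hsNormSq, ← ENNReal.tsum_mul_left, ENNReal.coe_mul, mul_assoc,
    ENNReal.ofReal]

theorem DiffusionAssumption.continuous (hG : DiffusionAssumption Q G L₆ L₇ L₈) (k : ℕ) :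
    Continuous fun x => G x k := by
  have hq := Q.eig_pos k
  refine LipschitzWith.continuous (K := Real.toNNReal √(L₆ / Q.eig k))
    (LipschitzWith.of_dist_le_mul fun x y => ?_)
  have hterm : ENNReal.ofReal (Q.eig k * ‖G x k - G y k‖ ^ 2) ≤
      ENNReal.ofReal (L₆ * ‖x - y‖ ^ 2) := by
    rw [ENNReal.ofReal_mul hq.le, ← enorm_sq_eq_ofReal]
    exact (ENNReal.le_tsum (f := fun k => ENNReal.ofReal (Q.eig k) * ‖G x k - G y k‖ₑ ^ 2)
      k).trans (hG.lipschitz x y)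
  rw [ENNReal.ofReal_le_ofReal_iff (mul_nonneg hG.L₆_nonneg (sq_nonneg _))] at hterm
  rw [dist_eq_norm, dist_eq_norm, Real.coe_toNNReal _ (Real.sqrt_nonneg _)]
  refine le_of_sq_le_sq ?_ (by positivity)
  rwa [mul_pow, Real.sq_sqrt (div_nonneg hG.L₆_nonneg hq.le), div_mul_eq_mul_div,
    le_div_iff₀' hq]

theorem DiffusionAssumption.weightedSq_sub_le (hG : DiffusionAssumption Q G L₆ L₇ L₈) (τ : ℝ≥0)
    (x y : H O) : weightedSq (fun k => τ * (Q.eig k).toNNReal) (fun k => G x k - G y k) ≤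
      ↑(τ * L₆.toNNReal) * ‖x - y‖ₑ ^ 2 := by
  rw [weightedSq_eq_mul_hsNormSq, ENNReal.coe_mul, mul_assoc, enorm_sq_eq_ofReal]
  gcongr
  exact (hG.lipschitz x y).trans_eq (ENNReal.ofReal_mul hG.L₆_nonneg)

theorem DiffusionAssumption.weightedSq_ne_top (hG : DiffusionAssumption Q G L₆ L₇ L₈) (τ : ℝ≥0)
    (x : H O) : weightedSq (fun k => τ * (Q.eig k).toNNReal) (G x) ≠ ∞ := by
  rw [weightedSq_eq_mul_hsNormSq]
  exact ENNReal.mul_ne_top ENNReal.coe_ne_top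
    ((hG.growth x).trans_lt ENNReal.ofReal_lt_top).ne

variable (hd : 1 ≤ d) (hd3 : d ≤ 3) (hO : MeasurableSet O) (hOb : Bornology.IsBounded O)
  (hf : DriftAssumption d f L₁ L₂ L₃ L₄ L₅ q) (hτ : 0 < τ)

include hd hd3 hO hOb hf hτ

theorem lipschitzWith_stepMap (hL₁ : L₁ < lambda1 O) :
    LipschitzWith (1 + τ * (lambda1 O - L₁)).toNNReal⁻¹ (stepMap O f τ) := by
  refine LipschitzWith.of_dist_le_mul fun w w' => ?_
  have hstep := isStep_stepMap hd hd3 hO hOb hf hτ hL₁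
  have hpos : 0 < 1 + τ * (lambda1 O - L₁) := add_pos one_pos (mul_pos hτ (sub_pos.2 hL₁))
  rw [NNReal.coe_inv, Real.coe_toNNReal _ hpos.le, dist_eq_norm, dist_eq_norm,
    ← div_eq_inv_mul, le_div_iff₀' hpos]
  exact (hstep w).norm_sub_le hO hOb hf.monotone hτ (hstep w')

theorem exists_isCompact_stepMap (hL₁ : L₁ < lambda1 O) (R : ℝ) :
    ∃ K, IsCompact K ∧ ∀ w, ‖w‖ ≤ R → stepMap O f τ w ∈ K := by
  set ρ := (1 + τ * (lambda1 O - L₁)).toNNReal⁻¹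
  obtain ⟨K, hK, hKmem⟩ := exists_isCompact_isStep hOb hf.coercive hτ hO
    (max R (ρ * R + ‖stepMap O f τ 0‖))
  refine ⟨K, hK, fun w hw => hKmem w _ (hw.trans (le_max_left _ _)) ?_
    (isStep_stepMap hd hd3 hO hOb hf hτ hL₁ w)⟩
  have hlip := (lipschitzWith_stepMap hd hd3 hO hOb hf hτ hL₁).norm_sub_le w 0
  rw [sub_zero] at hlip
  calc ‖stepMap O f τ w‖ ≤ ‖stepMap O f τ w - stepMap O f τ 0‖ + ‖stepMap O f τ 0‖ :=
        norm_le_norm_sub_add _ _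
    _ ≤ ρ * R + ‖stepMap O f τ 0‖ := by gcongr; exact hlip.trans (by gcongr)
    _ ≤ _ := le_max_right _ _

theorem isStep_iff_eq_stepMap (hL₁ : L₁ < lambda1 O) {x z y : H O} :
    IsStep O f τ x z y ↔ y = stepMap O f τ (x + z) := by
  have hstep := isStep_stepMap hd hd3 hO hOb hf hτ hL₁ (x + z)
  rw [isStep_iff_add]
  exact ⟨fun hy => hy.unique hO hOb hf.monotone hτ hL₁ hstep, fun hy => hy ▸ hstep⟩

variable (hG : DiffusionAssumption Q G L₆ L₇ L₈) (hL : L₁ + L₆ / 2 < lambda1 O) (hτ1 : τ < 1)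

omit hd hd3 hO hOb hf hτ in
include hG hL hτ1 in
theorem stepMap_rate_le : (1 + τ * (lambda1 O - L₁)).toNNReal⁻¹ *
      NNReal.sqrt (1 + τ * L₆.toNNReal) ≤
    (Real.exp (-(gamma6 (lambda1 O) L₁ L₆ * τ) / 2)).toNNReal := by
  have hL₆ := hG.L₆_nonneg
  have hpos : 0 < 1 + τ * (lambda1 O - L₁) :=
    add_pos_of_pos_of_nonneg one_pos (mul_nonneg τ.coe_nonneg (by linarith))
  have hexp := one_add_mul_le_exp_gamma6 hL₆ hL τ.coe_nonneg hτ1.le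
  rw [← NNReal.coe_le_coe]
  push_cast
  rw [Real.coe_toNNReal _ hpos.le, Real.coe_toNNReal _ hL₆, Real.coe_toNNReal _ (Real.exp_nonneg _),
    ← div_eq_inv_mul, div_le_iff₀ hpos, Real.sqrt_le_left (by positivity), mul_pow,
    ← Real.exp_nat_mul, Nat.cast_two, mul_div_cancel₀ _ two_ne_zero]
  exact hexp

/-- The drift-implicit Euler scheme with step size `τ`, driven by the increments `gridNoise`. -/
noncomputable def eulerScheme : ContractiveScheme (H O) where
  S := stepMap O f τ
  G := G
  σ k := τ * (Q.eig k).toNNReal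
  ρ := (1 + τ * (lambda1 O - L₁)).toNNReal⁻¹
  ℓ := τ * L₆.toNNReal
  κ := (Real.exp (-(gamma6 (lambda1 O) L₁ L₆ * τ) / 2)).toNNReal
  lipschitz_S := lipschitzWith_stepMap hd hd3 hO hOb hf hτ (by linarith [hG.L₆_nonneg])
  continuous_G := hG.continuous
  lipschitz_G := hG.weightedSq_sub_le τ
  weightedSq_G_zero := hG.weightedSq_ne_top τ 0
  le_rate := stepMap_rate_le hG hL hτ1
  rate_lt_one := by
    have := mul_pos (gamma6_pos hG.L₆_nonneg hL) (NNReal.coe_pos.2 hτ)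
    rw [Real.toNNReal_lt_one, Real.exp_lt_one_iff]
    linarith

variable {Ω : Type*} {mΩ : MeasurableSpace Ω} {𝓕 : Filtration ℝ≥0 mΩ} {P : Measure Ω}
  {W : ℝ≥0 → Ω → H O}

theorem isSolution_iff_isTrajectory {x : H O} {X : ℕ → Ω → H O} :
    IsSolution Q f G τ 𝓕 P W x X ↔ (eulerScheme hd hd3 hO hOb hf hτ hG hL hτ1).IsTrajectory
      (fun n => 𝓕 (n * τ)) P (gridNoise Q W τ) x X := by
  have hL₁ : L₁ < lambda1 O := by linarith [hG.L₆_nonneg]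
  constructor
  · rintro ⟨hinit, hadapted, hstep⟩
    simp only [isStep_iff_eq_stepMap hd hd3 hO hOb hf hτ hL₁] at hstep
    exact ⟨hinit, hadapted, hstep⟩
  · rintro ⟨hinit, hadapted, hstep⟩
    refine ⟨hinit, hadapted, ?_⟩
    simp only [isStep_iff_eq_stepMap hd hd3 hO hOb hf hτ hL₁]
    exact hstep

variable [IsProbabilityMeasure P] (hW : IsQWiener Q 𝓕 P W)

include hG hL hτ1 hW in
theorem exists_isSolution_ae_unique (x : H O) : ∃ X : ℕ → Ω → H O, IsSolution Q f G τ 𝓕 P W x X ∧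
    ∀ Y : ℕ → Ω → H O, IsSolution Q f G τ 𝓕 P W x Y → ∀ m, Y m =ᵐ[P] X m := by
  simp only [isSolution_iff_isTrajectory hd hd3 hO hOb hf hτ hG hL hτ1]
  obtain ⟨X, hX⟩ := ContractiveScheme.exists_isTrajectory
    (𝒮 := eulerScheme hd hd3 hO hOb hf hτ hG hL hτ1) (isWhite_infinitePi_gaussianReal _)
    (hW.isNoise_gridNoise τ) x
  exact ⟨X, hX, fun Y hY => hX.ae_eq hY⟩

variable {X : H O → ℕ → Ω → H O}

include hW in
theorem isFlow_eulerScheme (hX : ∀ x, IsSolution Q f G τ 𝓕 P W x (X x)) :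
    (eulerScheme hd hd3 hO hOb hf hτ hG hL hτ1).IsFlow (fun n => 𝓕 (n * τ)) P
      (Measure.infinitePi fun k => gaussianReal 0 (τ * (Q.eig k).toNNReal)) (gridNoise Q W τ) X :=
  ⟨isWhite_infinitePi_gaussianReal _, hW.isNoise_gridNoise τ, fun x =>
    (isSolution_iff_isTrajectory hd hd3 hO hOb hf hτ hG hL hτ1).1 (hX x)⟩

theorem abs_semigroup_sub_le {c : ℕ → Ω → ℕ → ℝ} {𝓖 : ℕ → MeasurableSpace Ω}
    {γ : Measure (ℕ → ℝ)} (h : (eulerScheme hd hd3 hO hOb hf hτ hG hL hτ1).IsFlow 𝓖 P γ c X)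
    {π : Measure (H O)} [IsProbabilityMeasure π] (hint : Integrable (fun y => y) π)
    (hπ : h.IsInvariant π) {φ : H O → ℝ} (hφ : IsLipB φ) (m : ℕ) (x : H O) :
    |semigroup P X m φ x - ∫ y, φ y ∂π| ≤
      Real.exp (-(gamma6 (lambda1 O) L₁ L₆ * (m * τ)) / 2) * lipSeminorm φ *
        ∫ y, ‖x - y‖ ∂π := by
  obtain ⟨C, hC⟩ := hφ.2
  have hlip := hφ.lipschitzWith
  have hmix := h.abs_transition_sub_le hint hπ
    (φ := .ofNormedAddCommGroup φ hlip.continuous C hC) hlip m x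
  have hpow : Real.exp (-(gamma6 (lambda1 O) L₁ L₆ * τ) / 2) ^ m =
      Real.exp (-(gamma6 (lambda1 O) L₁ L₆ * (m * τ)) / 2) := by
    rw [← Real.exp_nat_mul]
    ring_nf
  refine hmix.trans_eq ?_
  rw [← hpow, mul_comm (_ ^ m)]
  simp only [eulerScheme, Real.coe_toNNReal _ (lipSeminorm_nonneg φ),
    Real.coe_toNNReal _ (Real.exp_nonneg _)]

end Euler

end DIE

theorem theorem3p1_general {d : ℕ} (hd : 1 ≤ d) (hd3 : d ≤ 3)
    (O : Set (E d)) (hO : MeasurableSet O) (hOb : Bornology.IsBounded O)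
    (_hOi : (interior O).Nonempty)
    (f : ℝ → ℝ) (L₁ L₂ L₃ L₄ L₅ q : ℝ) (hf : DriftAssumption d f L₁ L₂ L₃ L₄ L₅ q)
    (Q : Covariance O) (G : H O → ℕ → H O) (L₆ L₇ L₈ : ℝ)
    (hG : DiffusionAssumption Q G L₆ L₇ L₈) (hL : L₁ + L₆ / 2 < lambda1 O)
    {Ω : Type*} {mΩ : MeasurableSpace Ω} (𝓕 : Filtration ℝ≥0 mΩ)
    (P : Measure Ω) [IsProbabilityMeasure P]
    (W : ℝ≥0 → Ω → H O) (hW : IsQWiener Q 𝓕 P W)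
    (τ : ℝ≥0) (hτ : 0 < τ) (hτ1 : τ < 1) :
    (∀ x : H O, ∃ X : ℕ → Ω → H O, IsSolution Q f G τ 𝓕 P W x X ∧
      ∀ Y : ℕ → Ω → H O, IsSolution Q f G τ 𝓕 P W x Y → ∀ m, Y m =ᵐ[P] X m) ∧
    0 < gamma6 (lambda1 O) L₁ L₆ ∧
    ∀ X : H O → ℕ → Ω → H O, (∀ x, IsSolution Q f G τ 𝓕 P W x (X x)) →
      ∃ π : Measure (H O), IsInvariantMeasure P X π ∧
        (∀ μ : Measure (H O), IsInvariantMeasure P X μ → μ = π) ∧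
        (∀ x : H O, Integrable (fun y => ‖x - y‖) π) ∧
        ∀ (m : ℕ) (x : H O) (φ : H O → ℝ), IsLipB φ →
          |semigroup P X m φ x - ∫ y, φ y ∂π| ≤
            Real.exp (-(gamma6 (lambda1 O) L₁ L₆ * (m * τ)) / 2) * lipSeminorm φ *
              ∫ y, ‖x - y‖ ∂π := by
  refine ⟨exists_isSolution_ae_unique hd hd3 hO hOb hf hτ hG hL hτ1 hW, gamma6_pos hG.L₆_nonneg hL,
    fun X hX => ?_⟩
  have hL₁ : L₁ < lambda1 O := by linarith [hG.L₆_nonneg]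
  have hflow := isFlow_eulerScheme hd hd3 hO hOb hf hτ hG hL hτ1 hW hX
  obtain ⟨π, hint, hπ⟩ :=
    hflow.exists_isInvariant (exists_isCompact_stepMap hd hd3 hO hOb hf hτ hL₁)
  refine ⟨π, ⟨π.2, hπ⟩, fun μ hμ => ?_, fun x => ((integrable_const x).sub hint).norm,
    fun m x φ hφ => abs_semigroup_sub_le hd hd3 hO hOb hf hτ hG hL hτ1 hflow hint hπ hφ m x⟩
  exact congrArg Subtype.val (hflow.eq_of_isInvariant (μ := ⟨μ, hμ.1⟩) hint hπ hμ.2)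

theorem theorem3p1 {d : ℕ} (hd : 1 ≤ d) (hd3 : d ≤ 3)
    (O : Set (E d)) (hO : IsOpen O) (hOb : Bornology.IsBounded O) (hOn : O.Nonempty)
    (f : ℝ → ℝ) (L₁ L₂ L₃ L₄ L₅ q : ℝ) (hf : DriftAssumption d f L₁ L₂ L₃ L₄ L₅ q)
    (Q : Covariance O) (g : ℝ → ℝ) (G : H O → ℕ → H O) (hgG : IsNemytskii Q g G)
    (L₆ L₇ L₈ : ℝ) (hG : DiffusionAssumption Q G L₆ L₇ L₈)
    (hL : max (L₁ + L₆ / 2) (L₂ + L₇ / 2) < lambda1 O)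
    {Ω : Type*} {mΩ : MeasurableSpace Ω} (𝓕 : Filtration ℝ≥0 mΩ)
    (P : Measure Ω) [IsProbabilityMeasure P]
    (W : ℝ≥0 → Ω → H O) (hW : IsQWiener Q 𝓕 P W)
    (τ : ℝ≥0) (hτ : 0 < τ) (hτ1 : τ < 1) :
    -- the scheme is well-posed
    (∀ x : H O, ∃ X : ℕ → Ω → H O, IsSolution Q f G τ 𝓕 P W x X ∧
      ∀ Y : ℕ → Ω → H O, IsSolution Q f G τ 𝓕 P W x Y → ∀ m, Y m =ᵐ[P] X m) ∧
    0 < gamma6 (lambda1 O) L₁ L₆ ∧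
    -- it has a unique invariant measure, which is exponentially mixing
    ∀ X : H O → ℕ → Ω → H O, (∀ x, IsSolution Q f G τ 𝓕 P W x (X x)) →
      ∃ π : Measure (H O), IsInvariantMeasure P X π ∧
        (∀ μ : Measure (H O), IsInvariantMeasure P X μ → μ = π) ∧
        (∀ x : H O, Integrable (fun y => ‖x - y‖) π) ∧
        ∀ (m : ℕ) (x : H O) (φ : H O → ℝ), IsLipB φ →
          |semigroup P X m φ x - ∫ y, φ y ∂π| ≤
            Real.exp (-(gamma6 (lambda1 O) L₁ L₆ * (m * τ)) / 2) * lipSeminorm φ *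
              ∫ y, ‖x - y‖ ∂π :=
  theorem3p1_general hd hd3 O hO.measurableSet hOb (hO.interior_eq.symm ▸ hOn) f L₁ L₂ L₃ L₄ L₅ q
    hf Q G L₆ L₇ L₈ hG ((le_max_left _ _).trans_lt hL) 𝓕 P W hW τ hτ hτ1
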